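/- Let $X,U,W$ be complex Hilbert spaces, $a$ a closed positive form with dense domain $V\subset X$, such that $V$ is a Hilbert space for the inner product $a$, continuously embedded in $X$; let $A\in\mathcal L(V,V')$, $\langle Ax,v\rangle=a(x,v)$ (so that its part in $X$ is the positive self-adjoint operator associated with $a$), and let $B\in\mathcal L(U,V')$ with adjoint $B^*\in\mathcal L(V,U)$, where $V'$ is the antidual of $V$ and $X\subset V'$. Let $C$ be a skew-adjoint operator on $U$, $D\in\mathcal L(W,D(C)')$ with adjoint $D^*\in\mathcal L(D(C),W)$, and extend $D^*$ by $D^*u:=\lim_{s\to+\infty}D^*(I-s^{-2}C^2)^{-1}u$ to those $u\in U$ for which this limit exists in $W$. Let $\widehat C$ be an m-dissipative operator on $U$ with $\widehat C=-C-DD^*$, i.e. $u\in D(\widehat C)$ and $\widehat Cu=f\in U$ if and only if $D^*u$ exists and $f=-Cu-DD^*u$ in $D(C)'$. Let $\mathcal H=V\times X\times U$ with $\|(x,y,u)\|_{\mathcal H}^2=a(x,x)+\|y\|_X^2+\|u\|_U^2$, let $$\mathcal A_d(x,y,u)=(y,\,-Ax-Bu,\,B^*y+\widehat Cu),\qquad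 \mathcal D(\mathcal A_d)=\{(x,y,u)\in V\times V\times D(\widehat C):\ Ax+Bu\in X\},$$ with graph norm $\|z\|_{\mathcal D(\mathcal A_d)}^2=\|z\|_{\mathcal H}^2+\|\mathcal A_dz\|_{\mathcal H}^2$, and let $\mathcal A_c$ be the operator obtained by replacing $\widehat C$ by $-C$. For $z_0\in\mathcal D(\mathcal A_d)$ let $z\in C([0,\infty),\mathcal D(\mathcal A_d))\cap C^1([0,\infty),\mathcal H)$ be the solution of $z'=\mathcal A_dz$, $z(0)=z_0$, let $E(t)=\frac12\|z(t)\|_{\mathcal H}^2$, and let $z_1=(x_1,y_1,u_1)$ be the (mild) solution of $z_1'=\mathcal A_cz_1$, $z_1(0)=z_0$. Here $D^*u_1\in L^2(0,T;W)$ denotes the function with $\int_0^tD^*u_1\,ds=D^*\int_0^tu_1\,ds$ for all $t\in[0,T]$ (it is $t\mapsto D^*u_1(t)$ if $z_0\in\mathcal D(\mathcal A_c)$); the lower bounds below are required whenever this function exists. Assume that either $D\in\mathcal L(W,U)$, or **(H)** for every $\lambda\in\mathbb C$ with $\operatorname{Re}\lambda>0$, $H(\lambda)=-D^*\big(\lambda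 I+C+\lambda B^*(\lambda^2+A)^{-1}B\big)^{-1}D$ is a bounded operator on $W$, and for some $\beta>0$ the function $H$ is bounded on the line $\operatorname{Re}\lambda=\beta$. Let $\theta\in(0,1)$ and let $\mathcal H_1,\mathcal H_2$ be Banach spaces with $\mathcal D(\mathcal A_d)\subset\mathcal H_1\subset\mathcal H\subset\mathcal H_2$, the last two inclusions being continuous, such that $\|\cdot\|_{\mathcal D(\mathcal A_d)}\sim\|\cdot\|_{\mathcal H_1}$ on $\mathcal D(\mathcal A_d)$ and $[\mathcal H_1;\mathcal H_2]_\theta=\mathcal H$ with equivalent norms (complex interpolation). Let $T>0$ and $c>0$. 1. Let $G:[0,\infty)\to[0,\infty)$ be a continuous increasing bijection such that $x\mapsto x^{-\theta/(1-\theta)}G(x)$ is nondecreasing on $(0,1)$. If for all nonzero $z_0\in\mathcal D(\mathcal A_d)$ $$\int_0^T\|D^*u_1(s)\|_W^2\,ds\ \ge\ c\,\|z_0\|_{\mathcal H}^2\,G\!\left(\frac{\|z_0\|_{\mathcal H_2}^2}{\|z_0\|_{\mathcal H}^2}\right),$$ then there is a constant $K>0$ such that for all $z_0\in\mathcal D(\mathcal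 A_d)$ and all $t\ge0$ $$E(t)\le K\left[G^{-1}\!\left(\frac1{1+t}\right)\right]^{\frac{\theta}{1-\theta}}\|z_0\|_{\mathcal D(\mathcal A_d)}^2 .$$ 2. If for all nonzero $z_0\in\mathcal D(\mathcal A_d)$ $$\int_0^T\|D^*u_1(s)\|_W^2\,ds\ \ge\ c\,\|z_0\|_{\mathcal H_2}^2,$$ then there is a constant $K>0$ such that for all $z_0\in\mathcal D(\mathcal A_d)$ and all $t\ge0$ $$E(t)\le \frac{K}{(1+t)^{\theta/(1-\theta)}}\,\|z_0\|_{\mathcal D(\mathcal A_d)}^2 .$$ -/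

import Mathlib

open Filter Topology MeasureTheory Set
open scoped NNReal

/-- The antidual `E'` of a complex normed space: bounded conjugate-linear functionals.
For `u ∈ U` Hilbert, `U ⊂ E'` through `u ↦ ⟨·, u⟩` whenever `E ⊂ U`
(Mathlib's `inner ℂ v u` is linear in `u` and conjugate-linear in `v`). -/
abbrev AntiDual (E : Type*) [NormedAddCommGroup E] [NormedSpace ℂ E] : Type _ := E →L⋆[ℂ] ℂ

/-- The adjoint `T* ∈ L(E, K)` of `T ∈ L(K, E')`, for a Hilbert space `K` identified with its
dual. -/
noncomputable def dualAdjoint {K E : Type*} [NormedAddCommGroup K] [InnerProductSpace ℂ K]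
    [CompleteSpace K] [NormedAddCommGroup E] [NormedSpace ℂ E] (T : K →L[ℂ] AntiDual E) :
    E →L[ℂ] K :=
  ((InnerProductSpace.toDual ℂ K).symm.toContinuousLinearEquiv :
    StrongDual ℂ K →L⋆[ℂ] K).comp T.flip

theorem inner_dualAdjoint {K E : Type*} [NormedAddCommGroup K] [InnerProductSpace ℂ K]
    [CompleteSpace K] [NormedAddCommGroup E] [NormedSpace ℂ E] (T : K →L[ℂ] AntiDual E)
    (e : E) (k : K) : inner ℂ (dualAdjoint T e) k = T k e := by
  change inner ℂ ((InnerProductSpace.toDual ℂ K).symm (T.flip e)) k = T k e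
  rw [InnerProductSpace.toDual_symm_apply]
  rfl

/-! ### Unbounded operators and Cauchy problems -/

/-- `C` is skew-adjoint: densely defined with `C* = -C`. -/
def IsSkewAdjointOp {U : Type*} [NormedAddCommGroup U] [InnerProductSpace ℂ U] [CompleteSpace U]
    (C : U →ₗ.[ℂ] U) : Prop :=
  Dense (C.domain : Set U) ∧ C.adjoint = -C

/-- `C` is m-dissipative: dissipative, and `s - C` is onto for some `s > 0`. -/
def IsMDissipative {U : Type*} [NormedAddCommGroup U] [InnerProductSpace ℂ U]
    (C : U →ₗ.[ℂ] U) : Prop :=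
  (∀ u : C.domain, (inner ℂ (u : U) (C u)).re ≤ 0) ∧
    ∃ s : ℝ, 0 < s ∧ ∀ f : U, ∃ u : C.domain, (s : ℂ) • (u : U) - C u = f

/-- The square of the (Hilbertian) graph norm `‖z‖_{D(A)}² = ‖z‖² + ‖A z‖²`. -/
noncomputable def graphNormSq {E : Type*} [NormedAddCommGroup E] [NormedSpace ℂ E]
    (A : E →ₗ.[ℂ] E) (z : A.domain) : ℝ :=
  ‖(z : E)‖ ^ 2 + ‖A z‖ ^ 2

/-- `z` is the solution of `z' = A z`, `z 0 = z₀` in the class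
`C([0,∞), D(A)) ∩ C¹([0,∞), E)`. -/
def IsClassicalSolution {E : Type*} [NormedAddCommGroup E] [NormedSpace ℂ E]
    (A : E →ₗ.[ℂ] E) (z₀ : E) (z : ℝ → E) : Prop :=
  z 0 = z₀ ∧ ∃ z' : ℝ → E, ContinuousOn z' (Ici 0) ∧
    ∀ t : ℝ, 0 ≤ t → (z t, z' t) ∈ A.graph ∧ HasDerivWithinAt z (z' t) (Ici 0) t

/-- `z` is the mild solution of `z' = A z`, `z 0 = z₀`: it is continuous on `[0,∞)`, and for all
`t ≥ 0`, `∫₀ᵗ z` lies in `D(A)` with `z t = z₀ + A ∫₀ᵗ z`. -/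
def IsMildSolution {E : Type*} [NormedAddCommGroup E] [NormedSpace ℂ E]
    (A : E →ₗ.[ℂ] E) (z₀ : E) (z : ℝ → E) : Prop :=
  ContinuousOn z (Ici 0) ∧
    ∀ t : ℝ, 0 ≤ t → ((∫ s in (0 : ℝ)..t, z s), z t - z₀) ∈ A.graph

/-! ### The second order system with dynamic feedback

`V` is a Hilbert space whose inner product is the form `a`, embedded in `X` by `j`; the operator
`A : V → V'` is `⟨A x, v⟩ = a(x, v)`, that is `inner ℂ v x`. -/

/-- The energy space `V × X × U` with its Hilbertian product norm. -/
abbrev EnergySpace (V X U : Type*) : Type _ := WithLp 2 (V × WithLp 2 (X × U))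

section System

variable {V X U W : Type*}
  [NormedAddCommGroup V] [InnerProductSpace ℂ V]
  [NormedAddCommGroup X] [InnerProductSpace ℂ X]
  [NormedAddCommGroup U] [InnerProductSpace ℂ U] [CompleteSpace U]
  [NormedAddCommGroup W] [InnerProductSpace ℂ W] [CompleteSpace W]

/-- The graph of `(x, y, u) ↦ (y, -A x - B u, B* y + S u)` on
`{(x, y, u) ∈ V × V × D(S) : A x + B u ∈ X}`; see `mem_systemGraph`. -/
def systemGraph (j : V →L[ℂ] X) (B : U →L[ℂ] AntiDual V) (S : U →ₗ.[ℂ] U) :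
    Submodule ℂ (EnergySpace V X U × EnergySpace V X U) where
  carrier := {p | j p.2.fst = p.1.snd.fst ∧
    (∀ v : V, inner ℂ v p.1.fst + B p.1.snd.snd v = -inner ℂ (j v) p.2.snd.fst) ∧
    (p.1.snd.snd, p.2.snd.snd - dualAdjoint B p.2.fst) ∈ S.graph}
  zero_mem' := by
    refine ⟨by simp, fun v => by simp, ?_⟩
    convert S.graph.zero_mem using 1
    simp
  add_mem' := by
    rintro p q ⟨hp1, hp2, hp3⟩ ⟨hq1, hq2, hq3⟩
    refine ⟨by simp [hp1, hq1], fun v => ?_, ?_⟩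
    · have h1 := hp2 v
      have h2 := hq2 v
      simp only [Prod.fst_add, Prod.snd_add, WithLp.add_fst, WithLp.add_snd, inner_add_right,
        map_add, add_apply]
      linear_combination h1 + h2
    · convert S.graph.add_mem hp3 hq3 using 1
      ext
      · simp
      · simp
        abel
  smul_mem' := by
    rintro c p ⟨hp1, hp2, hp3⟩
    refine ⟨by simp [hp1], fun v => ?_, ?_⟩
    · have h1 := hp2 v
      simp only [Prod.smul_fst, Prod.smul_snd, WithLp.smul_fst, WithLp.smul_snd, inner_smul_right,
        map_smul, smul_apply, smul_eq_mul]
      linear_combination c * h1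
    · convert S.graph.smul_mem c hp3 using 1
      ext
      · simp
      · simp [smul_sub]

theorem mem_systemGraph (j : V →L[ℂ] X) (B : U →L[ℂ] AntiDual V) (S : U →ₗ.[ℂ] U)
    (z z' : EnergySpace V X U) :
    (z, z') ∈ systemGraph j B S ↔
      ∃ (y : V) (hu : z.snd.snd ∈ S.domain) (f : X),
        z.snd.fst = j y ∧
        (∀ v : V, inner ℂ v z.fst + B z.snd.snd v = inner ℂ (j v) f) ∧
        z'.fst = y ∧ z'.snd.fst = -f ∧ z'.snd.snd = dualAdjoint B y + S ⟨z.snd.snd, hu⟩ := by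
  constructor
  · rintro ⟨h1, h2, h3⟩
    rw [LinearPMap.mem_graph_iff] at h3
    obtain ⟨u, hu, hS⟩ := h3
    have hu' : (u : U) = z.snd.snd := hu
    refine ⟨z'.fst, hu' ▸ u.2, -z'.snd.fst, h1.symm, fun v => ?_, rfl, by simp, ?_⟩
    · rw [inner_neg_right]
      exact h2 v
    · have hu'' : u = ⟨z.snd.snd, hu' ▸ u.2⟩ := Subtype.ext hu'
      rw [← hu'', hS]
      simp
  · rintro ⟨y, hu, f, h1, h2, h3, h4, h5⟩
    refine ⟨by simp [h1, h3], fun v => ?_, ?_⟩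
    · simp only [h4, inner_neg_right, neg_neg]
      exact h2 v
    · rw [LinearPMap.mem_graph_iff]
      exact ⟨⟨z.snd.snd, hu⟩, rfl, by simp [h3, h5]⟩

/-- The operator `(x, y, u) ↦ (y, -A x - B u, B* y + S u)` in `V × X × U` with domain
`{(x, y, u) ∈ V × V × D(S) : A x + B u ∈ X}`. It is `𝒜_d` for `S = Ĉ` and `𝒜_c` for `S = -C`. -/
noncomputable def systemOp (j : V →L[ℂ] X) (B : U →L[ℂ] AntiDual V) (S : U →ₗ.[ℂ] U) :
    EnergySpace V X U →ₗ.[ℂ] EnergySpace V X U :=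
  (systemGraph j B S).toLinearPMap

/-- If `V` is dense in `X` and embedded injectively, `systemOp` really has the graph above. -/
theorem systemOp_graph (j : V →L[ℂ] X) (hj : Function.Injective j) (hd : DenseRange j)
    (B : U →L[ℂ] AntiDual V) (S : U →ₗ.[ℂ] U) :
    (systemOp j B S).graph = systemGraph j B S := by
  apply Submodule.toLinearPMap_graph_eq
  rintro ⟨z, z'⟩ hz (h0 : z = 0)
  subst h0
  obtain ⟨y, hu, f, h1, h2, h3, h4, h5⟩ := (mem_systemGraph j B S 0 z').1 hz
  have hy : y = 0 := hj (by simpa using h1.symm)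
  have hf : f = 0 := by
    refine hd.eq_zero_of_inner_right ℂ (fun v => ?_)
    simpa using (h2 v).symm
  have hS : S ⟨(0 : EnergySpace V X U).snd.snd, hu⟩ = 0 := S.map_zero
  rw [hS, hy] at h5
  subst hy hf
  apply (WithLp.ofLp_injective 2)
  ext1
  · exact h3
  · apply (WithLp.ofLp_injective 2)
    ext1
    · simpa using h4
    · simpa using h5

/-! ### The damping `D D*`

`D(C)` with its graph norm is the submodule `C.graph` of `U × U`; an element of it is a pair
`(u, C u)`. Hence `D ∈ L(W, D(C)')` has an adjoint `dualAdjoint D ∈ L(D(C), W)`. -/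

/-- `w = D* u` for `u ∈ U` possibly outside `D(C)`: `w` is the limit in `W`, as `s → ∞`, of
`D* r(s)`, where `r(s) ∈ D(C²)` solves `r(s) - s⁻² C² r(s) = u`.

For `u ∈ D(C)` this is the value of `D*` at `u`, since `r(s) → u` in `D(C)`; if `D` is bounded from
`W` to `U`, or to the dual of `D(|C|^{1/2})`, it is the extension of `D*` by continuity to `U`, or
to `D(|C|^{1/2})`. -/
def HasDStar (C : U →ₗ.[ℂ] U) (D : W →L[ℂ] AntiDual C.graph) (u : U) (w : W) : Prop :=
  ∃ r : ℝ → C.graph,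
    (∀ s : ℝ, 0 < s → ∃ q : U, ((r s).1.2, q) ∈ C.graph ∧
      (r s).1.1 - (((s ^ 2)⁻¹ : ℝ) : ℂ) • q = u) ∧
    Tendsto (fun s => dualAdjoint D (r s)) atTop (𝓝 w)

/-- `Ĉ = -C - D D*`: one has `u ∈ D(Ĉ)` and `Ĉ u = f ∈ U` exactly when `D* u` exists and
`f = -C u - D D* u` in `D(C)'`, where `⟨C u, v⟩ = -⟨u, C v⟩` for `u ∈ U`, `v ∈ D(C)`. -/
def IsSkewPlusDamping (Chat C : U →ₗ.[ℂ] U) (D : W →L[ℂ] AntiDual C.graph) : Prop :=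
  ∀ u f : U, (u, f) ∈ Chat.graph ↔
    ∃ w : W, HasDStar C D u w ∧ ∀ v : C.graph, inner ℂ v.1.1 f = inner ℂ v.1.2 u - D w v

/-- `D ∈ L(W, U)`. -/
def IsBoundedDamping (C : U →ₗ.[ℂ] U) (D : W →L[ℂ] AntiDual C.graph) : Prop :=
  ∃ D₀ : W →L[ℂ] U, ∀ (w : W) (v : C.graph), D w v = inner ℂ v.1.1 (D₀ w)

/-- `h = H(l) w` with `H(l) = -D* (l + C + l B* (l² + A)⁻¹ B)⁻¹ D`. Here
`x = (l² + A)⁻¹ B u` (an equation in `V'`), `(l + C) u + l B* x = D w` (an equation in `D(C)'`),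
and `h = -D* u`. -/
def IsTransferValue (j : V →L[ℂ] X) (B : U →L[ℂ] AntiDual V) (C : U →ₗ.[ℂ] U)
    (D : W →L[ℂ] AntiDual C.graph) (l : ℂ) (w h : W) : Prop :=
  ∃ (u : U) (x : V),
    (∀ v : V, inner ℂ (j v) (l ^ 2 • j x) + inner ℂ v x = B u v) ∧
    (∀ v : C.graph, inner ℂ v.1.1 (l • u + l • dualAdjoint B x) - inner ℂ v.1.2 u = D w v) ∧
    HasDStar C D u (-h)

/-- The transfer function estimate: `H(l) ∈ L(W)` is defined for all `l` with `Re l > 0`, and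
is bounded on a line `Re l = β`, `β > 0`. -/
def TransferEstimate (j : V →L[ℂ] X) (B : U →L[ℂ] AntiDual V) (C : U →ₗ.[ℂ] U)
    (D : W →L[ℂ] AntiDual C.graph) : Prop :=
  ∃ H : ℂ → (W →L[ℂ] W),
    (∀ l : ℂ, 0 < l.re → ∀ w : W, IsTransferValue j B C D l w (H l w)) ∧
    ∃ β : ℝ, 0 < β ∧ ∃ M : ℝ, ∀ l : ℂ, l.re = β → ‖H l‖ ≤ M

/-- `y = D* u₁` on `(0, T)` as an element of `L²(0, T; W)`, for `u₁` the last component of a mild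
solution of the conservative system: `∫₀ᵗ u₁ ∈ D(C)` and `D* ∫₀ᵗ u₁ = ∫₀ᵗ y` for all `t ∈ [0, T]`.
When `u₁` is continuous with values in `D(C)` this says `y(t) = D* u₁(t)` for a.e. `t`. -/
def IsOutput (C : U →ₗ.[ℂ] U) (D : W →L[ℂ] AntiDual C.graph) (T : ℝ) (u₁ : ℝ → U)
    (y : ℝ → W) : Prop :=
  MemLp y 2 (volume.restrict (Ioc 0 T)) ∧
    ∀ t ∈ Icc 0 T, ∃ p : C.graph, p.1.1 = ∫ s in (0 : ℝ)..t, u₁ s ∧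
      dualAdjoint D p = ∫ s in (0 : ℝ)..t, y s

/-- `D* u₁` on `(0, T)` satisfies `∫₀ᵀ ‖D* u₁‖² ≥ m`, for the solution `(x₁, y₁, u₁)` of the
conservative system with initial datum `z₀`. -/
def ObservedBelow (j : V →L[ℂ] X) (B : U →L[ℂ] AntiDual V) (C : U →ₗ.[ℂ] U)
    (D : W →L[ℂ] AntiDual C.graph) (T : ℝ) (z₀ : EnergySpace V X U) (m : ℝ) : Prop :=
  ∀ (z₁ : ℝ → EnergySpace V X U) (y : ℝ → W), IsMildSolution (systemOp j B (-C)) z₀ z₁ →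
    IsOutput C D T (fun s => (z₁ s).snd.snd) y → m ≤ ∫ s in (0 : ℝ)..T, ‖y s‖ ^ 2

end System

/-! ### Complex interpolation of a couple `E₀ ⊂ E₁` -/

section Interpolation

variable {E₀ E₁ : Type*} [NormedAddCommGroup E₀] [NormedSpace ℂ E₀]
  [NormedAddCommGroup E₁] [NormedSpace ℂ E₁]

/-- `x = f(θ)` for some `f` bounded and continuous on the strip `0 ≤ Re ζ ≤ 1` with values in
`E₀ + E₁ = E₁`, holomorphic inside, with `f(it)` continuous into `E₀` and bounded there by `M`, and
`f(1 + it)` bounded by `M` in `E₁`. -/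
def InterpBound (i : E₀ →L[ℂ] E₁) (θ : ℝ) (x : E₁) (M : ℝ) : Prop :=
  ∃ (f : ℂ → E₁) (f₀ : ℝ → E₀),
    ContinuousOn f {ζ : ℂ | 0 ≤ ζ.re ∧ ζ.re ≤ 1} ∧
    (∃ K : ℝ, ∀ ζ : ℂ, 0 ≤ ζ.re → ζ.re ≤ 1 → ‖f ζ‖ ≤ K) ∧
    DifferentiableOn ℂ f {ζ : ℂ | 0 < ζ.re ∧ ζ.re < 1} ∧
    Continuous f₀ ∧ (∀ t : ℝ, f (t * Complex.I) = i (f₀ t)) ∧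
    (∀ t : ℝ, ‖f₀ t‖ ≤ M) ∧ (∀ t : ℝ, ‖f (1 + t * Complex.I)‖ ≤ M) ∧
    f θ = x

/-- The norm of the complex interpolation space `[E₀; E₁]_θ`. -/
noncomputable def interpNorm (i : E₀ →L[ℂ] E₁) (θ : ℝ) (x : E₁) : ℝ :=
  sInf {M : ℝ | InterpBound i θ x M}

/-- `[E₀; E₁]_θ = E` for `E₀ ⊂ E ⊂ E₁`: same elements, equivalent norms. -/
def IsInterpolationSpace {E : Type*} [NormedAddCommGroup E] [NormedSpace ℂ E]
    (ι₁ : E₀ →L[ℂ] E) (ι₂ : E →L[ℂ] E₁) (θ : ℝ) : Prop :=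
  (∀ x : E₁, (∃ M : ℝ, InterpBound (ι₂ ∘L ι₁) θ x M) ↔ x ∈ range ι₂) ∧
    ∃ c K : ℝ, 0 < c ∧ ∀ x : E,
      c * ‖x‖ ≤ interpNorm (ι₂ ∘L ι₁) θ (ι₂ x) ∧ interpNorm (ι₂ ∘L ι₁) θ (ι₂ x) ≤ K * ‖x‖

end Interpolation

/-! ### Plancherel's theorem for integrable, square integrable functions -/

section Plancherel
open scoped FourierTransform SchwartzMap ContDiff

variable {F : Type*} [NormedAddCommGroup F] [InnerProductSpace ℂ F] [CompleteSpace F]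

/-! The damped system dissipates exactly `‖D* u‖²`, whereas the hypothesis bounds from below the
output `D* u₁` of the conservative system. The first half of the proof controls the second output by
the first. Both solutions start at `z₀`, so in the difference of their Laplace transforms the datum
cancels, and the difference of the `U`-components solves the transfer equation with source `D g^`,
where `g = D* u` is the damped output. On a line `Re l = β` the bound on `H` (or, for bounded `D`, a
direct coercivity estimate) then gives `‖(D* u₁)^‖ ≤ (1 + M) ‖g^‖`. Plancherel turns this into a
weighted `L²` bound on `(0, ∞)`, which also shows that the output of the conservative mild solution
exists (`exists_output`, `exists_conservative_output`).

The price of working on a vertical line is that the right side involves all times, with weight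
`e^{-2βs}`. Cutting `(0, ∞)` into intervals of length `T`, and using the energy identity on each of
them, bounds the observed quantity by a geometric sum of energy drops, with ratio `q = e^{-2βT}`
(`observedBelow_le_tsum`).

The second half is real analysis. Interpolation gives `‖z‖ ≤ K ‖z‖₁^{1-θ} ‖z‖₂^θ`, and the graph
norm does not increase along damped solutions. The weak norm is therefore bounded below by a power
of the energy, and with `e n = ‖z(nT)‖² / N`, `N` the squared graph norm of the datum, one gets `e n
F(e n) ≤ K Σ q^k (e (n+k) - e (n+k+1))`, where `F(x)` is `G(κ x^r)` or `κ x^r`, `r = (1-θ)/θ`. The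
averages `s n = (1-q) Σ q^k e (n+k)` are comparable to `e n` and satisfy the one-step inequality `s
n - s (n+1) ≥ δ s n F(s n)`, which forces `F(s n) = O(1/n)`. Inverting `F` gives the stated rates.

Since an output has to be exhibited, the conservative mild solution is constructed as well, by
Yosida approximation. -/

theorem fourier_toLp_ae_eq {f : ℝ → F} (hf : Integrable f) (hf2 : MemLp f 2) :
    ((𝓕 (hf2.toLp f) : Lp F 2 (volume : Measure ℝ)) : ℝ → F) =ᵐ[volume] 𝓕 f := by
  have hcont : Continuous (𝓕 f) := VectorFourier.fourierIntegral_continuous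
    Real.continuous_fourierChar (by exact continuous_inner) hf
  -- The `L²` transform is only known as a tempered distribution here. Tested against a smooth
  -- compactly supported `g`, it and the integral transform both give the integral of `𝓕 g` against
  -- `f`.
  refine ae_eq_of_integral_contDiff_smul_eq ?_ hcont.locallyIntegrable ?_
  · exact (Lp.memLp _).locallyIntegrable (by norm_num)
  intro g hg hgc
  have hgc' : HasCompactSupport (fun x => (g x : ℂ)) := hgc.comp_left (g := fun x : ℝ => (x : ℂ)) rfl
  have hg' : ContDiff ℝ ∞ (fun x => (g x : ℂ)) := by
    exact Complex.ofRealCLM.contDiff.comp hg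
  let ψ : 𝓢(ℝ, ℂ) := hgc'.toSchwartzMap (by exact hg')
  have hψ : ∀ x, ψ x = (g x : ℂ) := fun x => rfl
  have h1 := congrArg (fun T => T ψ) (Lp.fourier_toTemperedDistribution_eq (hf2.toLp f))
  simp only [TemperedDistribution.fourier_apply, Lp.toTemperedDistribution_apply] at h1
  have h2 : ∫ x, g x • ((𝓕 (hf2.toLp f) : Lp F 2 (volume : Measure ℝ)) : ℝ → F) x
      = ∫ x, (𝓕 ψ) x • f x := by
    have h4 : ∫ x, g x • ((𝓕 (hf2.toLp f) : Lp F 2 (volume : Measure ℝ)) : ℝ → F) x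
        = ∫ x, ψ x • ((𝓕 (hf2.toLp f) : Lp F 2 (volume : Measure ℝ)) : ℝ → F) x :=
      integral_congr_ae (ae_of_all _ fun x => by simp only [hψ]; exact (Complex.coe_smul _ _).symm)
    rw [h4, ← h1]
    exact integral_congr_ae (hf2.coeFn_toLp.mono fun x hx => by simp only [hx])
  rw [h2]
  have h3 := VectorFourier.integral_fourierIntegral_smul_eq_flip (L := innerₗ ℝ) (μ := volume)
    (ν := volume) (f := ψ) (g := f)
    Real.continuous_fourierChar (by exact continuous_inner) ψ.integrable hf
  simp only [SchwartzMap.fourier_coe]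
  refine Eq.trans ?_ (h3.trans ?_)
  · rfl
  · rw [flip_innerₗ]
    refine integral_congr_ae (ae_of_all _ fun x => ?_)
    simp only [hψ]
    exact (Complex.coe_smul _ _)

theorem memLp_fourier {f : ℝ → F} (hf : Integrable f) (hf2 : MemLp f 2) : MemLp (𝓕 f) 2 :=
  (memLp_congr_ae (fourier_toLp_ae_eq hf hf2)).1 (Lp.memLp _)

theorem toLp_fourier {f : ℝ → F} (hf : Integrable f) (hf2 : MemLp f 2) :
    (memLp_fourier hf hf2).toLp = 𝓕 (hf2.toLp f) := by
  apply Lp.ext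
  exact (MemLp.coeFn_toLp _).trans (fourier_toLp_ae_eq hf hf2).symm

theorem eLpNorm_fourier {f : ℝ → F} (hf : Integrable f) (hf2 : MemLp f 2) :
    eLpNorm (𝓕 f) 2 = eLpNorm f 2 := by
  have h := Lp.norm_fourier_eq (hf2.toLp f)
  rw [← toLp_fourier hf hf2, Lp.norm_toLp, Lp.norm_toLp,
    ENNReal.toReal_eq_toReal_iff' (memLp_fourier hf hf2).2.ne hf2.2.ne] at h
  exact h

end Plancherel

/-! ### Multipliers of Steklov averages -/

theorem Complex.norm_one_sub_exp_neg_le {z : ℂ} (hz : 0 ≤ z.re) : ‖1 - Complex.exp (-z)‖ ≤ ‖z‖ := by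
  have h := Convex.norm_image_sub_le_of_norm_deriv_le (𝕜 := ℂ) (f := fun w => Complex.exp (-w))
    (s := {w : ℂ | 0 ≤ w.re}) (x := z) (y := 0) (C := 1) (fun w _ => by fun_prop) (fun w hw => ?_)
    (convex_halfSpace_re_ge 0) hz (by simp)
  · simpa using h
  · have : HasDerivAt (fun w : ℂ => Complex.exp (-w)) (Complex.exp (-w) * (-1)) w :=
      (hasDerivAt_neg w).cexp
    rw [this.deriv]
    simpa [Complex.norm_exp] using hw

/-- The Laplace multiplier `(1 - e^{-l / n}) / (l / n)` of the Steklov average over `[t - 1/n, t]`. -/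
noncomputable def steklovMultiplier (n : ℕ) (l : ℂ) : ℂ :=
  (n + 1) * (1 - Complex.exp (-(l / (n + 1)))) / l

theorem norm_steklovMultiplier_le (n : ℕ) {l : ℂ} (hl : 0 < l.re) :
    ‖steklovMultiplier n l‖ ≤ 1 := by
  have hn : (0 : ℝ) < n + 1 := by positivity
  have h0 : l ≠ 0 := by rintro rfl; simp at hl
  have hre : (l / ((n : ℂ) + 1)).re = l.re / (n + 1) := by
    have : ((n : ℂ) + 1) = ((n + 1 : ℝ) : ℂ) := by push_cast; rfl
    rw [this, Complex.div_ofReal_re]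
  have h := Complex.norm_one_sub_exp_neg_le (z := l / ((n : ℂ) + 1)) (by rw [hre]; positivity)
  have hnn : ‖(n : ℂ) + 1‖ = n + 1 := by
    have : ((n : ℂ) + 1) = ((n + 1 : ℝ) : ℂ) := by push_cast; rfl
    rw [this, Complex.norm_real, Real.norm_of_nonneg hn.le]
  rw [norm_div, hnn] at h
  rw [steklovMultiplier, norm_div, norm_mul, hnn, div_le_one (norm_pos_iff.2 h0)]
  calc ((n : ℝ) + 1) * ‖1 - Complex.exp (-(l / ((n : ℂ) + 1)))‖
      ≤ (n + 1) * (‖l‖ / (n + 1)) := by gcongr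
    _ = ‖l‖ := by field_simp

theorem tendsto_steklovMultiplier {l : ℂ} (hl : l ≠ 0) :
    Tendsto (fun n => steklovMultiplier n l) atTop (𝓝 1) := by
  have h1 : HasDerivAt (fun w : ℂ => Complex.exp (-(l * w))) (-l) 0 := by
    have := ((hasDerivAt_id (0 : ℂ)).const_mul l).neg.cexp
    simpa using this
  have h2 := hasDerivAt_iff_tendsto_slope_zero.1 h1
  have h3 : Tendsto (fun n : ℕ => 1 / ((n : ℂ) + 1)) atTop (𝓝[≠] 0) := by
    refine tendsto_nhdsWithin_iff.2 ⟨tendsto_one_div_add_atTop_nhds_zero_nat, ?_⟩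
    exact Eventually.of_forall fun n => one_div_ne_zero (Nat.cast_add_one_ne_zero n)
  have h4 := ((h2.comp h3).neg.mul_const l⁻¹)
  rw [neg_neg, mul_inv_cancel₀ hl] at h4
  refine h4.congr fun n => ?_
  have : (n : ℂ) + 1 ≠ 0 := Nat.cast_add_one_ne_zero n
  simp only [steklovMultiplier, Function.comp, zero_add, mul_zero, neg_zero, Complex.exp_zero,
    smul_eq_mul, div_eq_mul_inv, one_mul, inv_inv]
  ring

section
variable {F : Type*} [NormedAddCommGroup F] [NormedSpace ℂ F]

/-- Dominated convergence with majorant `2 ‖f‖`. It serves for the Steklov multipliers, which are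
bounded by 1 and tend to 1 along a vertical line. -/
theorem tendsto_eLpNorm_smul_sub {α : Type*} [MeasurableSpace α] {μ : Measure α} {f : α → F}
    (hf : MemLp f 2 μ) {σ : ℕ → α → ℂ}
    (hσ : ∀ n, AEStronglyMeasurable (σ n) μ) (hσ1 : ∀ n x, ‖σ n x‖ ≤ 1)
    (hlim : ∀ x, Tendsto (fun n => σ n x) atTop (𝓝 1)) :
    Tendsto (fun n => eLpNorm (fun x => σ n x • f x - f x) 2 μ) atTop (𝓝 0) := by
  have hm : ∀ n, AEStronglyMeasurable (fun x => σ n x • f x - f x) μ :=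
    fun n => ((hσ n).smul hf.1).sub hf.1
  have hfin : ∫⁻ x, (2 * ‖f x‖ₑ) ^ (2 : ℝ) ∂μ ≠ ⊤ := by
    have := lintegral_rpow_enorm_lt_top_of_eLpNorm_lt_top (f := fun x => (2 : ℝ) • f x) (p := 2)
      (μ := μ) (by norm_num) (by norm_num) (hf.const_smul (2 : ℝ)).2
    refine ne_of_lt (lt_of_le_of_lt (lintegral_mono fun x => ?_) this)
    have h2 : ‖(2 : ℝ)‖ₑ = 2 := by simp [Real.enorm_eq_ofReal]
    simp [enorm_smul, h2]
  have key : Tendsto (fun n => ∫⁻ x, ‖σ n x • f x - f x‖ₑ ^ (2 : ℝ) ∂μ) atTop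
      (𝓝 (∫⁻ _, 0 ∂μ)) := by
    refine tendsto_lintegral_of_dominated_convergence' (fun x => (2 * ‖f x‖ₑ) ^ (2 : ℝ))
      (fun n => (hm n).enorm.pow_const _) (fun n => ae_of_all _ fun x => ?_) hfin
      (ae_of_all _ fun x => ?_)
    · dsimp only
      gcongr
      calc ‖σ n x • f x - f x‖ₑ ≤ ‖σ n x • f x‖ₑ + ‖f x‖ₑ := enorm_sub_le
        _ ≤ 1 * ‖f x‖ₑ + ‖f x‖ₑ := by
          rw [enorm_smul]
          gcongr
          rw [← ofReal_norm, ENNReal.ofReal_le_one]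
          exact hσ1 n x
        _ = 2 * ‖f x‖ₑ := by ring
    · have h1 : Tendsto (fun n => σ n x • f x - f x) atTop (𝓝 0) := by
        simpa using ((hlim x).smul_const (f x)).sub_const (f x)
      have h2 := (h1.enorm).ennrpow_const (2 : ℝ)
      simpa using h2
  simp only [lintegral_zero] at key
  have h := key.ennrpow_const (1 / 2 : ℝ)
  simp only [ENNReal.zero_rpow_of_pos (by norm_num : (0 : ℝ) < 1 / 2)] at h
  refine h.congr fun n => ?_
  rw [eLpNorm_eq_lintegral_rpow_enorm_toReal (by norm_num) (by norm_num)]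
  simp
end

/-! ### Recovering a weak derivative from its Fourier transform -/

section
open scoped FourierTransform

variable {F : Type*} [NormedAddCommGroup F] [InnerProductSpace ℂ F] [CompleteSpace F]

omit [CompleteSpace F] in
theorem fourier_sub_translate {a : ℝ → F} (ha : Integrable a) (δ : ℝ) (c : ℂ) (ξ : ℝ) :
    𝓕 (fun t => a t - c • a (t - δ)) ξ
      = (1 - c * Complex.exp (-(2 * Real.pi * ξ * Complex.I) * δ)) • 𝓕 a ξ := by
  have hE : ∀ v : ℝ, ‖Complex.exp (↑(-2 * Real.pi * v * ξ) * Complex.I)‖ = 1 := fun v =>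
    Complex.norm_exp_ofReal_mul_I _
  have hint : ∀ {b : ℝ → F}, Integrable b →
      Integrable (fun v : ℝ => Complex.exp (↑(-2 * Real.pi * v * ξ) * Complex.I) • b v) := by
    intro b hb
    exact Integrable.bdd_smul (C := 1) hb (Continuous.aestronglyMeasurable (by fun_prop))
      (ae_of_all _ fun v => (hE v).le)
  have hb : Integrable (fun t => a (t - δ)) := ha.comp_sub_right δ
  simp only [Real.fourier_real_eq_integral_exp_smul, smul_sub]
  have hcb : Integrable (fun v : ℝ => Complex.exp (↑(-2 * Real.pi * v * ξ) * Complex.I) •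
      c • a (v - δ)) := hint (hb.smul c)
  rw [integral_sub (hint ha) hcb]
  rw [sub_smul, one_smul]
  congr 1
  rw [← integral_smul, ← integral_add_right_eq_self _ δ]
  refine integral_congr_ae (ae_of_all _ fun v => ?_)
  simp only [smul_smul, add_sub_cancel_right]
  congr 1
  rw [mul_assoc c, ← Complex.exp_add, mul_comm]
  congr 2
  push_cast
  ring

/-- If `(β + 2πiξ) 𝓕a(ξ)` is square integrable, then `e^{βt} a(t)` is the primitive of `e^{βt} κ(t)`,
where `κ` is the inverse Fourier transform of that function. -/
theorem exists_primitive_of_memLp_fourier {β : ℝ} (hβ : 0 < β) {a : ℝ → F}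
    (hac : Continuous a) (ha0 : ∀ t ≤ 0, a t = 0) (hai : Integrable a) (ha2 : MemLp a 2)
    (hF : MemLp (fun ξ : ℝ => (β + 2 * Real.pi * ξ * Complex.I) • 𝓕 a ξ) 2) :
    ∃ κ : ℝ → F, MemLp κ 2 ∧
      eLpNorm κ 2 = eLpNorm (fun ξ : ℝ => (β + 2 * Real.pi * ξ * Complex.I) • 𝓕 a ξ) 2 ∧
      ∀ t, 0 ≤ t → ∫ s in (0 : ℝ)..t, Real.exp (β * s) • κ s = Real.exp (β * t) • a t := by
  set l : ℝ → ℂ := fun ξ => β + 2 * Real.pi * ξ * Complex.I with hl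
  have hlre : ∀ ξ, (l ξ).re = β := fun ξ => by simp [hl]
  have hlpos : ∀ ξ, 0 < (l ξ).re := fun ξ => by rw [hlre]; exact hβ
  have hl0 : ∀ ξ, l ξ ≠ 0 := fun ξ h => by
    have := hlpos ξ
    simp [h] at this
  set F₀ : ℝ → F := fun ξ => l ξ • 𝓕 a ξ with hF₀
  let κ : Lp F 2 (volume : Measure ℝ) := 𝓕⁻ (hF.toLp F₀)
  -- `e^{βt} an n t` is the backward difference quotient, with step `1/(n+1)`, of `e^{βt} a(t)`. On
  -- the Fourier side it is `F₀` times the Steklov multiplier.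
  let an : ℕ → ℝ → F := fun n t => ((n : ℂ) + 1) •
    (a t - Complex.exp (-(β / (n + 1))) • a (t - 1 / ((n : ℝ) + 1)))
  have hani : ∀ n, Integrable (an n) := fun n =>
    (hai.sub ((hai.comp_sub_right _).smul _)).smul _
  have han2 : ∀ n, MemLp (an n) 2 := fun n => by
    refine MemLp.const_smul (ha2.sub (MemLp.const_smul ?_ _)) _
    exact ha2.comp_measurePreserving (measurePreserving_sub_right volume (1 / ((n : ℝ) + 1)))
  have hanF : ∀ n ξ, 𝓕 (an n) ξ = steklovMultiplier n (l ξ) • F₀ ξ := by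
    intro n ξ
    have h1 : 𝓕 (an n) ξ = ((n : ℂ) + 1) • 𝓕 (fun t => a t -
        Complex.exp (-(β / (n + 1))) • a (t - 1 / ((n : ℝ) + 1))) ξ := by
      simp only [Real.fourier_real_eq_integral_exp_smul, an]
      rw [← integral_smul]
      refine integral_congr_ae (ae_of_all _ fun v => ?_)
      simp only [smul_smul, mul_comm]
    rw [h1, fourier_sub_translate hai, hF₀, steklovMultiplier, smul_smul, smul_smul,
      div_mul_cancel₀ _ (hl0 ξ), ← Complex.exp_add]
    congr 4
    simp only [hl]
    push_cast
    ring
  have hlim : Tendsto (fun n => eLpNorm (an n - (κ : ℝ → F)) 2) atTop (𝓝 0) := by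
    have h1 := tendsto_eLpNorm_smul_sub hF (σ := fun n ξ => steklovMultiplier n (l ξ))
      (fun n => ?_) (fun n ξ => norm_steklovMultiplier_le n (hlpos ξ))
      (fun ξ => tendsto_steklovMultiplier (hl0 ξ))
    · refine h1.congr fun n => ?_
      have e1 : eLpNorm (an n - (κ : ℝ → F)) 2 = ENNReal.ofReal ‖(han2 n).toLp - κ‖ := by
        rw [Lp.norm_def, ENNReal.ofReal_toReal (Lp.eLpNorm_ne_top _)]
        refine eLpNorm_congr_ae ?_
        exact ((Lp.coeFn_sub _ _).trans ((han2 n).coeFn_toLp.sub (ae_eq_refl _))).symm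
      have e2 : ‖𝓕 ((han2 n).toLp (an n)) - 𝓕 κ‖ = ‖(han2 n).toLp - κ‖ := by
        change ‖Lp.fourierTransformₗᵢ ℝ F _ - Lp.fourierTransformₗᵢ ℝ F _‖ = _
        rw [← map_sub, LinearIsometryEquiv.norm_map]
      rw [e1, ← e2, ← toLp_fourier (hani n) (han2 n), FourierTransform.fourier_fourierInv_eq,
        Lp.norm_def, ENNReal.ofReal_toReal (Lp.eLpNorm_ne_top _)]
      refine eLpNorm_congr_ae ?_
      refine EventuallyEq.trans ?_ (Lp.coeFn_sub _ _).symm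
      filter_upwards [(memLp_fourier (hani n) (han2 n)).coeFn_toLp, hF.coeFn_toLp] with ξ h3 h4
      rw [Pi.sub_apply, h3, h4, hanF]
    · unfold steklovMultiplier
      refine Continuous.aestronglyMeasurable ?_
      simp only [hl]
      refine Continuous.div (by fun_prop) (by fun_prop) (fun ξ => hl0 ξ)
  refine ⟨κ, Lp.memLp _, ?_, ?_⟩
  · have h2 : ‖κ‖ = ‖hF.toLp F₀‖ := by
      rw [← Lp.norm_fourier_eq κ, FourierTransform.fourier_fourierInv_eq]
    rw [Lp.norm_def, Lp.norm_toLp, ENNReal.toReal_eq_toReal_iff' (Lp.eLpNorm_ne_top _) hF.2.ne] at h2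
    exact h2
  intro t ht
  -- On the bounded interval `(0, t]` the weight is at most `e^{βt}` and `L²` convergence implies
  -- `L¹` convergence.
  have hlim1 : Tendsto (fun n : ℕ => ∫ s in (0 : ℝ)..t, Real.exp (β * s) • an n s) atTop
      (𝓝 (∫ s in (0 : ℝ)..t, Real.exp (β * s) • κ s)) := by
    simp only [intervalIntegral.integral_of_le ht]
    have hec : Continuous fun s : ℝ => Real.exp (β * s) := by fun_prop
    have hmem : ∀ {b : ℝ → F}, MemLp b 2 →
        MemLp (fun s => Real.exp (β * s) • b s) 2 (volume.restrict (Ioc 0 t)) := by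
      intro b hb
      refine MemLp.of_le_mul (c := Real.exp (β * t)) (hb.restrict _)
        (hec.aestronglyMeasurable.smul hb.1.restrict) ?_
      filter_upwards [ae_restrict_mem measurableSet_Ioc] with s hs
      rw [norm_smul, Real.norm_of_nonneg (Real.exp_pos _).le]
      gcongr
      exact hs.2
    have hbd : ∀ n, eLpNorm ((fun s => Real.exp (β * s) • an n s) -
        fun s => Real.exp (β * s) • κ s) 1 (volume.restrict (Ioc 0 t)) ≤
        (ENNReal.ofReal (Real.exp (β * t)) * eLpNorm (an n - (κ : ℝ → F)) 2) *
          (volume.restrict (Ioc 0 t)) univ ^ (1 / (1 : ENNReal).toReal - 1 / (2 : ENNReal).toReal) := by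
      intro n
      refine (eLpNorm_le_eLpNorm_mul_rpow_measure_univ (q := 2) (by norm_num)
        ((hmem (han2 n)).sub (hmem (Lp.memLp κ))).1).trans ?_
      gcongr
      refine le_trans ?_ (mul_le_mul_right (eLpNorm_restrict_le (an n - (κ : ℝ → F)) 2 volume (Ioc 0 t)) _)
      refine eLpNorm_le_mul_eLpNorm_of_ae_le_mul ?_ _
      filter_upwards [ae_restrict_mem measurableSet_Ioc] with s hs
      rw [Pi.sub_apply, ← smul_sub, norm_smul, Real.norm_of_nonneg (Real.exp_pos _).le]
      simp only [Pi.sub_apply]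
      gcongr
      exact hs.2
    have h0 := tendsto_setIntegral_of_L1' (μ := volume.restrict (Ioc 0 t))
      (fun s => Real.exp (β * s) • κ s) (hmem (Lp.memLp κ)).1
      (F := fun n s => Real.exp (β * s) • an n s) (l := atTop)
      (Eventually.of_forall fun n => (hmem (han2 n)).integrable (by norm_num)) ?_ univ
    · simpa using h0
    · refine tendsto_of_tendsto_of_tendsto_of_le_of_le tendsto_const_nhds ?_ (fun _ => zero_le)
        hbd
      have h5 := ENNReal.Tendsto.mul_const (ENNReal.Tendsto.const_mul hlim
        (Or.inr (ENNReal.ofReal_ne_top (r := Real.exp (β * t)))))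
        (b := (volume.restrict (Ioc 0 t)) univ ^
          (1 / (1 : ENNReal).toReal - 1 / (2 : ENNReal).toReal)) (Or.inr ?_)
      · simpa using h5
      · refine (ENNReal.rpow_lt_top_of_nonneg (by norm_num) ?_).ne
        simp
  set k : ℝ → F := fun s => Real.exp (β * s) • a s with hk
  have hkc : Continuous k := by
    simp only [hk]
    fun_prop
  -- The integral of the difference quotient is the mean of `k` over `[t - 1/(n+1), t]`, because `k`
  -- vanishes for negative times.
  have hlim2 : Tendsto (fun n : ℕ => ∫ s in (0 : ℝ)..t, Real.exp (β * s) • an n s) atTop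
      (𝓝 (k t)) := by
    have hder : HasDerivAt (fun x => ∫ s in (0 : ℝ)..x, k s) (k t) t :=
      intervalIntegral.integral_hasDerivAt_right (hkc.intervalIntegrable _ _)
        (hkc.stronglyMeasurableAtFilter _ _) hkc.continuousAt
    have h2 := hasDerivAt_iff_tendsto_slope_zero.1 hder
    have h3 : Tendsto (fun n : ℕ => -(1 / ((n : ℝ) + 1))) atTop (𝓝[≠] 0) := by
      refine tendsto_nhdsWithin_iff.2 ⟨?_, ?_⟩
      · simpa using (tendsto_one_div_add_atTop_nhds_zero_nat (𝕜 := ℝ)).neg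
      · exact Eventually.of_forall fun n => neg_ne_zero.2 (one_div_ne_zero (Nat.cast_add_one_ne_zero n))
    refine (h2.comp h3).congr fun n => ?_
    have hn : (0 : ℝ) < n + 1 := by positivity
    have e1 : ∀ s, Real.exp (β * s) • an n s
        = ((n : ℝ) + 1) • (k s - k (s - 1 / ((n : ℝ) + 1))) := by
      intro s
      simp only [an, hk, smul_sub]
      congr 1
      · rw [← Complex.coe_smul, ← Complex.coe_smul, smul_comm]
        push_cast
        rw [← Complex.coe_smul]
        push_cast
        rfl
      · simp only [← Complex.coe_smul, smul_smul]
        congr 1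
        push_cast
        rw [mul_left_comm, ← Complex.exp_add]
        congr 2
        ring
    simp only [e1, Function.comp]
    have hkt : Continuous fun s => k (s - 1 / ((n : ℝ) + 1)) := hkc.comp (continuous_sub_right _)
    rw [intervalIntegral.integral_smul, intervalIntegral.integral_sub (hkc.intervalIntegrable _ _)
      (hkt.intervalIntegrable _ _),
      intervalIntegral.integral_comp_sub_right]
    have e2 : ∫ s in (0 - 1 / ((n : ℝ) + 1))..(t - 1 / ((n : ℝ) + 1)), k s
        = ∫ s in (0 : ℝ)..(t - 1 / ((n : ℝ) + 1)), k s := by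
      rw [← intervalIntegral.integral_add_adjacent_intervals (b := 0)
        (hkc.intervalIntegrable _ _) (hkc.intervalIntegrable _ _)]
      rw [intervalIntegral.integral_congr (g := fun _ => (0 : F)), intervalIntegral.integral_zero,
        zero_add]
      intro s hs
      rw [uIcc_of_le (by rw [zero_sub, neg_nonpos]; positivity)] at hs
      simp [hk, ha0 s hs.2]
    rw [e2, ← sub_eq_add_neg, inv_neg, one_div, inv_inv, neg_smul, ← smul_neg, neg_sub]
  exact tendsto_nhds_unique hlim1 hlim2
end

/-! ### Laplace transforms and square integrable outputs -/

/-- The Laplace transform of a function on `(0, ∞)`. -/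
noncomputable def laplace {F : Type*} [NormedAddCommGroup F] [NormedSpace ℂ F] (f : ℝ → F) (l : ℂ) :
    F :=
  ∫ t in Ioi (0 : ℝ), Complex.exp (-(l * t)) • f t

section
variable {F : Type*} [NormedAddCommGroup F] [NormedSpace ℂ F]

theorem integrableOn_one_add_mul_exp {b : ℝ} (hb : 0 < b) :
    IntegrableOn (fun t : ℝ => (1 + t) * Real.exp (-(b * t))) (Ioi 0) := by
  have h1 : IntegrableOn (fun t : ℝ => Real.exp (-(b * t))) (Ioi 0) := by
    simpa using integrableOn_exp_mul_Ioi (neg_lt_zero.2 hb) 0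
  have h2 : IntegrableOn (fun t : ℝ => t * Real.exp (-(b * t))) (Ioi 0) := by
    simpa using integrableOn_rpow_mul_exp_neg_mul_rpow (s := 1) (p := 1) (by norm_num) (by norm_num) hb
  refine (h1.add h2).congr (ae_of_all _ fun t => ?_)
  simp only [Pi.add_apply]
  ring

theorem integrableOn_exp_smul {f : ℝ → F} (hf : AEStronglyMeasurable f (volume.restrict (Ioi 0)))
    {K : ℝ} (hK : ∀ t, 0 < t → ‖f t‖ ≤ K * (1 + t)) {l : ℂ} (hl : 0 < l.re) :
    IntegrableOn (fun t : ℝ => Complex.exp (-(l * t)) • f t) (Ioi 0) := by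
  refine ((integrableOn_one_add_mul_exp hl).const_mul K).mono'
    ((Continuous.aestronglyMeasurable (by fun_prop)).smul hf) ?_
  filter_upwards [ae_restrict_mem measurableSet_Ioi] with t ht
  rw [norm_smul, Complex.norm_exp]
  have h : (-(l * (t : ℂ))).re = -(l.re * t) := by simp
  rw [h, mul_comm, ← mul_assoc]
  gcongr
  exact hK t ht

/-- The Laplace transform of a primitive. -/
theorem laplace_primitive [CompleteSpace F] {f : ℝ → F} (hf : Continuous f) {K : ℝ}
    (hK : ∀ t, 0 ≤ t → ‖f t‖ ≤ K) {l : ℂ} (hl : 0 < l.re) :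
    l • laplace (fun t => ∫ s in (0 : ℝ)..t, f s) l = laplace f l := by
  have hP : ∀ t, HasDerivAt (fun t => ∫ s in (0 : ℝ)..t, f s) (f t) t := fun t =>
    intervalIntegral.integral_hasDerivAt_right (hf.intervalIntegrable _ _)
        (hf.stronglyMeasurableAtFilter _ _) hf.continuousAt
  have hK0 : 0 ≤ K := (norm_nonneg _).trans (hK 0 le_rfl)
  have hPc : Continuous fun t => ∫ s in (0 : ℝ)..t, f s :=
    continuous_iff_continuousAt.2 fun t => (hP t).continuousAt
  have hPb : ∀ t, 0 ≤ t → ‖∫ s in (0 : ℝ)..t, f s‖ ≤ K * t := by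
    intro t ht
    have := intervalIntegral.norm_integral_le_of_norm_le_const (a := 0) (b := t) (f := f) (C := K)
      (fun s hs => hK s (by rw [uIoc_of_le ht] at hs; exact hs.1.le))
    simpa [abs_of_nonneg ht] using this
  have hi1 := integrableOn_exp_smul (f := f) (K := K) hf.aestronglyMeasurable
    (fun t ht => (hK t ht.le).trans (le_mul_of_one_le_right hK0 (by linarith))) hl
  have hi2 := integrableOn_exp_smul (f := fun t => ∫ s in (0 : ℝ)..t, f s) (K := K)
    hPc.aestronglyMeasurable (fun t ht => (hPb t ht.le).trans (by nlinarith)) hl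
  have hd : ∀ t ∈ Ici (0 : ℝ), HasDerivAt
      (fun t : ℝ => Complex.exp (-(l * t)) • ∫ s in (0 : ℝ)..t, f s)
      (Complex.exp (-(l * t)) • f t - l • Complex.exp (-(l * t)) • ∫ s in (0 : ℝ)..t, f s) t := by
    intro t _
    have h1 : HasDerivAt (fun t : ℝ => Complex.exp (-(l * t))) (Complex.exp (-(l * t)) * (-l)) t := by
      have h := ((hasDerivAt_id (t : ℂ)).const_mul l).neg.cexp
      simpa using h.comp_ofReal
    have h2 := h1.smul (hP t)
    refine h2.congr_deriv ?_
    rw [smul_smul, mul_neg, neg_smul, mul_comm l (Complex.exp _), sub_eq_add_neg]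
  have hlim : Tendsto (fun t : ℝ => Complex.exp (-(l * t)) • ∫ s in (0 : ℝ)..t, f s) atTop (𝓝 0) := by
    have h1 : Tendsto (fun t : ℝ => K * (t * Real.exp (-(l.re * t)))) atTop (𝓝 0) := by
      have h := (Real.tendsto_pow_mul_exp_neg_atTop_nhds_zero 1).comp
        (tendsto_id.const_mul_atTop hl)
      have h' := (h.const_mul (K / l.re))
      rw [mul_zero] at h'
      refine h'.congr fun t => ?_
      simp only [Function.comp, pow_one, id]
      field_simp
    refine squeeze_zero_norm' ?_ h1
    filter_upwards [eventually_ge_atTop 0] with t ht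
    rw [norm_smul, Complex.norm_exp]
    have h : (-(l * (t : ℂ))).re = -(l.re * t) := by simp
    rw [h, mul_comm, ← mul_assoc]
    gcongr
    exact hPb t ht
  have h := integral_Ioi_of_hasDerivAt_of_tendsto' hd (hi1.sub (hi2.smul l)) hlim
  have hi3 : IntegrableOn (fun t : ℝ => l • Complex.exp (-(l * t)) • ∫ s in (0 : ℝ)..t, f s) (Ioi 0) :=
    hi2.smul l
  rw [integral_sub hi1 hi3, integral_smul] at h
  simp only [intervalIntegral.integral_same, smul_zero, sub_zero] at h
  exact (sub_eq_zero.1 h).symm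

theorem laplace_const [CompleteSpace F] (x : F) {l : ℂ} (hl : 0 < l.re) :
    l • laplace (fun _ => x) l = x := by
  have h0 : l ≠ 0 := by rintro rfl; simp at hl
  have h := integral_exp_mul_complex_Ioi (a := -l) (by simpa using hl) 0
  have h2 : ∫ t in Ioi (0 : ℝ), Complex.exp (-(l * t)) = 1 / l := by
    simpa using h
  rw [laplace, integral_smul_const, h2, smul_smul, mul_one_div_cancel h0, one_smul]

end

section
open scoped FourierTransform
variable {F : Type*} [NormedAddCommGroup F] [InnerProductSpace ℂ F] [CompleteSpace F]

omit [CompleteSpace F] in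
theorem fourier_indicator_exp_smul (f : ℝ → F) (β ξ : ℝ) :
    𝓕 ((Ioi (0 : ℝ)).indicator fun t => Real.exp (-(β * t)) • f t) ξ
      = laplace f (β + 2 * Real.pi * ξ * Complex.I) := by
  rw [Real.fourier_real_eq_integral_exp_smul, laplace, ← integral_indicator measurableSet_Ioi]
  refine integral_congr_ae (ae_of_all _ fun t => ?_)
  by_cases ht : t ∈ Ioi (0 : ℝ)
  · simp only [indicator_of_mem ht, ← Complex.coe_smul, smul_smul]
    rw [Complex.ofReal_exp, ← Complex.exp_add]
    congr 2
    push_cast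
    ring
  · simp only [indicator_of_notMem ht, smul_zero]

omit [CompleteSpace F] in
theorem memLp_indicator_exp_smul {f : ℝ → F} (hf : Continuous f)
    {K : ℝ} (hK : ∀ t, 0 < t → ‖f t‖ ≤ K * (1 + t)) {β : ℝ} (hβ : 0 < β) :
    Integrable ((Ioi (0 : ℝ)).indicator fun t => Real.exp (-(β * t)) • f t) ∧
      MemLp ((Ioi (0 : ℝ)).indicator fun t => Real.exp (-(β * t)) • f t) 2 := by
  have hm : Continuous fun t : ℝ => Real.exp (-(β * t)) • f t := by fun_prop
  have h1 : IntegrableOn (fun t : ℝ => Real.exp (-(β * t)) • f t) (Ioi 0) := by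
    have := integrableOn_exp_smul (f := f) hf.aestronglyMeasurable hK (l := β) (by simpa using hβ)
    refine this.congr (ae_of_all _ fun t => ?_)
    simp only [← Complex.coe_smul]
    push_cast
    rfl
  refine ⟨h1.integrable_indicator measurableSet_Ioi, ?_⟩
  rw [memLp_indicator_iff_restrict measurableSet_Ioi,
    memLp_two_iff_integrable_sq_norm hm.aestronglyMeasurable]
  have hK0 : 0 ≤ K := by
    have := (norm_nonneg _).trans (hK 1 one_pos)
    linarith
  refine (h1.norm.const_mul (K * (1 + 1 / β))).mono' (hm.norm.pow 2).aestronglyMeasurable ?_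
  filter_upwards [ae_restrict_mem measurableSet_Ioi] with t ht
  rw [Real.norm_of_nonneg (by positivity), sq]
  refine mul_le_mul_of_nonneg_right ?_ (norm_nonneg _)
  rw [norm_smul, Real.norm_of_nonneg (Real.exp_pos _).le, Real.exp_neg,
    inv_mul_le_iff₀ (Real.exp_pos _)]
  refine (hK t ht).trans ?_
  have h3 : 1 + t ≤ (1 + 1 / β) * (1 + β * t) := by
    have e : (1 + 1 / β) * (1 + β * t) = 1 + t + (1 / β + β * t) := by field_simp; ring
    have : 0 < t := ht
    have : 0 ≤ 1 / β + β * t := by positivity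
    linarith
  have h4 : 1 + β * t ≤ Real.exp (β * t) := by linarith [Real.add_one_le_exp (β * t)]
  calc K * (1 + t) ≤ K * ((1 + 1 / β) * Real.exp (β * t)) := by
        gcongr
        exact h3.trans (by gcongr)
    _ = Real.exp (β * t) * (K * (1 + 1 / β)) := by ring

omit [InnerProductSpace ℂ F] [CompleteSpace F] in
theorem integral_norm_sq_eq_eLpNorm_sq {α : Type*} [MeasurableSpace α] {μ : Measure α} {f : α → F}
    (hf : MemLp f 2 μ) : ∫ x, ‖f x‖ ^ 2 ∂μ = (eLpNorm f 2 μ).toReal ^ 2 := by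
  have h0 : 0 ≤ ∫ x, ‖f x‖ ^ 2 ∂μ := integral_nonneg fun _ => by positivity
  rw [hf.eLpNorm_eq_integral_rpow_norm (by norm_num) (by norm_num),
    ENNReal.toReal_ofReal (by positivity)]
  simp only [ENNReal.toReal_ofNat, Real.rpow_ofNat]
  rw [← Real.rpow_natCast, ← Real.rpow_mul h0]
  norm_num

/-- If `l k^(l)` is controlled by the Laplace transform of `g` on the line `Re l = β`, then
`k` has a square integrable derivative, controlled by `g` in a weighted norm. -/
theorem exists_output {k g : ℝ → F} (hk : Continuous k) (hk0 : k 0 = 0)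
    (hg : Continuous g) {K : ℝ} (hkK : ∀ t, 0 < t → ‖k t‖ ≤ K * (1 + t))
    (hgK : ∀ t, 0 < t → ‖g t‖ ≤ K * (1 + t)) {β : ℝ} (hβ : 0 < β) {M : ℝ}
    (hM : ∀ l : ℂ, l.re = β → ‖l • laplace k l‖ ≤ M * ‖laplace g l‖) (hM0 : 0 ≤ M) {T : ℝ}
    (hT : 0 ≤ T) :
    ∃ y : ℝ → F, MemLp y 2 (volume.restrict (Ioc 0 T)) ∧
      (∀ t ∈ Icc 0 T, k t = ∫ s in (0 : ℝ)..t, y s) ∧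
      ∫ s in (0 : ℝ)..T, ‖y s‖ ^ 2 ≤ Real.exp (2 * β * T) * M ^ 2 *
        ∫ s in Ioi (0 : ℝ), Real.exp (-(2 * β * s)) * ‖g s‖ ^ 2 := by
  obtain ⟨hai, ha2⟩ := memLp_indicator_exp_smul hk hkK hβ
  obtain ⟨hbi, hb2⟩ := memLp_indicator_exp_smul hg hgK hβ
  have haF := fourier_indicator_exp_smul k β
  have hbF := fourier_indicator_exp_smul g β
  set a := (Ioi (0 : ℝ)).indicator fun t => Real.exp (-(β * t)) • k t with ha
  set b := (Ioi (0 : ℝ)).indicator fun t => Real.exp (-(β * t)) • g t with hb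
  -- Because `k 0 = 0`, extension by zero creates no jump, and `l k^` is the transform of the
  -- derivative without a boundary term.
  have hac : Continuous a := by
    have : a = fun t => Real.exp (-(β * t)) • k (max t 0) := by
      ext t
      by_cases ht : 0 < t
      · rw [ha, indicator_of_mem (mem_Ioi.2 ht), max_eq_left ht.le]
      · rw [ha, indicator_of_notMem (by simpa using ht), max_eq_right (not_lt.1 ht), hk0, smul_zero]
    rw [this]
    have : Continuous fun t : ℝ => k (max t 0) := hk.comp (by fun_prop)
    fun_prop
  have ha0 : ∀ t ≤ 0, a t = 0 := fun t ht => indicator_of_notMem (by simpa using ht) _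
  have hFm : AEStronglyMeasurable (fun ξ : ℝ => (β + 2 * Real.pi * ξ * Complex.I) • 𝓕 a ξ) :=
    (Continuous.aestronglyMeasurable (by fun_prop)).smul (memLp_fourier hai ha2).1
  have hbound : ∀ ξ : ℝ, ‖(β + 2 * Real.pi * ξ * Complex.I) • 𝓕 a ξ‖ ≤ M * ‖𝓕 b ξ‖ := by
    intro ξ
    rw [haF, hbF]
    exact hM _ (by simp)
  have hF : MemLp (fun ξ : ℝ => (β + 2 * Real.pi * ξ * Complex.I) • 𝓕 a ξ) 2 :=
    (memLp_fourier hbi hb2).of_le_mul hFm (ae_of_all _ hbound)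
  obtain ⟨κ, hκ, hκn, hκp⟩ := exists_primitive_of_memLp_fourier hβ hac ha0 hai ha2 hF
  have hec : Continuous fun s : ℝ => Real.exp (β * s) := by fun_prop
  have hy : MemLp (fun s => Real.exp (β * s) • κ s) 2 (volume.restrict (Ioc 0 T)) := by
    refine MemLp.of_le_mul (c := Real.exp (β * T)) (hκ.restrict _)
      (hec.aestronglyMeasurable.smul hκ.1.restrict) ?_
    filter_upwards [ae_restrict_mem measurableSet_Ioc] with s hs
    rw [norm_smul, Real.norm_of_nonneg (Real.exp_pos _).le]
    gcongr
    exact hs.2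
  refine ⟨fun s => Real.exp (β * s) • κ s, hy, fun t ht => ?_, ?_⟩
  · rw [hκp t ht.1]
    rcases eq_or_lt_of_le ht.1 with h0 | h0
    · rw [← h0, hk0, ha0 0 le_rfl, smul_zero]
    · rw [ha, indicator_of_mem (mem_Ioi.2 h0), smul_smul, ← Real.exp_add]
      simp
  -- Undoing the weight on `(0, T)` costs the factor `e^{2βT}`.
  · have h1 : ∫ s in (0 : ℝ)..T, ‖Real.exp (β * s) • κ s‖ ^ 2
        ≤ Real.exp (2 * β * T) * ∫ s, ‖κ s‖ ^ 2 := by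
      rw [intervalIntegral.integral_of_le hT, ← integral_const_mul]
      have hi : Integrable (fun s => Real.exp (2 * β * T) * ‖κ s‖ ^ 2) :=
        (hκ.integrable_norm_pow (by norm_num)).const_mul _
      refine le_trans ?_ (setIntegral_le_integral (s := Ioc 0 T) hi (ae_of_all _ fun s => by positivity))
      refine integral_mono_ae (hy.integrable_norm_pow (by norm_num)) hi.restrict ?_
      filter_upwards [ae_restrict_mem measurableSet_Ioc] with s hs
      rw [norm_smul, Real.norm_of_nonneg (Real.exp_pos _).le, mul_pow, ← Real.exp_nat_mul]
      refine mul_le_mul_of_nonneg_right (Real.exp_le_exp.2 ?_) (by positivity)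
      have := mul_le_mul_of_nonneg_left hs.2 hβ.le
      push_cast
      linarith
    have h2 : ∫ s, ‖κ s‖ ^ 2 ≤ M ^ 2 * ∫ s, ‖b s‖ ^ 2 := by
      rw [integral_norm_sq_eq_eLpNorm_sq hκ, integral_norm_sq_eq_eLpNorm_sq hb2, ← mul_pow, hκn]
      gcongr
      have h3 := eLpNorm_le_mul_eLpNorm_of_ae_le_mul (μ := volume) (ae_of_all _ hbound) 2
      rw [eLpNorm_fourier hbi hb2] at h3
      have h4 := ENNReal.toReal_mono (ENNReal.mul_ne_top ENNReal.ofReal_ne_top hb2.2.ne) h3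
      rwa [ENNReal.toReal_mul, ENNReal.toReal_ofReal hM0] at h4
    have h3 : ∫ s, ‖b s‖ ^ 2 = ∫ s in Ioi (0 : ℝ), Real.exp (-(2 * β * s)) * ‖g s‖ ^ 2 := by
      rw [← integral_indicator measurableSet_Ioi]
      refine integral_congr_ae (ae_of_all _ fun s => ?_)
      by_cases hs : s ∈ Ioi (0 : ℝ)
      · simp only [hb, indicator_of_mem hs]
        rw [norm_smul, Real.norm_of_nonneg (Real.exp_pos _).le, mul_pow, ← Real.exp_nat_mul]
        congr 2
        push_cast
        ring
      · simp only [hb, indicator_of_notMem hs]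
        simp
    rw [h3] at h2
    rw [mul_assoc]
    exact h1.trans (mul_le_mul_of_nonneg_left h2 (Real.exp_pos _).le)
end

/-! ### Skew-adjoint operators and the regularisation `(I - s⁻² C²)⁻¹` -/

section SkewAdjoint

variable {U : Type*} [NormedAddCommGroup U] [InnerProductSpace ℂ U] [CompleteSpace U]
  {C : U →ₗ.[ℂ] U}

theorem IsSkewAdjointOp.inner_eq (hC : IsSkewAdjointOp C) {p q : U × U} (hp : p ∈ C.graph)
    (hq : q ∈ C.graph) : inner ℂ p.1 q.2 = -inner ℂ p.2 q.1 := by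
  obtain ⟨x, hx1, hx2⟩ := (LinearPMap.mem_graph_iff C).1 hp
  obtain ⟨y, hy1, hy2⟩ := (LinearPMap.mem_graph_iff C).1 hq
  have h := LinearPMap.adjoint_isFormalAdjoint hC.1
  rw [hC.2] at h
  have h2 := h y x
  rw [LinearPMap.neg_apply] at h2
  rw [← hx1, ← hx2, ← hy1, ← hy2]
  have h3 := congrArg (starRingEnd ℂ) h2
  rw [inner_neg_left, map_neg, inner_conj_symm, inner_conj_symm] at h3
  rw [← h3, neg_neg]

/-- The condition says that `u` lies in the domain of `C*` with `C* u = -f`, and `C* = -C`. This is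
how elements of `D(C)` are produced from weak equations. -/
theorem IsSkewAdjointOp.mem_graph (hC : IsSkewAdjointOp C) {u f : U}
    (h : ∀ p ∈ C.graph, inner ℂ p.1 f = -inner ℂ p.2 u) : (u, f) ∈ C.graph := by
  have h1 : ∀ x : C.domain, inner ℂ (-f) (x : U) = inner ℂ u (C x) := by
    intro x
    have h2 := congrArg (starRingEnd ℂ) (h _ (C.mem_graph x))
    rw [map_neg, inner_conj_symm, inner_conj_symm] at h2
    rw [inner_neg_left, h2, neg_neg]
  have hu : u ∈ C.adjoint.domain := C.mem_adjoint_domain_of_exists u ⟨-f, h1⟩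
  have h3 := LinearPMap.adjoint_apply_eq hC.1 ⟨u, hu⟩ h1
  have h4 : (u, -f) ∈ C.adjoint.graph := (LinearPMap.mem_graph_iff _).2 ⟨⟨u, hu⟩, rfl, h3⟩
  rw [hC.2] at h4
  obtain ⟨y, hy1, hy2⟩ := (LinearPMap.mem_graph_iff _).1 h4
  rw [LinearPMap.neg_apply, neg_inj] at hy2
  exact (LinearPMap.mem_graph_iff _).2 ⟨y, hy1, hy2⟩

theorem IsSkewAdjointOp.re_inner_eq_zero (hC : IsSkewAdjointOp C) {p : U × U} (hp : p ∈ C.graph) :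
    (inner ℂ p.1 p.2).re = 0 := by
  have h := congrArg Complex.re (hC.inner_eq hp hp)
  have h2 : (inner ℂ p.2 p.1).re = (inner ℂ p.1 p.2).re := inner_re_symm (𝕜 := ℂ) p.2 p.1
  rw [Complex.neg_re, h2] at h
  linarith

theorem IsSkewAdjointOp.isClosed_graph (hC : IsSkewAdjointOp C) :
    IsClosed (C.graph : Set (U × U)) := by
  have : (C.graph : Set (U × U)) =
      ⋂ p : C.graph, {q : U × U | inner ℂ p.1.1 q.2 = -inner ℂ p.1.2 q.1} := by
    ext q
    simp only [SetLike.mem_coe, mem_iInter, mem_ofPred_eq]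
    exact ⟨fun hq p => hC.inner_eq p.2 hq, fun h => hC.mem_graph fun p hp => h ⟨p, hp⟩⟩
  rw [this]
  refine isClosed_iInter fun p => isClosed_eq ?_ ?_ <;> fun_prop

/-- `r = (ρ, C ρ)` and `q = C² ρ` with `ρ - s⁻² C² ρ = u`. -/
def IsSqResolvent (C : U →ₗ.[ℂ] U) (s : ℝ) (u : U) (r : U × U) (q : U) : Prop :=
  r ∈ C.graph ∧ (r.2, q) ∈ C.graph ∧ r.1 - (((s ^ 2)⁻¹ : ℝ) : ℂ) • q = u

omit [CompleteSpace U] in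
theorem IsSqResolvent.sub {s : ℝ} {u u' : U} {r r' : U × U} {q q' : U}
    (h : IsSqResolvent C s u r q) (h' : IsSqResolvent C s u' r' q') :
    IsSqResolvent C s (u - u') (r - r') (q - q') := by
  refine ⟨C.graph.sub_mem h.1 h'.1, C.graph.sub_mem h.2.1 h'.2.1, ?_⟩
  rw [← h.2.2, ← h'.2.2, smul_sub, Prod.fst_sub]
  abel

/-- Pairing the equation with `ρ = r.1` turns `-s⁻² ⟨ρ, C² ρ⟩` into `s⁻² ‖C ρ‖²` by
skew-adjointness. The contraction bound on `ρ`, the bound on `C ρ` and uniqueness all follow. -/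
theorem IsSqResolvent.energy (hC : IsSkewAdjointOp C) {s : ℝ} {u : U} {r : U × U} {q : U}
    (h : IsSqResolvent C s u r q) :
    ‖r.1‖ ^ 2 + (s ^ 2)⁻¹ * ‖r.2‖ ^ 2 ≤ ‖r.1‖ * ‖u‖ := by
  have h1 := hC.inner_eq h.1 h.2.1
  have h2 : inner ℂ r.1 u = ((‖r.1‖ ^ 2 + (s ^ 2)⁻¹ * ‖r.2‖ ^ 2 : ℝ) : ℂ) := by
    rw [← h.2.2, inner_sub_right, inner_smul_right, h1, inner_self_eq_norm_sq_to_K,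
      inner_self_eq_norm_sq_to_K]
    push_cast
    simp
  have h3 := norm_inner_le_norm (𝕜 := ℂ) r.1 u
  rw [h2, Complex.norm_real] at h3
  exact (le_abs_self _).trans h3

theorem IsSqResolvent.norm_le (hC : IsSkewAdjointOp C) {s : ℝ} {u : U} {r : U × U} {q : U}
    (h : IsSqResolvent C s u r q) : ‖r.1‖ ≤ ‖u‖ := by
  have h1 := h.energy hC
  have h2 : 0 ≤ (s ^ 2)⁻¹ * ‖r.2‖ ^ 2 := by positivity
  by_contra! h3
  nlinarith [norm_nonneg u]

theorem IsSqResolvent.norm_snd_le (hC : IsSkewAdjointOp C) {s : ℝ} (hs : 0 < s) {u : U} {r : U × U}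
    {q : U} (h : IsSqResolvent C s u r q) : ‖r.2‖ ≤ s * ‖u‖ := by
  have h1 := h.energy hC
  have h2 := h.norm_le hC
  have h3 : (s ^ 2)⁻¹ * ‖r.2‖ ^ 2 ≤ ‖u‖ ^ 2 := by nlinarith [norm_nonneg r.1, norm_nonneg u]
  rw [inv_mul_le_iff₀ (by positivity), ← mul_pow] at h3
  exact le_of_sq_le_sq h3 (by positivity)

theorem IsSqResolvent.unique (hC : IsSkewAdjointOp C) {s : ℝ} (hs : 0 < s) {u : U} {r r' : U × U}
    {q q' : U} (h : IsSqResolvent C s u r q) (h' : IsSqResolvent C s u r' q') : r = r' := by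
  have h1 := (h.sub h').norm_le hC
  have h2 := (h.sub h').norm_snd_le hC hs
  rw [sub_self, norm_zero] at h1 h2
  rw [mul_zero] at h2
  rw [← sub_eq_zero]
  exact Prod.ext (norm_le_zero_iff.1 h1) (norm_le_zero_iff.1 h2)

/-- Variational: `ρ` minimises `‖ρ - u‖² + s⁻² ‖C ρ‖²` over `D(C)`, that is, `(u, 0)` is projected
on a rescaled copy of the closed graph. The Euler equation says weakly that `C (C ρ) = s² (ρ - u)`,
and skew-adjointness makes it strong. -/
theorem exists_isSqResolvent (hC : IsSkewAdjointOp C) {s : ℝ} (hs : 0 < s) (u : U) :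
    ∃ r q, IsSqResolvent C s u r q := by
  let Λ : WithLp 2 (U × U) →ₗ[ℂ] U × U :=
    { toFun := fun p => (p.fst, (s : ℂ) • p.snd)
      map_add' := fun p q => by simp
      map_smul' := fun c p => by simp [smul_comm c] }
  have hΛ : Continuous Λ := by
    change Continuous fun p : WithLp 2 (U × U) => (p.fst, (s : ℂ) • p.snd)
    fun_prop
  let K := C.graph.comap Λ
  have hK : IsClosed (K : Set (WithLp 2 (U × U))) := hC.isClosed_graph.preimage hΛ
  let z : WithLp 2 (U × U) := WithLp.toLp 2 (u, 0)
  obtain ⟨r, hr, hrz⟩ := K.exists_norm_eq_iInf_of_complete_subspace hK.isComplete z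
  have hort := (K.norm_eq_iInf_iff_inner_eq_zero hr).1 hrz
  have hs0 : (s : ℂ) ≠ 0 := by exact_mod_cast hs.ne'
  have hr' : (r.fst, (s : ℂ) • r.snd) ∈ C.graph := hr
  refine ⟨(r.fst, (s : ℂ) • r.snd), (s ^ 2 : ℂ) • (r.fst - u), hr', ?_, ?_⟩
  · refine hC.mem_graph fun p hp => ?_
    have hpK : (WithLp.toLp 2 (p.1, (s : ℂ)⁻¹ • p.2) : WithLp 2 (U × U)) ∈ K := by
      change (p.1, (s : ℂ) • (s : ℂ)⁻¹ • p.2) ∈ C.graph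
      rw [smul_inv_smul₀ hs0]
      exact hp
    have h1 := congrArg (starRingEnd ℂ) (hort _ hpK)
    rw [inner_conj_symm, map_zero] at h1
    have h2 : inner ℂ p.1 (u - r.fst) + inner ℂ ((s : ℂ)⁻¹ • p.2) (0 - r.snd) = 0 :=
      (WithLp.prod_inner_apply _ _).symm.trans h1
    simp only [zero_sub, inner_smul_left, inner_neg_right, inner_sub_right, map_inv₀,
      Complex.conj_ofReal] at h2
    simp only [inner_smul_right, inner_sub_right]
    have h3 : (s : ℂ) * (s : ℂ)⁻¹ = 1 := mul_inv_cancel₀ hs0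
    linear_combination (-(s : ℂ) ^ 2) * h2 - (s : ℂ) * inner ℂ p.2 r.snd * h3
  · push_cast
    rw [smul_smul, inv_mul_cancel₀ (pow_ne_zero 2 hs0), one_smul, sub_sub_cancel]

/-- The regularisations are contractions, so convergence need only be checked on the dense domain of
`C`. -/
theorem tendsto_sqResolvent (hC : IsSkewAdjointOp C) {u : U} {r : ℝ → U × U} {q : ℝ → U}
    (h : ∀ s, 0 < s → IsSqResolvent C s u (r s) (q s)) :
    Tendsto (fun s => (r s).1) atTop (𝓝 u) := by
  rw [Metric.tendsto_nhds]
  intro ε hε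
  obtain ⟨x, hx, hxu⟩ := hC.1.exists_dist_lt u (ε := ε / 3) (by positivity)
  have hp := C.mem_graph ⟨x, hx⟩
  set p : U × U := (x, C ⟨x, hx⟩) with hpdef
  filter_upwards [eventually_gt_atTop 0, eventually_gt_atTop (3 * ‖p.2‖ / ε)] with s hs hs2
  obtain ⟨r', q', h'⟩ := exists_isSqResolvent hC hs p.1
  have h1 := ((h s hs).sub h').norm_le hC
  have hs0 : (s : ℂ) ≠ 0 := by exact_mod_cast hs.ne'
  have hq' : q' = ((s ^ 2 : ℝ) : ℂ) • (r'.1 - p.1) := by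
    have : r'.1 - p.1 = (((s ^ 2)⁻¹ : ℝ) : ℂ) • q' := by rw [← h'.2.2]; abel
    rw [this, smul_smul]
    push_cast
    rw [mul_inv_cancel₀ (pow_ne_zero 2 hs0), one_smul]
  -- `C` commutes with the regularisation, so `(C ρ, C² ρ)` regularises `C p`. Hence `‖C² ρ‖ ≤ s ‖C
  -- p‖`, and `ρ - p = s⁻² C² ρ` is of size at most `‖C p‖ / s`.
  have h2 : IsSqResolvent C s p.2 (r'.2, q') (((s ^ 2 : ℝ) : ℂ) • (r'.2 - p.2)) := by
    refine ⟨h'.2.1, ?_, ?_⟩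
    · have := C.graph.smul_mem ((s ^ 2 : ℝ) : ℂ) (C.graph.sub_mem h'.1 hp)
      convert this using 1
      exact Prod.ext hq' rfl
    · push_cast
      rw [smul_smul, inv_mul_cancel₀ (pow_ne_zero 2 hs0), one_smul]
      simp
  have h3 : ‖q'‖ ≤ s * ‖p.2‖ := h2.norm_snd_le hC hs
  have h4 : ‖r'.1 - p.1‖ < ε / 3 := by
    rw [hq', norm_smul, Complex.norm_real, Real.norm_of_nonneg (by positivity)] at h3
    rw [div_lt_iff₀ hε] at hs2
    by_contra! h5
    have h6 : s * ‖r'.1 - p.1‖ ≤ ‖p.2‖ := by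
      by_contra! h7
      nlinarith
    nlinarith
  have h5 : ‖u - p.1‖ < ε / 3 := by rwa [← dist_eq_norm]
  rw [dist_eq_norm]
  have h6 : (r s).1 - u = (r s - r').1 + (r'.1 - p.1) - (u - p.1) := by
    rw [Prod.fst_sub]
    abel
  rw [h6]
  refine (norm_sub_le _ _).trans_lt ?_
  have := norm_add_le (r s - r').1 (r'.1 - p.1)
  linarith

/-- Commutation with `C` again: the second components regularise `p.2`, so the previous convergence
applies to both components. -/
theorem tendsto_sqResolvent_graph (hC : IsSkewAdjointOp C) {p : U × U} (hp : p ∈ C.graph)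
    {r : ℝ → U × U} {q : ℝ → U} (h : ∀ s, 0 < s → IsSqResolvent C s p.1 (r s) (q s)) :
    Tendsto r atTop (𝓝 p) := by
  suffices h2 : Tendsto (fun s => (r s).2) atTop (𝓝 p.2) from
    (tendsto_sqResolvent hC h).prodMk_nhds h2
  refine tendsto_sqResolvent (r := fun s => ((r s).2, q s))
    (q := fun s => ((s ^ 2 : ℝ) : ℂ) • ((r s).2 - p.2)) hC fun s hs => ?_
  have hs0 : (s : ℂ) ≠ 0 := by exact_mod_cast hs.ne'
  have h' := h s hs
  have hq' : q s = ((s ^ 2 : ℝ) : ℂ) • ((r s).1 - p.1) := by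
    have : (r s).1 - p.1 = (((s ^ 2)⁻¹ : ℝ) : ℂ) • q s := by rw [← h'.2.2]; abel
    rw [this, smul_smul]
    push_cast
    rw [mul_inv_cancel₀ (pow_ne_zero 2 hs0), one_smul]
  refine ⟨h'.2.1, ?_, ?_⟩
  · have := C.graph.smul_mem ((s ^ 2 : ℝ) : ℂ) (C.graph.sub_mem h'.1 hp)
    convert this using 1
    exact Prod.ext hq' rfl
  · push_cast
    rw [smul_smul, inv_mul_cancel₀ (pow_ne_zero 2 hs0), one_smul]
    simp

end SkewAdjoint

/-! ### The extended `D*` and the energy identity of the damping -/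

section DStar

variable {U W : Type*} [NormedAddCommGroup U] [InnerProductSpace ℂ U] [CompleteSpace U]
  [NormedAddCommGroup W] [InnerProductSpace ℂ W] [CompleteSpace W]
  {C : U →ₗ.[ℂ] U} {D : W →L[ℂ] AntiDual C.graph}

omit [CompleteSpace U] in
theorem hasDStar_iff {u : U} {w : W} : HasDStar C D u w ↔ ∃ (r : ℝ → C.graph) (q : ℝ → U),
    (∀ s, 0 < s → IsSqResolvent C s u (r s) (q s)) ∧
      Tendsto (fun s => dualAdjoint D (r s)) atTop (𝓝 w) := by
  constructor
  · rintro ⟨r, h, hw⟩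
    choose! q hq using h
    exact ⟨r, q, fun s hs => ⟨(r s).2, hq s hs⟩, hw⟩
  · rintro ⟨r, q, h, hw⟩
    exact ⟨r, fun s hs => ⟨q s, (h s hs).2⟩, hw⟩

theorem exists_sqResolvent_family (hC : IsSkewAdjointOp C) (u : U) :
    ∃ (r : ℝ → C.graph) (q : ℝ → U), ∀ s, 0 < s → IsSqResolvent C s u (r s) (q s) := by
  have h : ∀ s : ℝ, ∃ (r : C.graph) (q : U), 0 < s → IsSqResolvent C s u r q := by
    intro s
    by_cases hs : 0 < s
    · obtain ⟨r, q, h⟩ := exists_isSqResolvent hC hs u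
      exact ⟨⟨r, h.1⟩, q, fun _ => h⟩
    · exact ⟨0, 0, fun h => absurd h hs⟩
  choose r q h using h
  exact ⟨r, q, h⟩

theorem HasDStar.unique (hC : IsSkewAdjointOp C) {u : U} {w w' : W} (h : HasDStar C D u w)
    (h' : HasDStar C D u w') : w = w' := by
  obtain ⟨r, q, h, hw⟩ := hasDStar_iff.1 h
  obtain ⟨r', q', h', hw'⟩ := hasDStar_iff.1 h'
  refine tendsto_nhds_unique hw (hw'.congr' ?_)
  filter_upwards [eventually_gt_atTop 0] with s hs
  rw [Subtype.ext ((h s hs).unique hC hs (h' s hs))]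

omit [CompleteSpace U] in
theorem HasDStar.add {u u' : U} {w w' : W} (h : HasDStar C D u w) (h' : HasDStar C D u' w') :
    HasDStar C D (u + u') (w + w') := by
  obtain ⟨r, h, hw⟩ := h
  obtain ⟨r', h', hw'⟩ := h'
  refine ⟨fun s => r s + r' s, fun s hs => ?_, by simpa using hw.add hw'⟩
  obtain ⟨q, hq, e⟩ := h s hs
  obtain ⟨q', hq', e'⟩ := h' s hs
  refine ⟨q + q', C.graph.add_mem hq hq', ?_⟩
  rw [← e, ← e', smul_add, Submodule.coe_add, Prod.fst_add]
  abel

omit [CompleteSpace U] in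
theorem HasDStar.smul (c : ℂ) {u : U} {w : W} (h : HasDStar C D u w) :
    HasDStar C D (c • u) (c • w) := by
  obtain ⟨r, h, hw⟩ := h
  refine ⟨fun s => c • r s, fun s hs => ?_, by simpa using hw.const_smul c⟩
  obtain ⟨q, hq, e⟩ := h s hs
  refine ⟨c • q, C.graph.smul_mem c hq, ?_⟩
  rw [← e, smul_sub, smul_comm c, Submodule.coe_smul, Prod.smul_fst]

theorem hasDStar_graph (hC : IsSkewAdjointOp C) (p : C.graph) :
    HasDStar C D p.1.1 (dualAdjoint D p) := by
  obtain ⟨r, q, h⟩ := exists_sqResolvent_family hC p.1.1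
  refine hasDStar_iff.2 ⟨r, q, h, ?_⟩
  refine ((dualAdjoint D).continuous.tendsto p).comp ?_
  exact tendsto_subtype_rng.2 (tendsto_sqResolvent_graph hC p.2 h)

theorem hasDStar_of_bounded (hC : IsSkewAdjointOp C) {D₀ : W →L[ℂ] U}
    (hD : ∀ (w : W) (v : C.graph), D w v = inner ℂ v.1.1 (D₀ w)) (u : U) :
    HasDStar C D u (ContinuousLinearMap.adjoint D₀ u) := by
  obtain ⟨r, q, h⟩ := exists_sqResolvent_family hC u
  refine hasDStar_iff.2 ⟨r, q, h, ?_⟩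
  have h1 : ∀ v : C.graph, dualAdjoint D v = ContinuousLinearMap.adjoint D₀ v.1.1 := by
    intro v
    refine ext_inner_right ℂ fun w => ?_
    rw [inner_dualAdjoint, hD, ContinuousLinearMap.adjoint_inner_left]
  simp only [h1]
  exact ((ContinuousLinearMap.adjoint D₀).continuous.tendsto u).comp (tendsto_sqResolvent hC h)

/-- Energy identity `Re ⟨u, -C u - D D* u⟩ = -‖D* u‖²`. -/
theorem HasDStar.re_inner_eq (hC : IsSkewAdjointOp C) {u f : U} {w : W} (h : HasDStar C D u w)
    (hf : ∀ v : C.graph, inner ℂ v.1.1 f = inner ℂ v.1.2 u - D w v) :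
    (inner ℂ u f).re = -‖w‖ ^ 2 := by
  obtain ⟨r, q, h, hw⟩ := hasDStar_iff.1 h
  -- With `ρ - s⁻² C² ρ = u`, both `Re ⟨C ρ, ρ⟩` and `Re ⟨C ρ, C² ρ⟩` vanish, so the term `Re ⟨C ρ,
  -- u⟩` disappears before the limit. Regularising by an even function of `C` is what makes this
  -- work.
  have h1 : ∀ s, 0 < s → (inner ℂ (r s).1.1 f).re = -(inner ℂ (dualAdjoint D (r s)) w).re := by
    intro s hs
    have e := h s hs
    have e1 := hC.re_inner_eq_zero e.1
    have e2 : (inner ℂ (r s).1.2 (q s)).re = 0 := hC.re_inner_eq_zero e.2.1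
    have e3 : (inner ℂ (r s).1.2 (r s).1.1).re = 0 := by
      rw [← e1]
      exact inner_re_symm (𝕜 := ℂ) _ _
    rw [hf, inner_dualAdjoint, Complex.sub_re]
    nth_rewrite 1 [← e.2.2]
    rw [inner_sub_right, inner_smul_right, Complex.sub_re, Complex.re_ofReal_mul, e2, e3]
    ring
  have h2 : Tendsto (fun s => (inner ℂ (r s).1.1 f).re) atTop (𝓝 (inner ℂ u f).re) :=
    (Complex.continuous_re.tendsto _).comp ((tendsto_sqResolvent hC h).inner tendsto_const_nhds)
  have h3 : Tendsto (fun s => -(inner ℂ (dualAdjoint D (r s)) w).re) atTop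
      (𝓝 (-(inner ℂ w w).re)) :=
    ((Complex.continuous_re.tendsto _).comp (hw.inner tendsto_const_nhds)).neg
  have h4 := tendsto_nhds_unique h2 (h3.congr' ?_)
  · rw [h4, inner_self_eq_norm_sq_to_K]
    norm_cast
  · filter_upwards [eventually_gt_atTop 0] with s hs
    exact (h1 s hs).symm

/-- The operator `(u, Ĉ u) ↦ D* u`, bounded on the graph of `Ĉ`. -/
theorem exists_dampingOutput (hC : IsSkewAdjointOp C) {Chat : U →ₗ.[ℂ] U}
    (hCD : IsSkewPlusDamping Chat C D) :
    ∃ L : Chat.graph →L[ℂ] W, ∀ p : Chat.graph, HasDStar C D p.1.1 (L p) ∧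
      (∀ v : C.graph, inner ℂ v.1.1 p.1.2 = inner ℂ v.1.2 p.1.1 - D (L p) v) := by
  have h : ∀ p : Chat.graph, ∃ w, HasDStar C D p.1.1 w ∧
      ∀ v : C.graph, inner ℂ v.1.1 p.1.2 = inner ℂ v.1.2 p.1.1 - D w v :=
    fun p => (hCD p.1.1 p.1.2).1 p.2
  choose L hL1 hL2 using h
  let L' : Chat.graph →ₗ[ℂ] W :=
    { toFun := L
      map_add' := fun p p' => (hL1 (p + p')).unique hC ((hL1 p).add (hL1 p'))
      map_smul' := fun c p => (hL1 (c • p)).unique hC ((hL1 p).smul c) }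
  -- The bound comes from the energy identity: `‖D* u‖² = -Re ⟨u, Ĉ u⟩ ≤ ‖u‖ ‖Ĉ u‖`.
  refine ⟨L'.mkContinuous 1 fun p => ?_, fun p => ⟨hL1 p, hL2 p⟩⟩
  have h1 := (hL1 p).re_inner_eq hC (hL2 p)
  have h2 := (Complex.abs_re_le_norm _).trans (norm_inner_le_norm (𝕜 := ℂ) p.1.1 p.1.2)
  rw [h1, abs_neg, abs_of_nonneg (by positivity)] at h2
  have h3 : ‖p.1.1‖ ≤ ‖p‖ := norm_fst_le p.1
  have h4 : ‖p.1.2‖ ≤ ‖p‖ := norm_snd_le p.1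
  rw [one_mul]
  refine le_of_sq_le_sq (h2.trans ?_) (norm_nonneg _)
  rw [sq]
  gcongr

end DStar

/-! ### Mild solutions by Yosida approximation -/

section Generation

variable {E : Type*} [NormedAddCommGroup E] [InnerProductSpace ℂ E] [CompleteSpace E]

omit [CompleteSpace E] in
/-- The resolvent of a dissipative operator. -/
theorem exists_resolvent {A : E →ₗ.[ℂ] E} (hdiss : ∀ p ∈ A.graph, (inner ℂ p.1 p.2).re ≤ 0)
    {l : ℝ} (hl : 0 < l) (hsurj : ∀ f, ∃ p ∈ A.graph, (l : ℂ) • p.1 - p.2 = f) :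
    ∃ R : E →L[ℂ] E, (∀ f, (R f, (l : ℂ) • R f - f) ∈ A.graph) ∧ (∀ f, l * ‖R f‖ ≤ ‖f‖) ∧
      ∀ p ∈ A.graph, R ((l : ℂ) • p.1 - p.2) = p.1 := by
  have hcoer : ∀ p ∈ A.graph, l * ‖p.1‖ ≤ ‖(l : ℂ) • p.1 - p.2‖ := by
    intro p hp
    have h1 : (inner ℂ p.1 ((l : ℂ) • p.1 - p.2)).re = l * ‖p.1‖ ^ 2 - (inner ℂ p.1 p.2).re := by
      rw [inner_sub_right, inner_smul_right, Complex.sub_re, Complex.re_ofReal_mul,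
        inner_self_eq_norm_sq_to_K]
      norm_cast
    have h2 := (Complex.re_le_norm _).trans
      (norm_inner_le_norm (𝕜 := ℂ) p.1 ((l : ℂ) • p.1 - p.2))
    have h3 := hdiss p hp
    rcases (norm_nonneg p.1).eq_or_lt with h0 | h0
    · rw [← h0, mul_zero]
      exact norm_nonneg _
    · refine le_of_mul_le_mul_left ?_ h0
      nlinarith
  have hinj : ∀ p ∈ A.graph, ∀ p' ∈ A.graph,
      (l : ℂ) • p.1 - p.2 = (l : ℂ) • p'.1 - p'.2 → p.1 = p'.1 := by
    intro p hp p' hp' h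
    have h1 := hcoer _ (A.graph.sub_mem hp hp')
    have h2 : (l : ℂ) • (p - p').1 - (p - p').2 = 0 := by
      rw [Prod.fst_sub, Prod.snd_sub, smul_sub, ← sub_eq_zero.2 h]
      abel
    rw [h2, norm_zero] at h1
    have h3 : ‖(p - p').1‖ ≤ 0 := by
      by_contra! h4
      nlinarith
    exact sub_eq_zero.1 (norm_le_zero_iff.1 h3)
  choose P hP hPf using hsurj
  let R' : E →ₗ[ℂ] E :=
    { toFun := fun f => (P f).1
      map_add' := fun f g => by
        refine hinj _ (hP _) _ (A.graph.add_mem (hP f) (hP g)) ?_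
        rw [hPf, Prod.fst_add, Prod.snd_add, smul_add]
        nth_rewrite 1 [← hPf f, ← hPf g]
        abel
      map_smul' := fun c f => by
        refine hinj _ (hP _) _ (A.graph.smul_mem c (hP f)) ?_
        rw [hPf, Prod.smul_fst, Prod.smul_snd, smul_comm, ← smul_sub, hPf] }
  refine ⟨R'.mkContinuous l⁻¹ fun f => ?_, fun f => ?_, fun f => ?_, fun p hp => ?_⟩
  · rw [← div_eq_inv_mul, le_div_iff₀' hl]
    have := hcoer _ (hP f)
    rwa [hPf] at this
  · have h : (l : ℂ) • (P f).1 - f = (P f).2 := by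
      nth_rewrite 2 [← hPf f]
      abel
    change ((P f).1, (l : ℂ) • (P f).1 - f) ∈ A.graph
    rw [h]
    exact hP f
  · have := hcoer _ (hP f)
    rwa [hPf] at this
  · exact hinj _ (hP _) _ hp (hPf _)

theorem hasDerivAt_exp_smul_apply (B : E →L[ℂ] E) (x : E) (t : ℝ) :
    HasDerivAt (fun s : ℝ => NormedSpace.exp (s • B) x) (B (NormedSpace.exp (t • B) x)) t := by
  have h := hasDerivAt_exp_smul_const' (𝕂 := ℝ) B t
  exact ((ContinuousLinearMap.apply ℂ E x).restrictScalars ℝ).hasFDerivAt.comp_hasDerivAt t h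

theorem norm_exp_smul_apply_le {B : E →L[ℂ] E} (hB : ∀ x, (inner ℂ x (B x)).re ≤ 0) (x : E)
    {t : ℝ} (ht : 0 ≤ t) : ‖NormedSpace.exp (t • B) x‖ ≤ ‖x‖ := by
  let _ : InnerProductSpace ℝ E := InnerProductSpace.rclikeToReal ℂ E
  have hd : ∀ s : ℝ, HasDerivAt (fun s : ℝ => ‖NormedSpace.exp (s • B) x‖ ^ 2)
      (2 * inner ℝ (NormedSpace.exp (s • B) x) (B (NormedSpace.exp (s • B) x))) s :=
    fun s => (hasDerivAt_exp_smul_apply B x s).norm_sq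
  have hanti : Antitone fun s : ℝ => ‖NormedSpace.exp (s • B) x‖ ^ 2 :=
    antitone_of_hasDerivAt_nonpos hd fun s => by
      have := hB (NormedSpace.exp (s • B) x)
      rw [real_inner_eq_re_inner ℂ]
      change 2 * (inner ℂ _ _ : ℂ).re ≤ 0
      linarith
  have h := hanti ht
  simp only [zero_smul, NormedSpace.exp_zero] at h
  exact le_of_sq_le_sq h (norm_nonneg _)

omit [CompleteSpace E] in
/-- Yosida approximation. -/
theorem exists_yosida {A : E →ₗ.[ℂ] E} (hdiss : ∀ p ∈ A.graph, (inner ℂ p.1 p.2).re ≤ 0)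
    (hsurj : ∀ l : ℝ, 0 < l → ∀ f, ∃ p ∈ A.graph, (l : ℂ) • p.1 - p.2 = f) :
    ∃ J Y : ℕ → E →L[ℂ] E, (∀ n f, (J n f, Y n f) ∈ A.graph) ∧
      (∀ n f, J n f = f + ((1 / ((n : ℝ) + 1) : ℝ) : ℂ) • Y n f) ∧
      ∀ n, ∀ p ∈ A.graph, ‖Y n p.1‖ ≤ ‖p.2‖ := by
  have h : ∀ n : ℕ, ∃ R : E →L[ℂ] E, (∀ f, (R f, (((n : ℝ) + 1 : ℝ) : ℂ) • R f - f) ∈ A.graph) ∧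
      (∀ f, ((n : ℝ) + 1) * ‖R f‖ ≤ ‖f‖) ∧
      ∀ p ∈ A.graph, R ((((n : ℝ) + 1 : ℝ) : ℂ) • p.1 - p.2) = p.1 := fun n =>
    exists_resolvent hdiss (by positivity) (hsurj _ (by positivity))
  choose R hR1 hR2 hR3 using h
  -- With `λ = n + 1` and `R` the resolvent at `λ`, take `J = λ R` and `Y = A J = λ (λ R - 1)`.
  refine ⟨fun n => (((n : ℝ) + 1 : ℝ) : ℂ) • R n, fun n => (((n : ℝ) + 1 : ℝ) : ℂ) •
    ((((n : ℝ) + 1 : ℝ) : ℂ) • R n - ContinuousLinearMap.id ℂ E), fun n f => ?_, fun n f => ?_,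
    fun n p hp => ?_⟩
  · exact A.graph.smul_mem (((n : ℝ) + 1 : ℝ) : ℂ) (hR1 n f)
  · have h0 : (((n : ℝ) + 1 : ℝ) : ℂ) ≠ 0 := by
      have : ((n : ℝ) + 1) ≠ 0 := by positivity
      exact_mod_cast this
    simp only [smul_apply, sub_apply, ContinuousLinearMap.id_apply]
    rw [smul_smul, one_div, Complex.ofReal_inv, inv_mul_cancel₀ h0, one_smul]
    abel
  · have h1 := hR3 n p hp
    rw [map_sub, map_smul] at h1
    have h2 : (((n : ℝ) + 1 : ℝ) : ℂ) • R n p.1 - p.1 = R n p.2 := by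
      nth_rewrite 2 [← h1]
      abel
    simp only [smul_apply, sub_apply, ContinuousLinearMap.id_apply]
    rw [h2, norm_smul, Complex.norm_real, Real.norm_of_nonneg (by positivity)]
    exact hR2 n _

/-- If `v` is orthogonal to the domain, write `v = p₁ - A p₁`. Then `‖p₁‖² = Re ⟨p₁, A p₁⟩ ≤ 0`, so
`p₁ = 0` and `v = 0`. -/
theorem dense_domain_of_dissipative {A : E →ₗ.[ℂ] E}
    (hdiss : ∀ p ∈ A.graph, (inner ℂ p.1 p.2).re ≤ 0)
    (hsurj : ∀ l : ℝ, 0 < l → ∀ f, ∃ p ∈ A.graph, (l : ℂ) • p.1 - p.2 = f) :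
    Dense (A.domain : Set E) := by
  rw [← Submodule.dense_iff_topologicalClosure_eq_top.symm.eq,
    Submodule.topologicalClosure_eq_top_iff, Submodule.eq_bot_iff]
  intro v hv
  obtain ⟨p, hp, rfl⟩ := hsurj 1 one_pos v
  have hpd : p.1 ∈ A.domain := LinearPMap.mem_domain_of_mem_graph hp
  have h1 := congrArg Complex.re ((Submodule.mem_orthogonal _ _).1 hv _ hpd)
  have h2 := hdiss p hp
  rw [inner_sub_right, inner_smul_right, Complex.sub_re, Complex.re_ofReal_mul,
    Complex.zero_re] at h1
  have h3 : p.1 = 0 := by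
    rw [← norm_eq_zero]
    have h5 : (inner ℂ p.1 p.1).re = ‖p.1‖ ^ 2 := inner_self_eq_norm_sq (𝕜 := ℂ) p.1
    rw [h5] at h1
    nlinarith [norm_nonneg p.1]
  have h4 : p.2 = 0 := by
    have h5 : ((0 : E), p.2) ∈ A.graph := by rw [← h3]; exact hp
    exact A.graph_fst_eq_zero_snd h5 rfl
  rw [h3, h4]
  simp

/-- In the derivative `2 Re ⟨a - b, Y a - Y' b⟩`, replace `a - b` by `J a - J' b` minus `ε Y a - ε'
Y' b`. The first part contributes nonpositively by dissipativity. The remainder is at most `(ε + ε')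
M · 2M`, since each flow commutes with its generator and is contractive. -/
theorem norm_exp_yosida_sub_le {A : E →ₗ.[ℂ] E}
    (hdiss : ∀ p ∈ A.graph, (inner ℂ p.1 p.2).re ≤ 0) {J Y J' Y' : E →L[ℂ] E} {ε ε' : ℝ}
    (hε : 0 ≤ ε) (hε' : 0 ≤ ε')
    (hJ : ∀ f, (J f, Y f) ∈ A.graph) (hJ' : ∀ f, (J' f, Y' f) ∈ A.graph)
    (hY : ∀ f, J f = f + (ε : ℂ) • Y f) (hY' : ∀ f, J' f = f + (ε' : ℂ) • Y' f)
    (hYd : ∀ x, (inner ℂ x (Y x)).re ≤ 0) (hYd' : ∀ x, (inner ℂ x (Y' x)).re ≤ 0)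
    {x : E} {M : ℝ} (hM : ‖Y x‖ ≤ M) (hM' : ‖Y' x‖ ≤ M) {t : ℝ} (ht : 0 ≤ t) :
    ‖NormedSpace.exp (t • Y) x - NormedSpace.exp (t • Y') x‖ ^ 2 ≤ 4 * M ^ 2 * (ε + ε') * t := by
  let _ : InnerProductSpace ℝ E := InnerProductSpace.rclikeToReal ℂ E
  have hM0 : 0 ≤ M := (norm_nonneg _).trans hM
  have hcomm : ∀ (Z : E →L[ℂ] E) (s : ℝ), Z (NormedSpace.exp (s • Z) x)
      = NormedSpace.exp (s • Z) (Z x) := by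
    intro Z s
    have h : Commute Z (NormedSpace.exp (s • Z)) := ((Commute.refl Z).smul_right s).exp_right
    exact congrArg (fun L : E →L[ℂ] E => L x) h.eq
  let a : ℝ → E := fun s => NormedSpace.exp (s • Y) x
  let b : ℝ → E := fun s => NormedSpace.exp (s • Y') x
  have hd : ∀ s : ℝ, HasDerivAt (fun s : ℝ => ‖a s - b s‖ ^ 2 - 4 * M ^ 2 * (ε + ε') * s)
      (2 * inner ℝ (a s - b s) (Y (a s) - Y' (b s)) - 4 * M ^ 2 * (ε + ε')) s := by
    intro s
    have h := ((hasDerivAt_exp_smul_apply Y x s).sub (hasDerivAt_exp_smul_apply Y' x s)).norm_sq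
    refine (h.sub ((hasDerivAt_id s).const_mul (4 * M ^ 2 * (ε + ε')))).congr_deriv ?_
    rw [mul_one]
    rfl
  have hle : ∀ s, 0 ≤ s → 2 * inner ℝ (a s - b s) (Y (a s) - Y' (b s))
      - 4 * M ^ 2 * (ε + ε') ≤ 0 := by
    intro s hs
    have h1 : ‖Y (a s)‖ ≤ M := by
      simp only [a]
      rw [hcomm]
      exact (norm_exp_smul_apply_le hYd _ hs).trans hM
    have h2 : ‖Y' (b s)‖ ≤ M := by
      simp only [b]
      rw [hcomm]
      exact (norm_exp_smul_apply_le hYd' _ hs).trans hM'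
    have h3 := hdiss _ (A.graph.sub_mem (hJ (a s)) (hJ' (b s)))
    simp only [Prod.fst_sub, Prod.snd_sub, hY, hY'] at h3
    have h4 : a s + (ε : ℂ) • Y (a s) - (b s + (ε' : ℂ) • Y' (b s))
        = (a s - b s) + ((ε : ℂ) • Y (a s) - (ε' : ℂ) • Y' (b s)) := by abel
    rw [h4, inner_add_left, Complex.add_re] at h3
    have h5 := (Complex.abs_re_le_norm _).trans (norm_inner_le_norm (𝕜 := ℂ)
      ((ε : ℂ) • Y (a s) - (ε' : ℂ) • Y' (b s)) (Y (a s) - Y' (b s)))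
    have h6 : ‖(ε : ℂ) • Y (a s) - (ε' : ℂ) • Y' (b s)‖ ≤ (ε + ε') * M := by
      refine (norm_sub_le _ _).trans ?_
      rw [norm_smul, norm_smul, Complex.norm_real, Complex.norm_real, Real.norm_of_nonneg hε,
        Real.norm_of_nonneg hε', add_mul]
      gcongr
    have h7 : ‖Y (a s) - Y' (b s)‖ ≤ 2 * M := (norm_sub_le _ _).trans (by linarith)
    have h8 := mul_le_mul h6 h7 (norm_nonneg _) (by positivity)
    have h9 := neg_abs_le (inner ℂ ((ε : ℂ) • Y (a s) - (ε' : ℂ) • Y' (b s))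
      (Y (a s) - Y' (b s))).re
    have h10 : inner ℝ (a s - b s) (Y (a s) - Y' (b s))
      = (inner ℂ (a s - b s) (Y (a s) - Y' (b s))).re := rfl
    rw [h10]
    nlinarith
  have hanti : AntitoneOn (fun s : ℝ => ‖a s - b s‖ ^ 2 - 4 * M ^ 2 * (ε + ε') * s) (Ici 0) := by
    refine antitoneOn_of_deriv_nonpos (convex_Ici 0)
      (fun s _ => (hd s).continuousAt.continuousWithinAt)
      (fun s _ => (hd s).differentiableAt.differentiableWithinAt) fun s hs => ?_
    rw [(hd s).deriv]
    rw [interior_Ici] at hs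
    exact hle s hs.le
  have h := hanti (mem_Ici.2 le_rfl) (mem_Ici.2 ht) ht
  simp only [a, b, zero_smul, NormedSpace.exp_zero, sub_self, norm_zero, mul_zero] at h
  simp only [ne_eq, OfNat.ofNat_ne_zero, not_false_eq_true, zero_pow, sub_nonpos, sub_zero] at h
  linarith

end Generation

section Generation

variable {E : Type*} [NormedAddCommGroup E] [InnerProductSpace ℂ E] [CompleteSpace E]

/-- An m-dissipative operator generates mild solutions. -/
theorem exists_isMildSolution {A : E →ₗ.[ℂ] E} (hA : IsClosed (A.graph : Set (E × E)))
    (hdiss : ∀ p ∈ A.graph, (inner ℂ p.1 p.2).re ≤ 0)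
    (hsurj : ∀ l : ℝ, 0 < l → ∀ f, ∃ p ∈ A.graph, (l : ℂ) • p.1 - p.2 = f) (x : E) :
    ∃ z : ℝ → E, Continuous z ∧ (∀ t, ‖z t‖ ≤ ‖x‖) ∧ IsMildSolution A x z := by
  obtain ⟨J, Y, hJY, hJ, hY⟩ := exists_yosida hdiss hsurj
  set ε : ℕ → ℝ := fun n => 1 / ((n : ℝ) + 1) with hε
  have hε0 : ∀ n, 0 ≤ ε n := fun n => by simp only [hε]; positivity
  have hεlim : Tendsto ε atTop (𝓝 0) := tendsto_one_div_add_atTop_nhds_zero_nat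
  have hYd : ∀ n f, (inner ℂ f (Y n f)).re ≤ 0 := by
    intro n f
    have h1 := hdiss _ (hJY n f)
    simp only [hJ, inner_add_left, inner_smul_left, Complex.add_re, Complex.conj_ofReal,
      Complex.re_ofReal_mul] at h1
    have h2 : 0 ≤ (inner ℂ (Y n f) (Y n f)).re := inner_self_nonneg (𝕜 := ℂ)
    have h3 := mul_nonneg (hε0 n) h2
    simp only [hε] at h3
    linarith
  let S : ℕ → ℝ → E → E := fun n t y => NormedSpace.exp (t • Y n) y
  have hScontr : ∀ n t y, 0 ≤ t → ‖S n t y‖ ≤ ‖y‖ := fun n t y ht =>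
    norm_exp_smul_apply_le (hYd n) y ht
  have hSsub : ∀ n t y y', S n t y - S n t y' = S n t (y - y') := fun n t y y' =>
    (map_sub (NormedSpace.exp (t • Y n)) y y').symm
  have hSd : ∀ n y t, HasDerivAt (fun s => S n s y) (Y n (S n t y)) t := fun n y t =>
    hasDerivAt_exp_smul_apply (Y n) y t
  have hSc : ∀ n y, Continuous fun s => S n s y := fun n y =>
    continuous_iff_continuousAt.2 fun t => (hSd n y t).continuousAt
  -- The flows are compared on a vector `y` of the dense domain, where `‖Y n y‖ ≤ ‖A y‖`;
  -- contractivity transfers the estimate to `x`.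
  have hunif : ∀ R : ℝ, UniformCauchySeqOn (fun n t => S n t x) atTop (Icc 0 R) := by
    intro R
    rw [Metric.uniformCauchySeqOn_iff]
    intro δ hδ
    obtain ⟨y, hy, hxy⟩ := (dense_domain_of_dissipative hdiss hsurj).exists_dist_lt x
      (ε := δ / 4) (by positivity)
    have hp := A.mem_graph ⟨y, hy⟩
    set M := ‖A ⟨y, hy⟩‖ with hM
    have hlim : Tendsto (fun n => 8 * M ^ 2 * R * ε n) atTop (𝓝 0) := by
      simpa using hεlim.const_mul (8 * M ^ 2 * R)
    obtain ⟨N, hN⟩ := (hlim.eventually (gt_mem_nhds (show (0 : ℝ) < (δ / 2) ^ 2 by positivity))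
      ).exists_forall_of_atTop
    have hanti : ∀ n, N ≤ n → ε n ≤ ε N := fun n hn => by
      simp only [hε]
      gcongr
    refine ⟨N, fun m hm n hn t ht => ?_⟩
    have h1 := norm_exp_yosida_sub_le hdiss (hε0 m) (hε0 n) (hJY m) (hJY n) (hJ m) (hJ n)
      (hYd m) (hYd n) (hY m _ hp) (hY n _ hp) ht.1
    have h2 : ‖S m t y - S n t y‖ < δ / 2 := by
      refine lt_of_pow_lt_pow_left₀ 2 (by positivity) (h1.trans_lt ?_)
      refine lt_of_le_of_lt ?_ (hN N le_rfl)
      have h3 := hanti m hm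
      have h4 := hanti n hn
      have h5 : (ε m + ε n) * t ≤ (2 * ε N) * R :=
        mul_le_mul (by linarith) ht.2 ht.1 (by linarith [hε0 N])
      have h6 := mul_le_mul_of_nonneg_left h5 (show 0 ≤ 4 * M ^ 2 by positivity)
      calc 4 * ‖A ⟨y, hy⟩‖ ^ 2 * (ε m + ε n) * t = 4 * M ^ 2 * ((ε m + ε n) * t) := by ring
        _ ≤ 4 * M ^ 2 * (2 * ε N * R) := h6
        _ = 8 * M ^ 2 * R * ε N := by ring
    have h3 : ‖x - y‖ < δ / 4 := by rwa [← dist_eq_norm]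
    have h4 := (hScontr m t (x - y) ht.1).trans_lt h3
    have h5 := (hScontr n t (x - y) ht.1).trans_lt h3
    rw [dist_eq_norm]
    have h6 : S m t x - S n t x = S m t (x - y) + (S m t y - S n t y) - S n t (x - y) := by
      rw [← hSsub, ← hSsub]
      abel
    rw [h6]
    refine (norm_sub_le _ _).trans_lt ?_
    have := norm_add_le (S m t (x - y)) (S m t y - S n t y)
    linarith
  have hlim : ∀ t, ∃ v, 0 ≤ t → Tendsto (fun n => S n t x) atTop (𝓝 v) := by
    intro t
    by_cases ht : 0 ≤ t
    · obtain ⟨v, hv⟩ := cauchySeq_tendsto_of_complete ((hunif t).cauchySeq ⟨ht, le_rfl⟩)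
      exact ⟨v, fun _ => hv⟩
    · exact ⟨0, fun h => absurd h ht⟩
  choose z hz using hlim
  have hzc : ContinuousOn z (Ici 0) := by
    intro t ht
    have h1 : TendstoUniformlyOn (fun n t => S n t x) z atTop (Icc 0 (t + 1)) :=
      (hunif (t + 1)).tendstoUniformlyOn_of_tendsto fun s hs => hz s hs.1
    have h2 : ContinuousOn z (Icc 0 (t + 1)) :=
      h1.continuousOn (Frequently.of_forall fun n => (hSc n x).continuousOn)
    refine (h2 t ⟨ht, by linarith⟩).mono_of_mem_nhdsWithin ?_
    rw [← Ici_inter_Iic]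
    exact inter_mem self_mem_nhdsWithin (mem_nhdsWithin_of_mem_nhds (Iic_mem_nhds (by linarith)))
  have hzb : ∀ t, 0 ≤ t → ‖z t‖ ≤ ‖x‖ := fun t ht =>
    le_of_tendsto (hz t ht).norm (Eventually.of_forall fun n => hScontr n t x ht)
  refine ⟨fun t => z (max t 0), ?_, fun t => hzb _ (le_max_right _ _), ?_, fun t ht => ?_⟩
  · exact hzc.comp_continuous (by fun_prop) fun t => mem_Ici.2 (le_max_right t 0)
  · exact (hzc.comp_continuous (by fun_prop) fun t => mem_Ici.2 (le_max_right t 0)).continuousOn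
  have hI : Tendsto (fun n => ∫ s in (0 : ℝ)..t, S n s x) atTop
      (𝓝 (∫ s in (0 : ℝ)..t, z (max s 0))) := by
    refine intervalIntegral.tendsto_integral_filter_of_dominated_convergence (fun _ => ‖x‖)
      (Eventually.of_forall fun n => (hSc n x).aestronglyMeasurable)
      (Eventually.of_forall fun n => ae_of_all _ fun s hs => ?_) (by simp)
      (ae_of_all _ fun s hs => ?_)
    · rw [uIoc_of_le ht] at hs
      exact hScontr n s x hs.1.le
    · rw [uIoc_of_le ht] at hs
      rw [max_eq_left hs.1.le]
      exact hz s hs.1.le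
  have hFTC : ∀ n, Y n (∫ s in (0 : ℝ)..t, S n s x) = S n t x - x := by
    intro n
    rw [← ContinuousLinearMap.intervalIntegral_comp_comm _ ((hSc n x).intervalIntegrable _ _)]
    rw [intervalIntegral.integral_eq_sub_of_hasDerivAt (fun s _ => hSd n x s)
      (((Y n).continuous.comp (hSc n x)).intervalIntegrable _ _)]
    simp [S]
  have hzt : (fun t => z (max t 0)) t = z t := by simp only [max_eq_left ht]
  rw [hzt]
  -- Each approximate flow satisfies its integrated equation. `J n` moves its time integral only by
  -- `ε n (S n t x - x)`, which tends to 0, so closedness of the graph gives the limit equation.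
  refine hA.mem_of_tendsto (Tendsto.prodMk_nhds ?_ ((hz t ht).sub_const x))
    (Eventually.of_forall fun n => ?_) (f := fun n => (J n (∫ s in (0 : ℝ)..t, S n s x), S n t x - x))
  · have h1 : Tendsto (fun n => (∫ s in (0 : ℝ)..t, S n s x) + ((ε n : ℝ) : ℂ) • (S n t x - x))
        atTop (𝓝 ((∫ s in (0 : ℝ)..t, z (max s 0)) + ((0 : ℝ) : ℂ) • (z t - x))) :=
      hI.add (((Complex.continuous_ofReal.tendsto _).comp hεlim).smul ((hz t ht).sub_const x))
    rw [Complex.ofReal_zero, zero_smul, add_zero] at h1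
    refine h1.congr fun n => ?_
    rw [hJ, hFTC]
  · have := hJY n (∫ s in (0 : ℝ)..t, S n s x)
    rw [hFTC] at this
    exact this

end Generation

/-! ### Classical solutions of dissipative problems -/

section Classical

variable {E : Type*} [NormedAddCommGroup E] [InnerProductSpace ℂ E]
  {A : E →ₗ.[ℂ] E} {z₀ : E} {z : ℝ → E}

theorem IsClassicalSolution.shift (h : IsClassicalSolution A z₀ z) {s : ℝ} (hs : 0 ≤ s) :
    IsClassicalSolution A (z s) (fun t => z (s + t)) := by
  obtain ⟨_, z', hc, hz⟩ := h
  refine ⟨by simp, fun t => z' (s + t), hc.comp (by fun_prop) fun t ht => ?_, fun t ht => ?_⟩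
  · exact add_nonneg hs ht
  · have h1 := hz (s + t) (add_nonneg hs ht)
    refine ⟨h1.1, ?_⟩
    have h2 : HasDerivWithinAt (fun t => s + t) 1 (Ici 0) t :=
      ((hasDerivAt_id t).const_add s).hasDerivWithinAt
    have h3 := HasDerivWithinAt.scomp t h1.2 h2 fun r hr => add_nonneg hs (mem_Ici.1 hr)
    simpa [Function.comp_def] using h3

theorem IsClassicalSolution.sub {z₁ : E} {y : ℝ → E} (h : IsClassicalSolution A z₀ z)
    (h' : IsClassicalSolution A z₁ y) : IsClassicalSolution A (z₀ - z₁) (fun t => z t - y t) := by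
  obtain ⟨h0, z', hc, hz⟩ := h
  obtain ⟨h0', y', hc', hy⟩ := h'
  exact ⟨by simp only [h0, h0'], fun t => z' t - y' t, hc.sub hc', fun t ht =>
    ⟨A.graph.sub_mem (hz t ht).1 (hy t ht).1, (hz t ht).2.sub (hy t ht).2⟩⟩

theorem IsClassicalSolution.continuousOn (h : IsClassicalSolution A z₀ z) :
    ContinuousOn z (Ici 0) := by
  obtain ⟨_, z', _, hz⟩ := h
  exact fun t ht => (hz t ht).2.continuousWithinAt

theorem IsClassicalSolution.norm_le (hdiss : ∀ p ∈ A.graph, (inner ℂ p.1 p.2).re ≤ 0)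
    (h : IsClassicalSolution A z₀ z) {t : ℝ} (ht : 0 ≤ t) : ‖z t‖ ≤ ‖z₀‖ := by
  have hcont := h.continuousOn
  obtain ⟨h0, z', _, hz⟩ := h
  let _ : InnerProductSpace ℝ E := InnerProductSpace.rclikeToReal ℂ E
  have hd : ∀ s, 0 < s → HasDerivAt (fun s => ‖z s‖ ^ 2) (2 * inner ℝ (z s) (z' s)) s := fun s hs =>
    ((hz s hs.le).2.hasDerivAt (Ici_mem_nhds hs)).norm_sq
  have hanti : AntitoneOn (fun s => ‖z s‖ ^ 2) (Ici 0) := by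
    refine antitoneOn_of_deriv_nonpos (convex_Ici 0) (hcont.norm.pow 2)
      (fun s hs => ?_) fun s hs => ?_ <;> rw [interior_Ici] at hs
    · exact (hd s hs).differentiableAt.differentiableWithinAt
    · rw [(hd s hs).deriv]
      have h1 := hdiss _ (hz s (le_of_lt hs)).1
      have h2 : inner ℝ (z s) (z' s) = (inner ℂ (z s) (z' s)).re := rfl
      rw [h2]
      dsimp only at h1
      linarith
  have h1 := hanti (mem_Ici.2 le_rfl) (mem_Ici.2 ht) ht
  rw [← h0]
  exact le_of_sq_le_sq h1 (norm_nonneg _)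

theorem norm_deriv_le_of_forall_norm_sub_le {f : ℝ → E} {a b : ℝ} {v w : E}
    (hv : HasDerivWithinAt f v (Ici a) a) (hw : HasDerivWithinAt f w (Ici b) b)
    (h : ∀ r, 0 ≤ r → ‖f (b + r) - f b‖ ≤ ‖f (a + r) - f a‖) : ‖w‖ ≤ ‖v‖ := by
  have key : ∀ {c : ℝ} {u : E}, HasDerivWithinAt f u (Ici c) c →
      Tendsto (fun r : ℝ => ‖r⁻¹ • (f (c + r) - f c)‖) (𝓝[>] 0) (𝓝 ‖u‖) := by
    intro c u hu
    have h1 := (hasDerivWithinAt_iff_tendsto_slope' (s := Ioi c) (by simp)).1 hu.Ioi_of_Ici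
    have h2 : Tendsto (fun r : ℝ => c + r) (𝓝[>] 0) (𝓝[>] c) := by
      refine tendsto_nhdsWithin_iff.2 ⟨?_, ?_⟩
      · have : Tendsto (fun r : ℝ => c + r) (𝓝 0) (𝓝 (c + 0)) := (continuous_const_add c).tendsto 0
        rw [add_zero] at this
        exact this.mono_left nhdsWithin_le_nhds
      · filter_upwards [self_mem_nhdsWithin] with r hr
        simpa using hr
    refine ((h1.comp h2).congr fun r => ?_).norm
    rw [Function.comp_apply, slope_def_module, add_sub_cancel_left]
  refine le_of_tendsto_of_tendsto (key hw) (key hv) ?_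
  filter_upwards [self_mem_nhdsWithin] with r hr
  rw [norm_smul, norm_smul]
  gcongr
  exact h r (le_of_lt hr)

/-- The difference between `z` and its shift by `r` is again a classical solution, so its norm does
not increase. Divide by `r` and let `r` tend to 0. In this way `z'`, which need not be a classical
solution, is never differentiated. -/
theorem IsClassicalSolution.norm_deriv_le (hdiss : ∀ p ∈ A.graph, (inner ℂ p.1 p.2).re ≤ 0)
    (h : IsClassicalSolution A z₀ z) {z' : ℝ → E}
    (hz : ∀ t : ℝ, 0 ≤ t → HasDerivWithinAt z (z' t) (Ici 0) t) {t : ℝ} (ht : 0 ≤ t) :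
    ‖z' t‖ ≤ ‖z' 0‖ := by
  refine norm_deriv_le_of_forall_norm_sub_le (hz 0 le_rfl)
    ((hz t ht).mono (Ici_subset_Ici.2 ht)) fun r hr => ?_
  have h1 := ((h.shift hr).sub h).norm_le hdiss ht
  rw [add_comm t r, zero_add]
  rw [← h.1] at h1
  exact h1

/-- A classical solution is integrated in the graph. -/
theorem IsClassicalSolution.exists_graph_primitive [CompleteSpace E]
    (hA : IsClosed (A.graph : Set (E × E))) (h : IsClassicalSolution A z₀ z) :
    ∃ p : ℝ → A.graph, Continuous p ∧ (∀ t, 0 ≤ t → (p t).1.1 = z t) ∧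
      (∀ t, 0 ≤ t → HasDerivWithinAt z (p t).1.2 (Ici 0) t) ∧
      ∀ t, 0 ≤ t → ((∫ s in (0 : ℝ)..t, p s : A.graph) : E × E)
        = (∫ s in (0 : ℝ)..t, z (max s 0), z t - z₀) := by
  have hzc := h.continuousOn
  obtain ⟨h0, z', hc, hz⟩ := h
  have : CompleteSpace A.graph := hA.completeSpace_coe
  have hmax : ∀ t : ℝ, max t 0 ∈ Ici (0 : ℝ) := fun t => le_max_right t 0
  let p : ℝ → A.graph := fun t => ⟨(z (max t 0), z' (max t 0)), (hz _ (hmax t)).1⟩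
  have hp1 : Continuous fun t => z (max t 0) := hzc.comp_continuous (by fun_prop) hmax
  have hp2 : Continuous fun t => z' (max t 0) := hc.comp_continuous (by fun_prop) hmax
  have hp : Continuous p := Continuous.subtype_mk (hp1.prodMk hp2) _
  refine ⟨p, hp, fun t ht => by simp only [p, max_eq_left ht], fun t ht => ?_, fun t ht => ?_⟩
  · simp only [p, max_eq_left ht]
    exact (hz t ht).2
  have e1 := (ContinuousLinearMap.fst ℂ E E ∘L A.graph.subtypeL).intervalIntegral_comp_comm
    (hp.intervalIntegrable (μ := volume) 0 t)
  have e2 := (ContinuousLinearMap.snd ℂ E E ∘L A.graph.subtypeL).intervalIntegral_comp_comm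
    (hp.intervalIntegrable (μ := volume) 0 t)
  simp only [ContinuousLinearMap.comp_apply, Submodule.subtypeL_apply,
    ContinuousLinearMap.coe_fst', ContinuousLinearMap.coe_snd', p] at e1 e2
  refine Prod.ext e1.symm ?_
  simp only [p]
  rw [← e2, ← h0]
  refine intervalIntegral.integral_eq_sub_of_hasDeriv_right (f := z)
    (f' := fun s => z' (max s 0)) ?_ (fun s hs => ?_) (hp2.intervalIntegrable _ _)
  · rw [uIcc_of_le ht]
    exact hzc.mono fun s hs => hs.1
  · rw [min_eq_left ht] at hs
    rw [max_eq_left hs.1.le]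
    exact (hz s hs.1.le).2.mono fun r hr => (hs.1.trans hr).le

end Classical

/-! ### Laplace transforms inside a closed graph -/

section LaplaceGraph

variable {E F : Type*} [NormedAddCommGroup E] [NormedSpace ℂ E] [CompleteSpace E]
  [NormedAddCommGroup F] [NormedSpace ℂ F] [CompleteSpace F]

theorem map_laplace (L : E →L[ℂ] F) {q : ℝ → E} (hq : Continuous q) {K : ℝ}
    (hK : ∀ t, 0 < t → ‖q t‖ ≤ K * (1 + t)) {l : ℂ} (hl : 0 < l.re) :
    L (laplace q l) = laplace (fun t => L (q t)) l := by
  rw [laplace, ← L.integral_comp_comm (integrableOn_exp_smul hq.aestronglyMeasurable hK hl)]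
  simp only [map_smul, laplace]

omit [CompleteSpace E] in
theorem laplace_congr {f g : ℝ → E} (h : ∀ t, 0 < t → f t = g t) (l : ℂ) :
    laplace f l = laplace g l :=
  setIntegral_congr_fun measurableSet_Ioi fun t ht => by simp only [h t ht]

/-- If `(∫₀ᵗ z, z t - z₀)` stays in a closed subspace, so does `(z^, l z^ - z₀)`. -/
theorem exists_laplace_mem {Γ : Submodule ℂ (E × E)} (hΓ : IsClosed (Γ : Set (E × E)))
    {z : ℝ → E} (hz : Continuous z) {K : ℝ} (hK : ∀ t, ‖z t‖ ≤ K) {z₀ : E} {q : ℝ → Γ}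
    (hq : Continuous q)
    (hqz : ∀ t, 0 ≤ t → (q t : E × E) = (∫ s in (0 : ℝ)..t, z s, z t - z₀)) {l : ℂ}
    (hl : 0 < l.re) :
    ∃ P : Γ, (P : E × E) = (laplace z l, l • laplace z l - z₀) ∧
      ∀ L : Γ →L[ℂ] F, L P = l • laplace (fun t => L (q t)) l := by
  have : CompleteSpace Γ := hΓ.completeSpace_coe
  have hK0 : 0 ≤ K := (norm_nonneg _).trans (hK 0)
  have hqK : ∀ t, 0 < t → ‖q t‖ ≤ (K + ‖z₀‖) * (1 + t) := by
    intro t ht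
    have h1 : ‖∫ s in (0 : ℝ)..t, z s‖ ≤ K * t := by
      have := intervalIntegral.norm_integral_le_of_norm_le_const (a := 0) (b := t) (f := z) (C := K)
        (fun s _ => hK s)
      simpa [abs_of_nonneg ht.le] using this
    have h2 : ‖z t - z₀‖ ≤ K + ‖z₀‖ := (norm_sub_le _ _).trans (by gcongr; exact hK t)
    rw [Submodule.coe_norm, hqz t ht.le]
    refine max_le (h1.trans ?_) (h2.trans ?_)
    · nlinarith [norm_nonneg z₀]
    · exact le_mul_of_one_le_right (by positivity) (by linarith)
  -- The integral is taken in the closed subspace itself. Multiplication by `l` undoes the primitive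
  -- in the first component and turns the constant `z₀` into itself in the second.
  refine ⟨l • laplace q l, ?_, fun L => by rw [map_smul, map_laplace L hq hqK hl]⟩
  have h0 := map_laplace Γ.subtypeL hq hqK hl
  have h1 := map_laplace (ContinuousLinearMap.fst ℂ E E ∘L Γ.subtypeL) hq hqK hl
  have h2 := map_laplace (ContinuousLinearMap.snd ℂ E E ∘L Γ.subtypeL) hq hqK hl
  simp only [ContinuousLinearMap.comp_apply, Submodule.subtypeL_apply,
    ContinuousLinearMap.coe_fst', ContinuousLinearMap.coe_snd'] at h1 h2
  refine Prod.ext ?_ ?_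
  · rw [Submodule.coe_smul, Prod.smul_fst, h1,
      laplace_congr (g := fun t => ∫ s in (0 : ℝ)..t, z s) fun t ht => by rw [hqz t ht.le]]
    exact laplace_primitive hz (fun t _ => hK t) hl
  · rw [Submodule.coe_smul, Prod.smul_snd, h2,
      laplace_congr (g := fun t => z t - z₀) fun t ht => by rw [hqz t ht.le]]
    have h3 : laplace (fun t => z t - z₀) l = laplace z l - laplace (fun _ => z₀) l := by
      simp only [laplace, smul_sub]
      refine integral_sub
        (integrableOn_exp_smul (K := K) hz.aestronglyMeasurable (fun t ht => ?_) hl)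
        (integrableOn_exp_smul (K := ‖z₀‖) continuous_const.aestronglyMeasurable
          (fun t ht => ?_) hl)
      · exact (hK t).trans (le_mul_of_one_le_right hK0 (by linarith))
      · exact le_mul_of_one_le_right (norm_nonneg _) (by linarith)
    rw [h3, smul_sub, laplace_const z₀ hl]

end LaplaceGraph

/-! ### Dissipativity and resolvent of the coupled system -/

section System

variable {V X U W : Type*}
  [NormedAddCommGroup V] [InnerProductSpace ℂ V]
  [NormedAddCommGroup X] [InnerProductSpace ℂ X]
  [NormedAddCommGroup U] [InnerProductSpace ℂ U] [CompleteSpace U]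
  [NormedAddCommGroup W] [InnerProductSpace ℂ W] [CompleteSpace W]
  {j : V →L[ℂ] X} {B : U →L[ℂ] AntiDual V} {S : U →ₗ.[ℂ] U}

theorem mem_systemGraph_iff {p : EnergySpace V X U × EnergySpace V X U} :
    p ∈ systemGraph j B S ↔ j p.2.fst = p.1.snd.fst ∧
      (∀ v : V, inner ℂ v p.1.fst + B p.1.snd.snd v = -inner ℂ (j v) p.2.snd.fst) ∧
      (p.1.snd.snd, p.2.snd.snd - dualAdjoint B p.2.fst) ∈ S.graph :=
  Iff.rfl

theorem isClosed_systemGraph (hS : IsClosed (S.graph : Set (U × U))) :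
    IsClosed (systemGraph j B S : Set (EnergySpace V X U × EnergySpace V X U)) := by
  have h : (systemGraph j B S : Set (EnergySpace V X U × EnergySpace V X U)) =
      {p | j p.2.fst = p.1.snd.fst} ∩
      ((⋂ v : V, {p | inner ℂ v p.1.fst + B p.1.snd.snd v = -inner ℂ (j v) p.2.snd.fst}) ∩
      (fun p : EnergySpace V X U × EnergySpace V X U =>
        (p.1.snd.snd, p.2.snd.snd - dualAdjoint B p.2.fst)) ⁻¹' S.graph) := by
    ext p
    simp only [mem_inter_iff, mem_iInter, mem_ofPred_eq, mem_preimage, SetLike.mem_coe]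
    exact mem_systemGraph_iff
  rw [h]
  refine (isClosed_eq (by fun_prop) (by fun_prop)).inter (IsClosed.inter ?_ (hS.preimage (by fun_prop)))
  refine isClosed_iInter fun v => isClosed_eq ?_ (by fun_prop)
  have : Continuous fun p : EnergySpace V X U × EnergySpace V X U => B p.1.snd.snd v :=
    (B.flip v).continuous.comp (by fun_prop)
  fun_prop

omit [CompleteSpace U] in
theorem inner_energySpace (z ζ : EnergySpace V X U) : inner ℂ z ζ = inner ℂ z.fst ζ.fst +
    (inner ℂ z.snd.fst ζ.snd.fst + inner ℂ z.snd.snd ζ.snd.snd) := by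
  rw [WithLp.prod_inner_apply]
  exact congrArg _ (WithLp.prod_inner_apply _ _)

/-- The system is conservative but for the last component. -/
theorem re_inner_systemGraph {p : EnergySpace V X U × EnergySpace V X U}
    (hp : p ∈ systemGraph j B S) :
    (inner ℂ p.1 p.2).re
      = (inner ℂ p.1.snd.snd (p.2.snd.snd - dualAdjoint B p.2.fst)).re := by
  obtain ⟨h1, h2, -⟩ := mem_systemGraph_iff.1 hp
  have h3 := congrArg Complex.re (h2 p.2.fst)
  have h5 : (inner ℂ p.2.fst p.1.fst).re = (inner ℂ p.1.fst p.2.fst).re :=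
    inner_re_symm (𝕜 := ℂ) _ _
  have h6 : (inner ℂ p.1.snd.snd (dualAdjoint B p.2.fst)).re = (B p.1.snd.snd p.2.fst).re := by
    rw [← inner_dualAdjoint]
    exact inner_re_symm (𝕜 := ℂ) _ _
  rw [inner_energySpace, inner_sub_right, Complex.sub_re, h6, Complex.add_re, Complex.add_re]
  rw [h1, Complex.add_re, Complex.neg_re, h5] at h3
  linarith

theorem systemGraph_dissipative (hS : ∀ q ∈ S.graph, (inner ℂ q.1 q.2).re ≤ 0)
    {p : EnergySpace V X U × EnergySpace V X U} (hp : p ∈ systemGraph j B S) :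
    (inner ℂ p.1 p.2).re ≤ 0 := by
  rw [re_inner_systemGraph hp]
  exact hS _ (mem_systemGraph_iff.1 hp).2.2

/-- Dissipativity bounds `l - Γ` from below on the closed graph, so its range is closed; the
hypothesis says that its orthogonal complement is zero. -/
theorem exists_of_dissipative_of_orthogonal {E : Type*} [NormedAddCommGroup E]
    [InnerProductSpace ℂ E] [CompleteSpace E] {Γ : Submodule ℂ (E × E)}
    (hΓ : IsClosed (Γ : Set (E × E))) (hdiss : ∀ p ∈ Γ, (inner ℂ p.1 p.2).re ≤ 0) {l : ℝ}
    (hl : 0 < l)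
    (hort : ∀ ζ : E, (∀ p ∈ Γ, inner ℂ ((l : ℂ) • p.1 - p.2) ζ = 0) → ζ = 0) (f : E) :
    ∃ p ∈ Γ, (l : ℂ) • p.1 - p.2 = f := by
  have : CompleteSpace Γ := hΓ.completeSpace_coe
  let Λ : Γ →L[ℂ] E := ((l : ℂ) • ContinuousLinearMap.fst ℂ E E - ContinuousLinearMap.snd ℂ E E) ∘L
    Γ.subtypeL
  have hΛ : ∀ p : Γ, Λ p = (l : ℂ) • p.1.1 - p.1.2 := fun p => rfl
  have hcoer : ∀ p : Γ, l * ‖p.1.1‖ ≤ ‖Λ p‖ := by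
    intro p
    have h1 : (inner ℂ p.1.1 (Λ p)).re = l * ‖p.1.1‖ ^ 2 - (inner ℂ p.1.1 p.1.2).re := by
      rw [hΛ, inner_sub_right, inner_smul_right, Complex.sub_re, Complex.re_ofReal_mul]
      congr 2
      exact inner_self_eq_norm_sq (𝕜 := ℂ) _
    have h2 := (Complex.re_le_norm _).trans (norm_inner_le_norm (𝕜 := ℂ) p.1.1 (Λ p))
    have h3 := hdiss p p.2
    rcases (norm_nonneg p.1.1).eq_or_lt with h0 | h0
    · rw [← h0, mul_zero]
      exact norm_nonneg _
    · refine le_of_mul_le_mul_left ?_ h0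
      nlinarith
  have hbelow : ∀ p : Γ, ‖p‖ ≤ (l⁻¹ + 2) * ‖Λ p‖ := by
    intro p
    have h1 : ‖p.1.1‖ ≤ l⁻¹ * ‖Λ p‖ := by
      rw [← div_eq_inv_mul, le_div_iff₀' hl]
      exact hcoer p
    have h2 : ‖p.1.2‖ ≤ 2 * ‖Λ p‖ := by
      have h3 : p.1.2 = (l : ℂ) • p.1.1 - Λ p := by rw [hΛ]; abel
      rw [h3]
      refine (norm_sub_le _ _).trans ?_
      rw [norm_smul, Complex.norm_real, Real.norm_of_nonneg hl.le]
      linarith [hcoer p]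
    have h4 : 0 ≤ l⁻¹ * ‖Λ p‖ := by positivity
    rw [add_mul]
    exact max_le (h1.trans (by linarith [norm_nonneg (Λ p)])) (h2.trans (by linarith))
  have hanti : AntilipschitzWith (Real.toNNReal (l⁻¹ + 2)) Λ :=
    AddMonoidHomClass.antilipschitz_of_bound Λ fun p => by
      rw [Real.coe_toNNReal _ (by positivity)]
      exact hbelow p
  have hcl : IsClosed (Λ.range : Set E) := hanti.isClosed_range Λ.uniformContinuous
  have htop : Λ.range = ⊤ := by
    rw [← hcl.submodule_topologicalClosure_eq, Submodule.topologicalClosure_eq_top_iff,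
      Submodule.eq_bot_iff]
    intro ζ hζ
    exact hort ζ fun p hp => (Submodule.mem_orthogonal _ _).1 hζ _ ⟨⟨p, hp⟩, rfl⟩
  obtain ⟨p, hp⟩ := (htop ▸ Submodule.mem_top : f ∈ Λ.range)
  exact ⟨p, p.2, hp⟩

omit [CompleteSpace U] in
theorem mem_graph_neg {C : U →ₗ.[ℂ] U} {q : U × U} : q ∈ (-C).graph ↔ (q.1, -q.2) ∈ C.graph := by
  simp only [LinearPMap.mem_graph_iff, LinearPMap.neg_apply]
  constructor
  · rintro ⟨y, h1, h2⟩
    exact ⟨y, h1, by rw [← h2, neg_neg]⟩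
  · rintro ⟨y, h1, h2⟩
    exact ⟨y, h1, by rw [h2, neg_neg]⟩

theorem isClosed_graph_neg {C : U →ₗ.[ℂ] U} (hC : IsSkewAdjointOp C) :
    IsClosed ((-C).graph : Set (U × U)) := by
  have : ((-C).graph : Set (U × U)) = (fun q : U × U => (q.1, -q.2)) ⁻¹' C.graph := by
    ext q
    exact mem_graph_neg
  rw [this]
  exact hC.isClosed_graph.preimage (by fun_prop)

theorem re_inner_graph_neg {C : U →ₗ.[ℂ] U} (hC : IsSkewAdjointOp C) {q : U × U}
    (hq : q ∈ (-C).graph) : (inner ℂ q.1 q.2).re = 0 := by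
  have h := hC.re_inner_eq_zero (mem_graph_neg.1 hq)
  simpa using h

/-- A supply of graph elements with free parameters `g`, `y` and `(u, C u)`. In the inner product of
`V` the operator `A` is the Riesz map, so `A x = g - B u` is solved by adjoints. -/
theorem mem_systemGraph_neg_of_graph [CompleteSpace V] [CompleteSpace X] {C : U →ₗ.[ℂ] U} (g : X)
    (y : V) (q : C.graph) :
    ((WithLp.toLp 2 (ContinuousLinearMap.adjoint j g -
        ContinuousLinearMap.adjoint (dualAdjoint B) q.1.1, WithLp.toLp 2 (j y, q.1.1)),
      WithLp.toLp 2 (y, WithLp.toLp 2 (-g, dualAdjoint B y - q.1.2))) :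
        EnergySpace V X U × EnergySpace V X U) ∈ systemGraph j B (-C) := by
  refine mem_systemGraph_iff.2 ⟨rfl, fun v => ?_, ?_⟩
  · dsimp only [WithLp.toLp_fst, WithLp.toLp_snd]
    rw [inner_sub_right, ContinuousLinearMap.adjoint_inner_right,
      ContinuousLinearMap.adjoint_inner_right, inner_dualAdjoint, inner_neg_right]
    ring
  · dsimp only [WithLp.toLp_fst, WithLp.toLp_snd]
    rw [mem_graph_neg]
    simp

/-- Let `ζ = (a, b, c)` be orthogonal to the range. Testing with each parameter separately gives `b
= -l j a`, then `c ∈ D(C)` with `C c = l (c - B* a)`, and a scalar identity from `y = a`. As `Re ⟨c,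
C c⟩ = 0`, these combine to `‖a‖² + l² ‖j a‖² + ‖c‖² = 0`. -/
theorem conservative_surjective [CompleteSpace V] [CompleteSpace X] {C : U →ₗ.[ℂ] U}
    (hC : IsSkewAdjointOp C) {l : ℝ} (hl : 0 < l) (f : EnergySpace V X U) :
    ∃ p ∈ systemGraph j B (-C), ((l : ℂ) • p.1 : EnergySpace V X U) - p.2 = f := by
  have hcl : IsClosed (systemGraph j B (-C) : Set (EnergySpace V X U × EnergySpace V X U)) :=
    isClosed_systemGraph (isClosed_graph_neg hC)
  refine exists_of_dissipative_of_orthogonal (E := EnergySpace V X U)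
    (Γ := systemGraph j B (-C)) hcl (fun p hp => systemGraph_dissipative (fun q hq => (re_inner_graph_neg hC hq).le) hp) hl ?_ f
  intro ζ hζ
  set a := ζ.fst with ha
  set b := ζ.snd.fst with hb
  set c := ζ.snd.snd with hc
  set Bt : V →L[ℂ] U := dualAdjoint B with hBt
  let J' : X →L[ℂ] V := ContinuousLinearMap.adjoint j
  let B' : U →L[ℂ] V := ContinuousLinearMap.adjoint Bt
  have hJ' : ∀ g, inner ℂ (J' g) a = inner ℂ g (j a) := fun g =>
    ContinuousLinearMap.adjoint_inner_left j a g
  have hB' : ∀ u, inner ℂ (B' u) a = inner ℂ u (Bt a) := fun u =>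
    ContinuousLinearMap.adjoint_inner_left Bt a u
  have key : ∀ (g : X) (y : V) (q : C.graph),
      inner ℂ ((l : ℂ) • (J' g - B' q.1.1) - y) a + (inner ℂ ((l : ℂ) • j y + g) b
        + inner ℂ ((l : ℂ) • q.1.1 - (Bt y - q.1.2)) c) = 0 := by
    intro g y q
    have h := hζ _ (mem_systemGraph_neg_of_graph g y q)
    rw [inner_energySpace] at h
    rw [← sub_neg_eq_add ((l : ℂ) • j y) g]
    exact h
  have hb' : b = -((l : ℂ) • j a) := by
    refine ext_inner_left ℂ fun g => ?_
    have h := key g 0 0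
    simp only [map_zero, ZeroMemClass.coe_zero, Prod.fst_zero, Prod.snd_zero, sub_zero, smul_zero,
      zero_add, inner_zero_left, add_zero, inner_smul_left, Complex.conj_ofReal, hJ'] at h
    rw [inner_neg_right, inner_smul_right]
    linear_combination h
  have h1 := key 0 a 0
  simp only [map_zero, ZeroMemClass.coe_zero, Prod.fst_zero, Prod.snd_zero, sub_zero, smul_zero,
    zero_sub, add_zero, inner_smul_left, inner_neg_left, Complex.conj_ofReal, hb', inner_neg_right,
    inner_smul_right] at h1
  have h2 : (c, (l : ℂ) • (c - Bt a)) ∈ C.graph := by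
    refine hC.mem_graph fun q hq => ?_
    have h := key 0 0 ⟨q, hq⟩
    simp only [map_zero, zero_sub, sub_zero, smul_zero, add_zero, inner_zero_left, zero_add,
      inner_smul_left, inner_neg_left, smul_neg, Complex.conj_ofReal, sub_neg_eq_add,
      inner_add_left, hB'] at h
    rw [inner_smul_right, inner_sub_right]
    linear_combination h
  have h3 := hC.re_inner_eq_zero h2
  have h4 : (inner ℂ c c).re = ‖c‖ ^ 2 := inner_self_eq_norm_sq (𝕜 := ℂ) c
  have h5 : (inner ℂ a a).re = ‖a‖ ^ 2 := inner_self_eq_norm_sq (𝕜 := ℂ) a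
  have h6 : (inner ℂ (j a) (j a)).re = ‖j a‖ ^ 2 := inner_self_eq_norm_sq (𝕜 := ℂ) (j a)
  have h7 : (inner ℂ c (Bt a)).re = (inner ℂ (Bt a) c).re := inner_re_symm (𝕜 := ℂ) _ _
  rw [inner_smul_right, Complex.re_ofReal_mul, inner_sub_right, Complex.sub_re, h4, h7] at h3
  have h8 := congrArg Complex.re h1
  simp only [Complex.add_re, Complex.neg_re, Complex.re_ofReal_mul, h5, h6, Complex.zero_re] at h8
  have h9 : ‖c‖ ^ 2 = (inner ℂ (Bt a) c).re := by
    rcases mul_eq_zero.1 h3 with h | h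
    · exact absurd h hl.ne'
    · linarith
  have h10 : 0 ≤ l * (l * ‖j a‖ ^ 2) := by positivity
  have ha0 : a = 0 := by
    rw [← norm_eq_zero, ← sq_eq_zero_iff]
    nlinarith [sq_nonneg ‖c‖, sq_nonneg ‖a‖]
  have hc0 : c = 0 := by
    rw [← norm_eq_zero, ← sq_eq_zero_iff]
    nlinarith [sq_nonneg ‖c‖, sq_nonneg ‖a‖]
  rw [ha0, map_zero, smul_zero, neg_zero] at hb'
  apply WithLp.ofLp_injective 2
  refine Prod.ext ha0 ?_
  apply WithLp.ofLp_injective 2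
  exact Prod.ext hb' hc0

end System

/-! ### The transfer function on a vertical line -/

section Transfer

variable {V X U W : Type*}
  [NormedAddCommGroup V] [InnerProductSpace ℂ V]
  [NormedAddCommGroup X] [InnerProductSpace ℂ X]
  [NormedAddCommGroup U] [InnerProductSpace ℂ U] [CompleteSpace U]
  [NormedAddCommGroup W] [InnerProductSpace ℂ W] [CompleteSpace W]
  {j : V →L[ℂ] X} {B : U →L[ℂ] AntiDual V} {C : U →ₗ.[ℂ] U} {D : W →L[ℂ] AntiDual C.graph}

-- One bounded resolvent `R` suffices: the graph is the closed set where `R (s p₁ - p₂) = p₁`.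
omit [CompleteSpace U] in
theorem IsMDissipative.isClosed_graph {Chat : U →ₗ.[ℂ] U} (h : IsMDissipative Chat) :
    IsClosed (Chat.graph : Set (U × U)) := by
  obtain ⟨hd, s, hs, hsurj⟩ := h
  have hdiss : ∀ p ∈ Chat.graph, (inner ℂ p.1 p.2).re ≤ 0 := by
    intro p hp
    obtain ⟨u, h1, h2⟩ := (LinearPMap.mem_graph_iff _).1 hp
    rw [← h1, ← h2]
    exact hd u
  obtain ⟨R, hR1, -, hR3⟩ := exists_resolvent hdiss hs fun f => by
    obtain ⟨u, hu⟩ := hsurj f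
    exact ⟨_, Chat.mem_graph u, hu⟩
  have : (Chat.graph : Set (U × U)) = {p | R ((s : ℂ) • p.1 - p.2) = p.1} := by
    ext p
    refine ⟨fun hp => hR3 p hp, fun hp => ?_⟩
    have h1 := hR1 ((s : ℂ) • p.1 - p.2)
    rw [show R ((s : ℂ) • p.1 - p.2) = p.1 from hp, sub_sub_cancel] at h1
    exact h1
  rw [this]
  exact isClosed_eq (by fun_prop) (by fun_prop)

/-- The solutions of `(l + C + l B* (l² + A)⁻¹ B) u = f` satisfy `Re l ‖u‖² ≤ Re ⟨u, f⟩`. -/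
theorem transfer_coercive (hC : IsSkewAdjointOp C) {l : ℂ} (hl : 0 ≤ l.re) {u f : U} {x : V}
    (h1 : ∀ v : V, inner ℂ (j v) (l ^ 2 • j x) + inner ℂ v x = B u v)
    (h2 : ∀ v : C.graph, inner ℂ v.1.1 (l • u + l • dualAdjoint B x) - inner ℂ v.1.2 u
      = inner ℂ v.1.1 f) : l.re * ‖u‖ ^ 2 ≤ (inner ℂ u f).re := by
  have hg : (u, f - (l • u + l • dualAdjoint B x)) ∈ C.graph := by
    refine hC.mem_graph fun p hp => ?_
    have h := h2 ⟨p, hp⟩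
    rw [inner_sub_right, ← h]
    ring
  have h3 := hC.re_inner_eq_zero hg
  have h4 : inner ℂ u (dualAdjoint B x) = starRingEnd ℂ (B u x) := by
    rw [← inner_dualAdjoint, inner_conj_symm]
  have h5 := h1 x
  rw [inner_smul_right, inner_self_eq_norm_sq_to_K, inner_self_eq_norm_sq_to_K] at h5
  rw [inner_sub_right, inner_add_right, inner_smul_right, inner_smul_right,
    inner_self_eq_norm_sq_to_K, h4, ← h5] at h3
  simp only [map_add, map_mul, map_pow, Complex.coe_algebraMap, Complex.conj_ofReal] at h3
  -- Since `l · conj(l)² = |l|² conj(l)`, the second order part contributes `Re l (|l|² ‖j x‖² +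
  -- ‖x‖²)`, which is nonnegative and can be dropped.
  have h6 : l * ((starRingEnd ℂ l) ^ 2 * (‖j x‖ : ℂ) ^ 2 + (‖x‖ : ℂ) ^ 2)
      = ((‖l‖ ^ 2 * ‖j x‖ ^ 2 : ℝ) : ℂ) * starRingEnd ℂ l + ((‖x‖ ^ 2 : ℝ) : ℂ) * l := by
    have h7 := Complex.mul_conj' l
    push_cast
    linear_combination (starRingEnd ℂ l * (‖j x‖ : ℂ) ^ 2) * h7
  have h8 : l * (‖u‖ : ℂ) ^ 2 = ((‖u‖ ^ 2 : ℝ) : ℂ) * l := by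
    push_cast
    ring
  have h3' : (inner ℂ u f - (l * (‖u‖ : ℂ) ^ 2 +
      l * ((starRingEnd ℂ l) ^ 2 * (‖j x‖ : ℂ) ^ 2 + (‖x‖ : ℂ) ^ 2))).re = 0 := h3
  rw [h6, h8] at h3'
  simp only [Complex.sub_re, Complex.add_re, Complex.re_ofReal_mul, Complex.conj_re] at h3'
  have h9 : 0 ≤ ‖l‖ ^ 2 * ‖j x‖ ^ 2 * l.re := by positivity
  have h10 : 0 ≤ ‖x‖ ^ 2 * l.re := by positivity
  linarith

/-- On the line `Re l = β`, the solutions of `(l + C + l B* (l² + A)⁻¹ B) u = D w` satisfy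
`‖D* u‖ ≤ M ‖w‖`. -/
def TransferBound (j : V →L[ℂ] X) (B : U →L[ℂ] AntiDual V) (C : U →ₗ.[ℂ] U)
    (D : W →L[ℂ] AntiDual C.graph) (β M : ℝ) : Prop :=
  ∀ l : ℂ, l.re = β → ∀ (u : U) (x : V) (w : W),
    (∀ v : V, inner ℂ (j v) (l ^ 2 • j x) + inner ℂ v x = B u v) →
    (∀ v : C.graph, inner ℂ v.1.1 (l • u + l • dualAdjoint B x) - inner ℂ v.1.2 u = D w v) →
    ∃ h : W, HasDStar C D u h ∧ ‖h‖ ≤ M * ‖w‖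

/-- Coercivity makes the solution of the transfer equation unique on the line, so any solution is
the one that defines `H(l) w`. -/
theorem TransferEstimate.transferBound (hC : IsSkewAdjointOp C) (h : TransferEstimate j B C D) :
    ∃ β M : ℝ, 0 < β ∧ 0 ≤ M ∧ TransferBound j B C D β M := by
  obtain ⟨H, hH, β, hβ, M, hM⟩ := h
  refine ⟨β, M, hβ, (norm_nonneg _).trans (hM β (by simp)), fun l hl u x w h1 h2 => ?_⟩
  obtain ⟨u', x', h1', h2', hu'⟩ := hH l (hl ▸ hβ) w
  have huu : u - u' = 0 := by
    have h3 := transfer_coercive (u := u - u') (x := x - x') (f := 0) (j := j) (B := B) hC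
      (l := l) (by rw [hl]; exact hβ.le) (fun v => ?_) fun v => ?_
    · rw [inner_zero_right, Complex.zero_re, hl] at h3
      rw [← norm_eq_zero, ← sq_eq_zero_iff]
      nlinarith [sq_nonneg ‖u - u'‖]
    · rw [map_sub, smul_sub, inner_sub_right, inner_sub_right, map_sub, sub_apply, ← h1,
        ← h1']
      ring
    · have e : l • (u - u') + l • dualAdjoint B (x - x')
          = (l • u + l • dualAdjoint B x) - (l • u' + l • dualAdjoint B x') := by
        rw [map_sub, smul_sub, smul_sub]
        abel
      rw [e, inner_sub_right, inner_sub_right, inner_zero_right]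
      linear_combination h2 v - h2' v
  rw [sub_eq_zero] at huu
  refine ⟨-H l w, huu ▸ hu', ?_⟩
  rw [norm_neg]
  exact (H l).le_of_opNorm_le (hM l hl) w

/-- Any line would do. On `Re l = 1` coercivity reads `‖u‖² ≤ Re ⟨u, D₀ w⟩`, so `‖u‖ ≤ ‖D₀ w‖` and
`M = ‖D₀‖²` works. -/
theorem IsBoundedDamping.transferBound (hC : IsSkewAdjointOp C) (h : IsBoundedDamping C D) :
    ∃ β M : ℝ, 0 < β ∧ 0 ≤ M ∧ TransferBound j B C D β M := by
  obtain ⟨D₀, hD⟩ := h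
  refine ⟨1, ‖D₀‖ * ‖D₀‖, one_pos, by positivity, fun l hl u x w h1 h2 =>
    ⟨_, hasDStar_of_bounded hC hD u, ?_⟩⟩
  have h3 := transfer_coercive (f := D₀ w) hC (by rw [hl]; exact zero_le_one) h1
    fun v => (h2 v).trans (hD w v)
  have h4 := (Complex.re_le_norm _).trans (norm_inner_le_norm (𝕜 := ℂ) u (D₀ w))
  rw [hl, one_mul] at h3
  have h5 : ‖u‖ ≤ ‖D₀ w‖ := by
    by_contra! h6
    nlinarith [norm_nonneg (D₀ w)]
  calc ‖ContinuousLinearMap.adjoint D₀ u‖ ≤ ‖ContinuousLinearMap.adjoint D₀‖ * ‖u‖ :=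
        (ContinuousLinearMap.adjoint D₀).le_opNorm u
    _ ≤ ‖D₀‖ * (‖D₀‖ * ‖w‖) := by
        rw [LinearIsometryEquiv.norm_map]
        gcongr
        exact h5.trans (D₀.le_opNorm w)
    _ = ‖D₀‖ * ‖D₀‖ * ‖w‖ := by ring

/-- The last component of the equation of the system. -/
noncomputable def systemThird (B : U →L[ℂ] AntiDual V) :
    EnergySpace V X U × EnergySpace V X U →L[ℂ] U × U where
  toFun p := (p.1.snd.snd, p.2.snd.snd - dualAdjoint B p.2.fst)
  map_add' p q := by
    refine Prod.ext (by simp) ?_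
    simp only [Prod.snd_add, WithLp.add_fst, WithLp.add_snd, map_add]
    abel
  map_smul' c p := by
    refine Prod.ext (by simp) ?_
    simp [smul_sub]
  cont := by fun_prop

omit [CompleteSpace W] in
/-- Difference of the resolvent equations of the damped and conservative systems. -/
theorem transfer_equations (hC : IsSkewAdjointOp C) {Chat : U →ₗ.[ℂ] U} {l : ℂ}
    {z₀ a b : EnergySpace V X U} (ha : (a, l • a - z₀) ∈ systemGraph j B Chat)
    (hb : (b, l • b - z₀) ∈ systemGraph j B (-C)) {w : W}
    (hw : ∀ v : C.graph, inner ℂ v.1.1 ((l • a - z₀).snd.snd - dualAdjoint B (l • a - z₀).fst)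
      = inner ℂ v.1.2 a.snd.snd - D w v) :
    (∀ v : V, inner ℂ (j v) (l ^ 2 • j (a - b).fst) + inner ℂ v (a - b).fst
      = B (b - a).snd.snd v) ∧
    (∀ v : C.graph, inner ℂ v.1.1 (l • (b - a).snd.snd + l • dualAdjoint B (a - b).fst)
      - inner ℂ v.1.2 (b - a).snd.snd = D w v) := by
  obtain ⟨ha1, ha2, -⟩ := mem_systemGraph_iff.1 ha
  obtain ⟨hb1, hb2, hb3⟩ := mem_systemGraph_iff.1 hb
  simp only [WithLp.sub_fst, WithLp.sub_snd, WithLp.smul_fst, WithLp.smul_snd, map_sub,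
    map_smul] at ha1 ha2 hb1 hb2 hb3 hw
  -- The unknowns are `u = u_b - u_a` and `x = x_a - x_b`: the opposite order in `x` absorbs the
  -- sign of `B u` in the second equation of the system.
  constructor
  · intro v
    have e1 := ha2 v
    have e2 := hb2 v
    simp only [WithLp.sub_fst, WithLp.sub_snd, map_sub, sub_apply, inner_sub_right,
      inner_smul_right, smul_sub] at e1 e2 ⊢
    rw [← ha1] at e1
    rw [← hb1] at e2
    simp only [inner_sub_right, inner_smul_right] at e1 e2
    linear_combination e1 - e2
  · intro v
    have e1 := hw v
    have e2 := hC.inner_eq v.2 (mem_graph_neg.1 hb3)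
    simp only [WithLp.sub_fst, WithLp.sub_snd, map_sub, smul_sub, inner_sub_right,
      inner_add_right, inner_smul_right, inner_neg_right] at e1 e2 ⊢
    linear_combination -e2 - e1

end Transfer

/-! ### Comparison of the conservative and damped outputs -/

section Observation

variable {V X U W : Type*}
  [NormedAddCommGroup V] [InnerProductSpace ℂ V]
  [NormedAddCommGroup X] [InnerProductSpace ℂ X]
  [NormedAddCommGroup U] [InnerProductSpace ℂ U] [CompleteSpace U]
  [NormedAddCommGroup W] [InnerProductSpace ℂ W] [CompleteSpace W]
  {j : V →L[ℂ] X} {B : U →L[ℂ] AntiDual V} {C : U →ₗ.[ℂ] U} {D : W →L[ℂ] AntiDual C.graph}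

theorem mem_systemOp_graph (hj : Function.Injective j) (hjd : DenseRange j) {S : U →ₗ.[ℂ] U}
    {p : EnergySpace V X U × EnergySpace V X U} :
    p ∈ (systemOp j B S).graph ↔ p ∈ systemGraph j B S := by
  rw [systemOp_graph j hj hjd]

/-- Restriction of `systemThird` to the graph of `systemOp`. -/
noncomputable def systemThirdGraph (hj : Function.Injective j) (hjd : DenseRange j)
    (B : U →L[ℂ] AntiDual V) (S : U →ₗ.[ℂ] U) : (systemOp j B S).graph →L[ℂ] S.graph :=
  ((systemThird B).comp (systemOp j B S).graph.subtypeL).codRestrict S.graph fun p =>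
    (mem_systemGraph_iff.1 ((mem_systemOp_graph hj hjd).1 p.2)).2.2

/-- `(z, 𝒜_c z) ↦ (u, C u)`. -/
noncomputable def conservativeThird (hj : Function.Injective j) (hjd : DenseRange j)
    (B : U →L[ℂ] AntiDual V) (C : U →ₗ.[ℂ] U) : (systemOp j B (-C)).graph →L[ℂ] C.graph :=
  (((ContinuousLinearMap.fst ℂ U U).prod (-ContinuousLinearMap.snd ℂ U U)).comp
    ((systemThird B).comp (systemOp j B (-C)).graph.subtypeL)).codRestrict C.graph fun p =>
      mem_graph_neg.1 (mem_systemGraph_iff.1 ((mem_systemOp_graph hj hjd).1 p.2)).2.2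

variable [CompleteSpace V] [CompleteSpace X]

/-- The output of the conservative system is controlled by that of the damped system. -/
theorem exists_conservative_output (hj : Function.Injective j) (hjd : DenseRange j)
    (hC : IsSkewAdjointOp C) {Chat : U →ₗ.[ℂ] U} (hChat : IsMDissipative Chat)
    {L : Chat.graph →L[ℂ] W} (hL : ∀ p : Chat.graph, HasDStar C D p.1.1 (L p) ∧
      (∀ v : C.graph, inner ℂ v.1.1 p.1.2 = inner ℂ v.1.2 p.1.1 - D (L p) v))
    {β M : ℝ} (hβ : 0 < β) (hM : 0 ≤ M) (hT : TransferBound j B C D β M)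
    {z₀ : EnergySpace V X U} {z : ℝ → EnergySpace V X U}
    (hz : IsClassicalSolution (systemOp j B Chat) z₀ z)
    {p : ℝ → (systemOp j B Chat).graph} (hp : Continuous p) {K : ℝ} (hpK : ∀ t, 0 ≤ t → ‖p t‖ ≤ K)
    (hpz : ∀ t, 0 ≤ t → ((∫ s in (0 : ℝ)..t, p s : (systemOp j B Chat).graph) :
      EnergySpace V X U × EnergySpace V X U) = (∫ s in (0 : ℝ)..t, z (max s 0), z t - z₀))
    (hzK : ∀ t, 0 ≤ t → ‖z t‖ ≤ K) {T : ℝ} (hT0 : 0 ≤ T) :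
    ∃ (z₁ : ℝ → EnergySpace V X U) (y : ℝ → W), IsMildSolution (systemOp j B (-C)) z₀ z₁ ∧
      IsOutput C D T (fun s => (z₁ s).snd.snd) y ∧
      ∫ s in (0 : ℝ)..T, ‖y s‖ ^ 2 ≤ Real.exp (2 * β * T) * (1 + M) ^ 2 *
        ∫ s in Ioi (0 : ℝ), Real.exp (-(2 * β * s)) *
          ‖L (systemThirdGraph hj hjd B Chat (p s))‖ ^ 2 := by
  have hcld : IsClosed ((systemOp j B Chat).graph :
      Set (EnergySpace V X U × EnergySpace V X U)) := by
    rw [systemOp_graph j hj hjd]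
    exact isClosed_systemGraph hChat.isClosed_graph
  have hclc : IsClosed ((systemOp j B (-C)).graph :
      Set (EnergySpace V X U × EnergySpace V X U)) := by
    rw [systemOp_graph j hj hjd]
    exact isClosed_systemGraph (isClosed_graph_neg hC)
  obtain ⟨z₁, hz₁c, hz₁b, hz₁⟩ := exists_isMildSolution hclc
    (fun p hp => systemGraph_dissipative (fun q hq => (re_inner_graph_neg hC hq).le)
      ((mem_systemOp_graph hj hjd).1 hp))
    (fun l hl f => by
      obtain ⟨p, hp, e⟩ := conservative_surjective (j := j) (B := B) hC hl f
      exact ⟨p, (mem_systemOp_graph hj hjd).2 hp, e⟩) z₀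
  have : CompleteSpace (systemOp j B Chat).graph := hcld.completeSpace_coe
  have : CompleteSpace (systemOp j B (-C)).graph := hclc.completeSpace_coe
  have hK0 : 0 ≤ K := (norm_nonneg _).trans (hzK 0 le_rfl)
  let Ld : (systemOp j B Chat).graph →L[ℂ] W := L ∘L systemThirdGraph hj hjd B Chat
  let Lc : (systemOp j B (-C)).graph →L[ℂ] W := dualAdjoint D ∘L conservativeThird hj hjd B C
  let g : ℝ → W := fun t => Ld (p t)
  have hg : Continuous g := Ld.continuous.comp hp
  have hgK : ∀ t, 0 ≤ t → ‖g t‖ ≤ ‖Ld‖ * K := fun t ht =>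
    (Ld.le_opNorm _).trans (mul_le_mul_of_nonneg_left (hpK t ht) (norm_nonneg _))
  let qc : ℝ → (systemOp j B (-C)).graph := fun t =>
    ⟨(∫ s in (0 : ℝ)..(max t 0), z₁ s, z₁ (max t 0) - z₀), hz₁.2 _ (le_max_right t 0)⟩
  have hprim : Continuous fun t => ∫ s in (0 : ℝ)..t, z₁ s :=
    intervalIntegral.continuous_primitive (fun a b => hz₁c.intervalIntegrable a b) 0
  have hqc : Continuous qc := by
    refine Continuous.subtype_mk ?_ _
    exact (hprim.comp (by fun_prop)).prodMk ((hz₁c.comp (by fun_prop)).sub continuous_const)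
  have hqcz : ∀ t, 0 ≤ t → (qc t : EnergySpace V X U × EnergySpace V X U)
      = (∫ s in (0 : ℝ)..t, z₁ s, z₁ t - z₀) := fun t ht => by
    simp only [qc, max_eq_left ht]
  -- For a mild solution `D* u₁(t)` may be undefined, but `D* ∫₀ᵗ u₁` makes sense. The output will
  -- be the derivative of `k`.
  let k : ℝ → W := fun t => Lc (qc t)
  have hk : Continuous k := Lc.continuous.comp hqc
  have hk0 : k 0 = 0 := by
    have h1 : qc 0 = 0 := by
      apply Subtype.ext
      rw [hqcz 0 le_rfl]
      have h2 := hz₁.2 0 le_rfl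
      rw [intervalIntegral.integral_same] at h2 ⊢
      have h3 := (systemOp j B (-C)).graph_fst_eq_zero_snd h2 rfl
      rw [h3]
      rfl
    simp only [k, h1, map_zero]
  have hqK : ∀ t, 0 < t → ‖qc t‖ ≤ (2 * ‖z₀‖) * (1 + t) := by
    intro t ht
    have h1 : ‖∫ s in (0 : ℝ)..t, z₁ s‖ ≤ ‖z₀‖ * t := by
      have := intervalIntegral.norm_integral_le_of_norm_le_const (a := 0) (b := t) (f := z₁)
        (C := ‖z₀‖) (fun s _ => hz₁b s)
      simpa [abs_of_nonneg ht.le] using this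
    have h2 : ‖z₁ t - z₀‖ ≤ 2 * ‖z₀‖ := (norm_sub_le _ _).trans (by linarith [hz₁b t])
    rw [Submodule.coe_norm, hqcz t ht.le]
    refine max_le (h1.trans ?_) (h2.trans ?_) <;> nlinarith [norm_nonneg z₀]
  have hline : ∀ l : ℂ, l.re = β → ‖l • laplace k l‖ ≤ (1 + M) * ‖laplace g l‖ := by
    intro l hl
    have hl0 : 0 < l.re := hl ▸ hβ
    have hzmax : Continuous fun t => z (max t 0) :=
      hz.continuousOn.comp_continuous (by fun_prop) fun t => mem_Ici.2 (le_max_right t 0)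
    have hqd : Continuous fun t => ∫ s in (0 : ℝ)..t, p s :=
      intervalIntegral.continuous_primitive (fun a b => hp.intervalIntegrable a b) 0
    obtain ⟨Pd, hPd, hLd⟩ := exists_laplace_mem (F := W) hcld hzmax
      (fun t => hzK _ (le_max_right t 0)) (z₀ := z₀) hqd
      (fun t ht => by rw [hpz t ht, max_eq_left ht]) hl0
    obtain ⟨Pc, hPc, hLc⟩ := exists_laplace_mem (F := W) hclc hz₁c hz₁b hqc hqcz hl0
    have hgd : Ld Pd = laplace g l := by
      rw [hLd Ld, ← laplace_primitive hg hgK hl0]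
      simp only [g, ← Ld.intervalIntegral_comp_comm (hp.intervalIntegrable _ _)]
    have hkc : Lc Pc = l • laplace k l := hLc Lc
    set a := laplace (fun t => z (max t 0)) l with ha
    set b := laplace z₁ l with hb
    have hPd2 := (mem_systemOp_graph hj hjd).1 Pd.2
    have hPc2 := (mem_systemOp_graph hj hjd).1 Pc.2
    rw [hPd] at hPd2
    rw [hPc] at hPc2
    have hth : ((systemThirdGraph hj hjd B Chat Pd : Chat.graph) : U × U)
        = (a.snd.snd, (l • a - z₀).snd.snd - dualAdjoint B (l • a - z₀).fst) := by
      change systemThird B (Pd : EnergySpace V X U × EnergySpace V X U) = _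
      rw [hPd]
      rfl
    have hthc : ((conservativeThird hj hjd B C Pc : C.graph) : U × U).1 = b.snd.snd := by
      change (Pc : EnergySpace V X U × EnergySpace V X U).1.snd.snd = _
      rw [hPc]
    obtain ⟨hs1, hs2⟩ := hL (systemThirdGraph hj hjd B Chat Pd)
    rw [hth] at hs1 hs2
    -- Both resolvent equations have the same datum `z₀`, which cancels; the source that remains is
    -- `D` applied to the transform of the damped output.
    obtain ⟨e1, e2⟩ := transfer_equations hC hPd2 hPc2 hs2
    obtain ⟨h, hh, hhM⟩ := hT l hl _ _ _ e1 e2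
    have hc1 := hasDStar_graph (D := D) hC (conservativeThird hj hjd B C Pc)
    rw [hthc] at hc1
    have hsum := hs1.add hh
    have e3 : a.snd.snd + (b - a).snd.snd = b.snd.snd := by
      rw [WithLp.sub_snd, WithLp.sub_snd]
      abel
    rw [e3] at hsum
    have e4 := hc1.unique hC hsum
    have e5 : l • laplace k l = laplace g l + h := by
      rw [← hkc, ← hgd]
      exact e4
    have hgd' : L (systemThirdGraph hj hjd B Chat Pd) = laplace g l := hgd
    rw [hgd'] at hhM
    rw [e5, add_mul, one_mul]
    exact (norm_add_le _ _).trans (by gcongr)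
  have hkK : ∀ t, 0 < t → ‖k t‖ ≤ (‖Lc‖ * (2 * ‖z₀‖) + ‖Ld‖ * K) * (1 + t) := by
    intro t ht
    have h1 : ‖k t‖ ≤ ‖Lc‖ * (2 * ‖z₀‖ * (1 + t)) :=
      (Lc.le_opNorm (qc t)).trans (mul_le_mul_of_nonneg_left (hqK t ht) (norm_nonneg _))
    have h2 : 0 ≤ ‖Ld‖ * K * (1 + t) := by positivity
    linarith
  have hgK' : ∀ t, 0 < t → ‖g t‖ ≤ (‖Lc‖ * (2 * ‖z₀‖) + ‖Ld‖ * K) * (1 + t) := by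
    intro t ht
    refine (hgK t ht.le).trans ?_
    have h1 : 0 ≤ ‖Ld‖ * K := by positivity
    have h2 : 0 ≤ ‖Lc‖ * (2 * ‖z₀‖) := by positivity
    nlinarith
  obtain ⟨y, hy1, hy2, hy3⟩ := exists_output hk hk0 hg hkK hgK' hβ hline (by positivity) hT0
  refine ⟨z₁, y, hz₁, ⟨hy1, fun t ht => ⟨conservativeThird hj hjd B C (qc t), ?_, hy2 t ht⟩⟩, hy3⟩
  change (qc t : EnergySpace V X U × EnergySpace V X U).1.snd.snd = _
  rw [hqcz t ht.1]
  let Λ : EnergySpace V X U →L[ℂ] U :=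
    WithLp.sndL 2 ℂ X U ∘L WithLp.sndL 2 ℂ V (WithLp 2 (X × U))
  exact (Λ.intervalIntegral_comp_comm (hz₁c.intervalIntegrable _ _)).symm

end Observation

/-! ### Observation controlled by energy drops -/

section Observation

/-- A weighted integral over `(0, ∞)` is bounded by the weighted sum over the intervals
`(k T, (k + 1) T)`. -/
theorem integral_exp_mul_le_tsum {f : ℝ → ℝ} (hf : Continuous f) (hf0 : ∀ t, 0 ≤ f t) {K : ℝ}
    (hK : ∀ t, 0 ≤ t → f t ≤ K) {b T : ℝ} (hb : 0 < b) (hT : 0 < T) :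
    ∫ s in Ioi (0 : ℝ), Real.exp (-(b * s)) * f s
      ≤ ∑' k : ℕ, Real.exp (-(b * T)) ^ k * ∫ s in (k * T : ℝ)..((k + 1) * T), f s := by
  set F : ℝ → ℝ := fun s => Real.exp (-(b * s)) * f s with hF
  have hFc : Continuous F := by
    simp only [hF]
    fun_prop
  have hFi : IntegrableOn F (Ioi 0) := by
    have h1 : IntegrableOn (fun t : ℝ => Real.exp (-(b * t))) (Ioi 0) := by
      simpa using integrableOn_exp_mul_Ioi (neg_lt_zero.2 hb) 0
    refine (h1.const_mul K).mono' hFc.aestronglyMeasurable ?_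
    filter_upwards [ae_restrict_mem measurableSet_Ioi] with t ht
    rw [Real.norm_of_nonneg (mul_nonneg (Real.exp_pos _).le (hf0 t)), mul_comm]
    gcongr
    exact hK t (le_of_lt ht)
  have hle : ∀ k : ℕ, (k * T : ℝ) ≤ (k + 1) * T := fun k => by gcongr; linarith
  have hI0 : ∀ k : ℕ, 0 ≤ ∫ s in (k * T : ℝ)..((k + 1) * T), f s := fun k =>
    intervalIntegral.integral_nonneg (hle k) fun s _ => hf0 s
  have hIK : ∀ k : ℕ, ∫ s in (k * T : ℝ)..((k + 1) * T), f s ≤ K * T := by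
    intro k
    have := intervalIntegral.integral_mono_on (μ := volume) (hle k) (hf.intervalIntegrable _ _)
      (continuous_const.intervalIntegrable _ _)
      (g := fun _ => K) fun s hs => hK s ((by positivity : (0 : ℝ) ≤ k * T).trans hs.1)
    rw [intervalIntegral.integral_const, smul_eq_mul] at this
    linarith
  set q := Real.exp (-(b * T)) with hq
  have hq1 : q < 1 := Real.exp_lt_one_iff.2 (by nlinarith)
  have hsum : Summable fun k : ℕ => q ^ k * ∫ s in (k * T : ℝ)..((k + 1) * T), f s := by
    refine Summable.of_nonneg_of_le (fun k => mul_nonneg (by positivity) (hI0 k)) (fun k => ?_)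
      ((summable_geometric_of_lt_one (Real.exp_pos _).le hq1).mul_right (K * T))
    gcongr
    exact hIK k
  have hlim : Tendsto (fun n : ℕ => ∫ s in (0 : ℝ)..(n * T), F s) atTop
      (𝓝 (∫ s in Ioi (0 : ℝ), F s)) :=
    intervalIntegral_tendsto_integral_Ioi 0 hFi
      (tendsto_natCast_atTop_atTop.atTop_mul_const hT)
  refine le_of_tendsto hlim (Eventually.of_forall fun n => ?_)
  have h1 := intervalIntegral.sum_integral_adjacent_intervals (μ := volume) (f := F)
    (a := fun k : ℕ => (k * T : ℝ)) (n := n) fun k _ => hFc.intervalIntegrable _ _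
  simp only [Nat.cast_zero, zero_mul, Nat.cast_add, Nat.cast_one] at h1
  rw [← h1]
  refine le_trans (Finset.sum_le_sum fun k _ => ?_)
    (hsum.sum_le_tsum (Finset.range n) fun k _ => mul_nonneg (by positivity) (hI0 k))
  rw [← intervalIntegral.integral_const_mul]
  refine intervalIntegral.integral_mono_on (hle k) (hFc.intervalIntegrable _ _)
    ((hf.const_mul _).intervalIntegrable _ _) fun s hs => ?_
  refine mul_le_mul_of_nonneg_right ?_ (hf0 s)
  rw [hq, ← Real.exp_nat_mul, Real.exp_le_exp]
  have := mul_le_mul_of_nonneg_left hs.1 hb.le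
  linarith

variable {V X U W : Type*}
  [NormedAddCommGroup V] [InnerProductSpace ℂ V] [CompleteSpace V]
  [NormedAddCommGroup X] [InnerProductSpace ℂ X] [CompleteSpace X]
  [NormedAddCommGroup U] [InnerProductSpace ℂ U] [CompleteSpace U]
  [NormedAddCommGroup W] [InnerProductSpace ℂ W] [CompleteSpace W]
  {j : V →L[ℂ] X} {B : U →L[ℂ] AntiDual V} {C : U →ₗ.[ℂ] U} {D : W →L[ℂ] AntiDual C.graph}

omit [CompleteSpace V] [CompleteSpace X] [CompleteSpace U] in
theorem systemOp_dissipative [CompleteSpace U] (hj : Function.Injective j) (hjd : DenseRange j)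
    {Chat : U →ₗ.[ℂ] U} (hChat : IsMDissipative Chat) :
    ∀ p ∈ (systemOp j B Chat).graph, (inner ℂ p.1 p.2).re ≤ 0 := by
  intro p hp
  refine systemGraph_dissipative (fun q hq => ?_) ((mem_systemOp_graph hj hjd).1 hp)
  obtain ⟨u, h1, h2⟩ := (LinearPMap.mem_graph_iff _).1 hq
  rw [← h1, ← h2]
  exact hChat.1 u

/-- An observed quantity is controlled by the dissipation of the damped system. -/
theorem observedBelow_le_tsum (hj : Function.Injective j) (hjd : DenseRange j)
    (hC : IsSkewAdjointOp C) {Chat : U →ₗ.[ℂ] U} (hChat : IsMDissipative Chat)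
    (hCD : IsSkewPlusDamping Chat C D)
    {β M : ℝ} (hβ : 0 < β) (hM : 0 ≤ M) (hTB : TransferBound j B C D β M) {T : ℝ} (hT : 0 < T)
    {z₀ : EnergySpace V X U} {z : ℝ → EnergySpace V X U}
    (hz : IsClassicalSolution (systemOp j B Chat) z₀ z) {m : ℝ}
    (hm : ObservedBelow j B C D T z₀ m) :
    m ≤ Real.exp (2 * β * T) * (1 + M) ^ 2 * ∑' k : ℕ, Real.exp (-(2 * β * T)) ^ k *
      ((‖z (k * T)‖ ^ 2 - ‖z ((k + 1) * T)‖ ^ 2) / 2) := by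
  obtain ⟨L, hL⟩ := exists_dampingOutput hC hCD
  have hcld : IsClosed ((systemOp j B Chat).graph :
      Set (EnergySpace V X U × EnergySpace V X U)) := by
    rw [systemOp_graph j hj hjd]
    exact isClosed_systemGraph hChat.isClosed_graph
  have hdiss := systemOp_dissipative (B := B) hj hjd hChat
  obtain ⟨p, hp, hpz, hpd, hpI⟩ := hz.exists_graph_primitive hcld
  set K := max ‖z₀‖ ‖(p 0).1.2‖ with hK
  have hzK : ∀ t, 0 ≤ t → ‖z t‖ ≤ K := fun t ht => (hz.norm_le hdiss ht).trans (le_max_left _ _)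
  have hpK : ∀ t, 0 ≤ t → ‖p t‖ ≤ K := by
    intro t ht
    rw [Submodule.coe_norm]
    refine max_le ?_ ((hz.norm_deriv_le hdiss hpd ht).trans (le_max_right _ _))
    change ‖(p t).1.1‖ ≤ K
    rw [hpz t ht]
    exact hzK t ht
  obtain ⟨z₁, y, hz₁, hy, hle⟩ := exists_conservative_output hj hjd hC hChat hL hβ hM hTB hz hp hpK
    hpI hzK hT.le
  refine (hm z₁ y hz₁ hy).trans (hle.trans ?_)
  refine mul_le_mul_of_nonneg_left ?_ (by positivity)
  set Ld : (systemOp j B Chat).graph →L[ℂ] W := L ∘L systemThirdGraph hj hjd B Chat with hLd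
  have hgc : Continuous fun s => ‖Ld (p s)‖ ^ 2 := (Ld.continuous.comp hp).norm.pow 2
  refine (integral_exp_mul_le_tsum hgc (fun _ => by positivity) (K := (‖Ld‖ * K) ^ 2)
    (fun t ht => ?_) (by positivity) hT).trans_eq ?_
  · gcongr
    exact (Ld.le_opNorm _).trans (mul_le_mul_of_nonneg_left (hpK t ht) (norm_nonneg _))
  refine tsum_congr fun k => ?_
  congr 1
  have hab : (k * T : ℝ) ≤ (k + 1) * T := by gcongr; linarith
  have hk0 : (0 : ℝ) ≤ k * T := by positivity
  have hen : ∀ t, 0 ≤ t → (inner ℂ (z t) (p t).1.2).re = -‖Ld (p t)‖ ^ 2 := by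
    intro t ht
    rw [← hpz t ht, re_inner_systemGraph ((mem_systemOp_graph hj hjd).1 (p t).2)]
    obtain ⟨h1, h2⟩ := hL (systemThirdGraph hj hjd B Chat (p t))
    exact h1.re_inner_eq hC h2
  let _ : InnerProductSpace ℝ (EnergySpace V X U) := InnerProductSpace.rclikeToReal ℂ _
  -- The squared output integrates over one period to the drop of `‖z‖² / 2`.
  have hftc := intervalIntegral.integral_eq_sub_of_hasDeriv_right (a := (k * T : ℝ))
    (b := (k + 1) * T) (f := fun t => -(‖z t‖ ^ 2 / 2)) (f' := fun s => ‖Ld (p s)‖ ^ 2)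
    ?_ (fun s hs => ?_) (hgc.intervalIntegrable _ _)
  · rw [hftc]
    ring
  · rw [uIcc_of_le hab]
    exact (((hz.continuousOn.norm.pow 2).div_const 2).neg).mono fun s hs => hk0.trans hs.1
  · rw [min_eq_left hab] at hs
    have hs0 : 0 < s := hk0.trans_lt hs.1
    have h1 := ((hpd s hs0.le).hasDerivAt (Ici_mem_nhds hs0)).norm_sq
    have h2 : inner ℝ (z s) (p s).1.2 = (inner ℂ (z s) (p s).1.2).re := rfl
    rw [h2, hen s hs0.le] at h1
    refine ((h1.div_const 2).neg.congr_deriv ?_).hasDerivWithinAt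
    ring

end Observation

/-! ### Discrete decay inequalities -/

section Sequences

theorem Real.one_sub_rpow_le_inv {x r : ℝ} (hx0 : 0 ≤ x) (hx1 : x ≤ 1) (hr : 0 < r) :
    (1 - x) ^ r ≤ (1 + r * x)⁻¹ := by
  have h1 : (1 - x) ^ r ≤ Real.exp (-(r * x)) := by
    calc (1 - x) ^ r ≤ (Real.exp (-x)) ^ r :=
          Real.rpow_le_rpow (by linarith) (Real.one_sub_le_exp_neg x) hr.le
      _ = Real.exp (-(r * x)) := by rw [← Real.exp_mul]; ring_nf
  refine h1.trans ?_
  rw [Real.exp_neg]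
  have : 0 ≤ r * x := by positivity
  gcongr
  linarith [Real.add_one_le_exp (r * x)]

/-- Discrete decay: if `s n - s (n + 1) ≥ δ s n F (s n)`, then `F (s n) = O (1 / n)`. -/
theorem mul_le_one_of_decay {s : ℕ → ℝ} {F : ℝ → ℝ} {r δ : ℝ} (hr : 0 < r) (hδ : 0 < δ)
    (hs0 : ∀ n, 0 ≤ s n) (hs1 : ∀ n, s n ≤ 1) (hF0 : ∀ x ∈ Icc (0 : ℝ) 1, 0 ≤ F x)
    (hF : ∀ μ ∈ Icc (0 : ℝ) 1, ∀ x ∈ Icc (0 : ℝ) 1, F (μ * x) ≤ μ ^ r * F x)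
    (hdec : ∀ n, δ * (s n * F (s n)) ≤ s n - s (n + 1)) (n : ℕ) :
    r * δ * (n * F (s n)) ≤ 1 := by
  have hFz : F 0 = 0 := by
    have h1 := hF 0 ⟨le_rfl, zero_le_one⟩ 0 ⟨le_rfl, zero_le_one⟩
    rw [zero_mul, Real.zero_rpow hr.ne', zero_mul] at h1
    exact le_antisymm h1 (hF0 0 ⟨le_rfl, zero_le_one⟩)
  induction n with
  | zero => simp
  | succ n ih =>
    have hf := hF0 _ ⟨hs0 n, hs1 n⟩
    have hd := hdec n
    rcases (hs0 n).eq_or_lt with h0 | h0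
    · have h1 : s (n + 1) = 0 := by
        rw [← h0] at hd
        linarith [hs0 (n + 1)]
      rw [h1, hFz, mul_zero, mul_zero]
      exact zero_le_one
    set f := F (s n) with hfdef
    have hx1 : δ * f ≤ 1 := by
      by_contra! h1
      nlinarith [hs0 (n + 1)]
    have hμ : s (n + 1) / s n ≤ 1 - δ * f := by
      rw [div_le_iff₀ h0]
      linarith
    have hμ0 : 0 ≤ s (n + 1) / s n := div_nonneg (hs0 _) (hs0 _)
    have hδf : 0 ≤ δ * f := by positivity
    have h1 := hF _ ⟨hμ0, hμ.trans (by linarith)⟩ _ ⟨hs0 n, hs1 n⟩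
    rw [div_mul_cancel₀ _ h0.ne'] at h1
    -- For positive values this says that `1 / F(s n)` increases by at least `r δ` at each step.
    have h2 : F (s (n + 1)) ≤ (1 + r * (δ * f))⁻¹ * f := by
      refine h1.trans (mul_le_mul_of_nonneg_right ?_ hf)
      exact (Real.rpow_le_rpow hμ0 hμ hr.le).trans (Real.one_sub_rpow_le_inv hδf hx1 hr)
    have h3 : 0 < 1 + r * (δ * f) := by positivity
    rw [inv_mul_eq_div, le_div_iff₀ h3] at h2
    have hF' := hF0 _ ⟨hs0 (n + 1), hs1 (n + 1)⟩
    push_cast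
    have h4 : r * δ * ((n + 1) * F (s (n + 1))) * (1 + r * (δ * f)) ≤ 1 * (1 + r * (δ * f)) := by
      have h5 : (r * δ * (n + 1)) * (F (s (n + 1)) * (1 + r * (δ * f))) ≤ (r * δ * (n + 1)) * f :=
        mul_le_mul_of_nonneg_left h2 (by positivity)
      nlinarith
    exact le_of_mul_le_mul_right h4 h3

/-- Decay of a nonincreasing sequence dissipating on average. -/
theorem mul_le_of_average_decay {e : ℕ → ℝ} {F : ℝ → ℝ} {r q K : ℝ} (hr : 0 < r) (hq0 : 0 ≤ q)
    (hq1 : q < 1) (hK : 0 < K) (he : Antitone e) (he0 : ∀ n, 0 ≤ e n) (he1 : ∀ n, e n ≤ 1)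
    (hF0 : ∀ x ∈ Icc (0 : ℝ) 1, 0 ≤ F x) (hFm : MonotoneOn F (Icc 0 1))
    (hF : ∀ μ ∈ Icc (0 : ℝ) 1, ∀ x ∈ Icc (0 : ℝ) 1, F (μ * x) ≤ μ ^ r * F x)
    (hdec : ∀ n, e n * F (e n) ≤ K * ∑' k : ℕ, q ^ k * (e (n + k) - e (n + k + 1))) (n : ℕ) :
    n * F ((1 - q) * e n) ≤ K / (r * (1 - q)) := by
  have hq : 0 < 1 - q := by linarith
  have hgeo := summable_geometric_of_lt_one hq0 hq1
  have hsum : ∀ n, Summable fun k => q ^ k * e (n + k) := fun n =>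
    Summable.of_nonneg_of_le (fun k => mul_nonneg (by positivity) (he0 _))
      (fun k => mul_le_of_le_one_right (by positivity) (he1 _)) hgeo
  -- The geometric average turns the nonlocal dissipation into a single difference: `s n - s (n+1)`
  -- is `1 - q` times the sum on the right of `hdec`. As `e` is nonincreasing, `(1 - q) e n ≤ s n ≤
  -- e n`, so `s n` can replace `e n` on the left.
  set s : ℕ → ℝ := fun n => (1 - q) * ∑' k, q ^ k * e (n + k) with hs
  have hs0 : ∀ n, 0 ≤ s n := fun n =>
    mul_nonneg hq.le (tsum_nonneg fun k => mul_nonneg (by positivity) (he0 _))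
  have hse : ∀ n, s n ≤ e n := by
    intro n
    have h1 : ∑' k, q ^ k * e (n + k) ≤ ∑' k, q ^ k * e n :=
      (hsum n).tsum_le_tsum (fun k => by gcongr; exact he (Nat.le_add_right n k))
        (hgeo.mul_right _)
    rw [tsum_mul_right, tsum_geometric_of_lt_one hq0 hq1] at h1
    calc s n ≤ (1 - q) * ((1 - q)⁻¹ * e n) := by
          simp only [hs]
          gcongr
      _ = e n := by rw [mul_inv_cancel_left₀ hq.ne']
  have hes : ∀ n, (1 - q) * e n ≤ s n := by
    intro n
    simp only [hs]
    gcongr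
    have := (hsum n).le_tsum 0 fun k _ => mul_nonneg (by positivity) (he0 _)
    simpa using this
  have hdec' : ∀ n, (1 - q) / K * (s n * F (s n)) ≤ s n - s (n + 1) := by
    intro n
    have h1 : s n - s (n + 1) = (1 - q) * ∑' k, q ^ k * (e (n + k) - e (n + k + 1)) := by
      have h2 : ∀ k, n + 1 + k = n + k + 1 := fun k => by ring
      have h3 := hsum (n + 1)
      simp only [h2] at h3
      simp only [hs, h2, mul_sub]
      rw [(hsum n).tsum_sub h3]
      ring
    have h4 : s n * F (s n) ≤ e n * F (e n) :=
      mul_le_mul (hse n) (hFm ⟨hs0 n, (hse n).trans (he1 n)⟩ ⟨he0 n, he1 n⟩ (hse n))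
        (hF0 _ ⟨hs0 n, (hse n).trans (he1 n)⟩) (he0 n)
    rw [h1, div_mul_eq_mul_div, div_le_iff₀ hK]
    have := mul_le_mul_of_nonneg_left (h4.trans (hdec n)) hq.le
    linarith
  have h1 := mul_le_one_of_decay hr (div_pos hq hK) hs0 (fun n => (hse n).trans (he1 n)) hF0 hF
    hdec' n
  have h2 : F ((1 - q) * e n) ≤ F (s n) :=
    hFm ⟨mul_nonneg hq.le (he0 n), (hes n).trans ((hse n).trans (he1 n))⟩
      ⟨hs0 n, (hse n).trans (he1 n)⟩ (hes n)
  rw [le_div_iff₀ (by positivity)]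
  have h3 : n * F ((1 - q) * e n) * (r * (1 - q)) ≤ n * F (s n) * (r * (1 - q)) := by gcongr
  refine h3.trans ?_
  have h4 : n * F (s n) * (r * (1 - q)) = r * ((1 - q) / K) * (n * F (s n)) * K := by
    field_simp
  rw [h4]
  nlinarith

end Sequences

/-! ### The interpolation inequality -/

section Interpolation

variable {E₀ E E₁ : Type*} [NormedAddCommGroup E₀] [NormedSpace ℂ E₀]
  [NormedAddCommGroup E] [NormedSpace ℂ E]
  [NormedAddCommGroup E₁] [NormedSpace ℂ E₁]

/-- The classical choice is `f(ζ) = e^{(ζ-θ)κ} x`, with `κ` tuned so that the bounds on the two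
edges of the strip coincide. -/
theorem interpBound_rpow (i : E₀ →L[ℂ] E₁) {θ : ℝ} (hθ0 : 0 < θ) (hθ1 : θ < 1) {x : E₀}
    (hx : i x ≠ 0) : InterpBound i θ (i x) (‖x‖ ^ (1 - θ) * ‖i x‖ ^ θ) := by
  have hx0 : x ≠ 0 := by
    rintro rfl
    exact hx (map_zero i)
  have ha : 0 < ‖x‖ := norm_pos_iff.2 hx0
  have hb : 0 < ‖i x‖ := norm_pos_iff.2 hx
  set κ := Real.log (‖x‖ / ‖i x‖) with hκ
  have hexp : ∀ ζ : ℂ, ‖Complex.exp ((ζ - θ) * κ)‖ = Real.exp ((ζ.re - θ) * κ) := by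
    intro ζ
    rw [Complex.norm_exp]
    congr 1
    simp
  have hlog : κ = Real.log ‖x‖ - Real.log ‖i x‖ := Real.log_div ha.ne' hb.ne'
  have hM : ‖x‖ ^ (1 - θ) * ‖i x‖ ^ θ
      = Real.exp (Real.log ‖x‖ * (1 - θ) + Real.log ‖i x‖ * θ) := by
    rw [Real.exp_add, Real.rpow_def_of_pos ha, Real.rpow_def_of_pos hb]
  refine ⟨fun ζ => Complex.exp ((ζ - θ) * κ) • i x, fun t =>
    Complex.exp ((t * Complex.I - θ) * κ) • x, ?_, ⟨Real.exp |κ| * ‖i x‖, fun ζ h0 h1 => ?_⟩,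
    ?_, ?_, fun t => ?_, fun t => ?_, fun t => ?_, ?_⟩
  · exact Continuous.continuousOn (by fun_prop)
  · rw [norm_smul, hexp]
    refine mul_le_mul_of_nonneg_right (Real.exp_le_exp.2 ?_) hb.le
    refine (le_abs_self _).trans ?_
    rw [abs_mul]
    exact mul_le_of_le_one_left (abs_nonneg _) (abs_le.2 ⟨by linarith, by linarith⟩)
  · exact Differentiable.differentiableOn (by fun_prop)
  · fun_prop
  · simp only [map_smul]
  · rw [norm_smul, hexp, hM]
    nth_rewrite 1 [← Real.exp_log ha]
    rw [← Real.exp_add, Real.exp_le_exp, hlog]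
    simp only [Complex.mul_re, Complex.ofReal_re, Complex.ofReal_im, Complex.I_re, Complex.I_im]
    linarith
  · rw [norm_smul, hexp, hM]
    nth_rewrite 1 [← Real.exp_log hb]
    rw [← Real.exp_add, Real.exp_le_exp, hlog]
    simp only [Complex.mul_re, Complex.ofReal_re, Complex.ofReal_im, Complex.I_re, Complex.I_im,
      Complex.add_re, Complex.one_re]
    linarith
  · simp

theorem InterpBound.nonneg {i : E₀ →L[ℂ] E₁} {θ : ℝ} {x : E₁} {M : ℝ} (h : InterpBound i θ x M) :
    0 ≤ M := by
  obtain ⟨f, f₀, -, -, -, -, -, h0, -⟩ := h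
  exact (norm_nonneg _).trans (h0 0)

/-- The interpolation inequality. -/
theorem IsInterpolationSpace.exists_norm_le {ι₁ : E₀ →L[ℂ] E} {ι₂ : E →L[ℂ] E₁}
    (hι₂ : Function.Injective ι₂) {θ : ℝ} (hθ0 : 0 < θ) (hθ1 : θ < 1)
    (h : IsInterpolationSpace ι₁ ι₂ θ) :
    ∃ K : ℝ, 0 < K ∧ ∀ x : E₀, ‖ι₁ x‖ ≤ K * (‖x‖ ^ (1 - θ) * ‖ι₂ (ι₁ x)‖ ^ θ) := by
  obtain ⟨-, c, K, hc, hcK⟩ := h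
  refine ⟨c⁻¹, inv_pos.2 hc, fun x => ?_⟩
  rw [← div_eq_inv_mul, le_div_iff₀' hc]
  refine (hcK (ι₁ x)).1.trans ?_
  by_cases hx : ι₂ (ι₁ x) = 0
  · have h0 : ι₁ x = 0 := hι₂ (by rw [hx, map_zero])
    have h1 := (hcK 0).2
    rw [norm_zero, mul_zero] at h1
    rw [h0]
    exact h1.trans (by positivity)
  · exact csInf_le ⟨0, fun M hM => hM.nonneg⟩ (interpBound_rpow (ι₂ ∘L ι₁) hθ0 hθ1 hx)

end Interpolation

/-! ### Continuous-time energy decay -/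

section EnergyDecay

/-- Neither `‖z‖` nor `‖A z‖` increases. One constant `N`, read off at time 0, can thus normalise
the observability estimate restarted at every `nT`. -/
theorem IsClassicalSolution.exists_graphNormSq_le {E : Type*} [NormedAddCommGroup E]
    [InnerProductSpace ℂ E] {A : E →ₗ.[ℂ] E} (hdiss : ∀ p ∈ A.graph, (inner ℂ p.1 p.2).re ≤ 0)
    {z₀ : A.domain} {z : ℝ → E} (h : IsClassicalSolution A z₀ z) {t : ℝ} (ht : 0 ≤ t) :
    ∃ hz : z t ∈ A.domain, graphNormSq A ⟨z t, hz⟩ ≤ graphNormSq A z₀ := by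
  have hn := h.norm_le hdiss ht
  obtain ⟨z', -, hz'⟩ := h.2
  have hd := h.norm_deriv_le hdiss (fun t ht => (hz' t ht).2) ht
  have hval : ∀ {x : A.domain} {y : E}, ((x : E), y) ∈ A.graph → A x = y := by
    intro x y hxy
    exact A.mem_graph_snd_inj (A.mem_graph x) hxy rfl
  have hzt : z t ∈ A.domain := LinearPMap.mem_domain_of_mem_graph (hz' t ht).1
  refine ⟨hzt, ?_⟩
  have h1 : A ⟨z t, hzt⟩ = z' t := hval (hz' t ht).1
  have h2 : A z₀ = z' 0 := by
    have h3 := (hz' 0 le_rfl).1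
    rw [h.1] at h3
    exact hval h3
  rw [graphNormSq, graphNormSq, h1, h2]
  gcongr

/-- The lower bound of the weak norm by the energy, relative to the graph norm. -/
theorem IsInterpolationSpace.exists_lower_bound {E H₁ H₂ : Type*}
    [NormedAddCommGroup E] [NormedSpace ℂ E] [NormedAddCommGroup H₁] [NormedSpace ℂ H₁]
    [NormedAddCommGroup H₂] [NormedSpace ℂ H₂] {A : E →ₗ.[ℂ] E}
    {ι₁ : H₁ →L[ℂ] E} {ι₂ : E →L[ℂ] H₂} (hι₂ : Function.Injective ι₂)
    (hdom : (A.domain : Set E) ⊆ range ι₁)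
    (hnorm : ∃ c : ℝ, 0 < c ∧ ∀ (x : H₁) (hx : ι₁ x ∈ A.domain),
      c * ‖x‖ ^ 2 ≤ graphNormSq A ⟨ι₁ x, hx⟩)
    {θ : ℝ} (hθ0 : 0 < θ) (hθ1 : θ < 1) (hinterp : IsInterpolationSpace ι₁ ι₂ θ) :
    ∃ κ : ℝ, 0 < κ ∧ κ < 1 ∧ ∀ (z : A.domain) (N : ℝ), 0 < N → graphNormSq A z ≤ N →
      κ * (‖(z : E)‖ ^ 2 / N) ^ ((1 - θ) / θ) * ‖(z : E)‖ ^ 2 ≤ ‖ι₂ z‖ ^ 2 := by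
  obtain ⟨K, hK, hKx⟩ := hinterp.exists_norm_le hι₂ hθ0 hθ1
  obtain ⟨c, hc, hcx⟩ := hnorm
  set r := (1 - θ) / θ with hr
  have hr0 : 0 < r := div_pos (by linarith) hθ0
  have hr1 : 1 / θ = r + 1 := by
    rw [hr]
    field_simp
    ring
  have hκ : 0 < c ^ r / (K ^ 2) ^ (1 / θ) := by positivity
  -- The second entry results from raising the interpolation inequality to the power `1/θ`. The cap
  -- `1/2` keeps `κ x^r` below 1 for `x ≤ 1`, inside the range where the monotonicity of `G(x) /
  -- x^p` is assumed.
  refine ⟨min (1 / 2) (c ^ r / (K ^ 2) ^ (1 / θ)), lt_min (by norm_num) hκ,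
    (min_le_left _ _).trans_lt (by norm_num), fun z N hN hz => ?_⟩
  obtain ⟨x, hx⟩ := hdom z.2
  have hxd : ι₁ x ∈ A.domain := hx ▸ z.2
  have hxz : (⟨ι₁ x, hxd⟩ : A.domain) = z := Subtype.ext hx
  have h1 := hcx x hxd
  rw [hxz] at h1
  have h2 : ‖x‖ ^ 2 ≤ N / c := by
    rw [le_div_iff₀' hc]
    exact h1.trans hz
  have h3 := hKx x
  rw [hx] at h3
  set a := ‖(z : E)‖ with ha
  set d := ‖ι₂ z‖ with hd
  have h4 : a ^ 2 ≤ K ^ 2 * ((N / c) ^ (1 - θ) * (d ^ 2) ^ θ) := by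
    calc a ^ 2 ≤ (K * (‖x‖ ^ (1 - θ) * d ^ θ)) ^ 2 := by gcongr
      _ = K ^ 2 * ((‖x‖ ^ 2) ^ (1 - θ) * (d ^ 2) ^ θ) := by
        rw [mul_pow, mul_pow, Real.rpow_pow_comm (norm_nonneg x),
          Real.rpow_pow_comm (norm_nonneg _)]
      _ ≤ _ := by
        gcongr
  have h5 : (a ^ 2) ^ (1 / θ) ≤ (K ^ 2) ^ (1 / θ) * ((N / c) ^ r * d ^ 2) := by
    refine (Real.rpow_le_rpow (by positivity) h4 (by positivity)).trans_eq ?_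
    rw [Real.mul_rpow (by positivity) (by positivity),
      Real.mul_rpow (by positivity) (by positivity), ← Real.rpow_mul (by positivity),
      ← Real.rpow_mul (by positivity), mul_one_div, mul_one_div_cancel hθ0.ne', Real.rpow_one]
  have h6 : (a ^ 2 / N) ^ r * a ^ 2 = (a ^ 2) ^ (1 / θ) / N ^ r := by
    rcases (norm_nonneg (z : E)).eq_or_lt with h0 | h0
    · rw [ha, ← h0]
      simp [hθ0.ne']
    · rw [hr1, Real.rpow_add_one (by positivity), Real.div_rpow (by positivity) hN.le]
      ring
  calc _ ≤ c ^ r / (K ^ 2) ^ (1 / θ) * ((a ^ 2 / N) ^ r * a ^ 2) := by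
        rw [mul_assoc]
        gcongr
        exact min_le_right _ _
    _ ≤ c ^ r / (K ^ 2) ^ (1 / θ) * ((K ^ 2) ^ (1 / θ) * ((N / c) ^ r * d ^ 2) / N ^ r) := by
        rw [h6]
        gcongr
    _ = d ^ 2 := by
        rw [Real.div_rpow hN.le hc.le]
        field_simp

theorem le_of_mul_rpow_le {κ σ e r X : ℝ} (hκ : 0 < κ) (hσ : 0 < σ) (he : 0 ≤ e) (hr : 0 < r)
    (h : κ * (σ * e) ^ r ≤ X) : e ≤ σ⁻¹ * κ⁻¹ ^ r⁻¹ * X ^ r⁻¹ := by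
  have hX : 0 ≤ X := le_trans (by positivity) h
  have h1 : (σ * e) ^ r ≤ κ⁻¹ * X := by
    rw [← div_eq_inv_mul, le_div_iff₀' hκ]
    exact h
  have h2 := Real.rpow_le_rpow (by positivity) h1 (inv_nonneg.2 hr.le)
  rw [Real.rpow_rpow_inv (by positivity) hr.ne', Real.mul_rpow (by positivity) hX] at h2
  rw [mul_assoc, ← div_eq_inv_mul, le_div_iff₀' hσ]
  exact h2

variable {V X U W : Type*}
  [NormedAddCommGroup V] [InnerProductSpace ℂ V] [CompleteSpace V]
  [NormedAddCommGroup X] [InnerProductSpace ℂ X] [CompleteSpace X]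
  [NormedAddCommGroup U] [InnerProductSpace ℂ U] [CompleteSpace U]
  [NormedAddCommGroup W] [InnerProductSpace ℂ W] [CompleteSpace W]
  {j : V →L[ℂ] X} {B : U →L[ℂ] AntiDual V} {C : U →ₗ.[ℂ] U} {D : W →L[ℂ] AntiDual C.graph}
  {Chat : U →ₗ.[ℂ] U}

/-- Common core of both statements. `F` is the observability profile as a function of the normalised
energy, and its subhomogeneity of degree `r` allows constants to be moved inside the argument. -/
theorem exists_energy_decay (hj : Function.Injective j) (hjd : DenseRange j)
    (hC : IsSkewAdjointOp C) (hChat : IsMDissipative Chat) (hCD : IsSkewPlusDamping Chat C D)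
    {β M : ℝ} (hβ : 0 < β) (hM : 0 ≤ M) (hTB : TransferBound j B C D β M)
    {T c r : ℝ} (hT : 0 < T) (hc : 0 < c) (hr : 0 < r) {F : ℝ → ℝ}
    (hF0 : ∀ x ∈ Icc (0 : ℝ) 1, 0 ≤ F x) (hFm : MonotoneOn F (Icc 0 1))
    (hF : ∀ μ ∈ Icc (0 : ℝ) 1, ∀ x ∈ Icc (0 : ℝ) 1, F (μ * x) ≤ μ ^ r * F x)
    (hobs : ∀ (N : ℝ) (z : (systemOp j B Chat).domain), 0 < N → (z : EnergySpace V X U) ≠ 0 →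
      graphNormSq (systemOp j B Chat) z ≤ N → ObservedBelow j B C D T z
        (c * (‖(z : EnergySpace V X U)‖ ^ 2 * F (‖(z : EnergySpace V X U)‖ ^ 2 / N)))) :
    ∃ σ : ℝ, 0 < σ ∧ ∀ (z₀ : (systemOp j B Chat).domain) (z : ℝ → EnergySpace V X U),
      IsClassicalSolution (systemOp j B Chat) z₀ z → 0 < graphNormSq (systemOp j B Chat) z₀ →
      ∀ t : ℝ, 0 ≤ t →
        F (σ * (‖z t‖ ^ 2 / graphNormSq (systemOp j B Chat) z₀)) ≤ 1 / (1 + t) := by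
  have hdiss := systemOp_dissipative (B := B) hj hjd hChat
  set q := Real.exp (-(2 * β * T)) with hq
  have hq0 : 0 ≤ q := (Real.exp_pos _).le
  have hq1 : q < 1 := Real.exp_lt_one_iff.2 (by nlinarith [mul_pos hβ hT])
  set K := Real.exp (2 * β * T) * (1 + M) ^ 2 / (2 * c) with hKdef
  have hK : 0 < K := by positivity
  have hρ : 0 < 1 - q := by linarith
  -- The second entry handles `t ≥ T` and the third `t < T`. The factor `A⁻¹ ^ r⁻¹` in `σ` then
  -- absorbs `A` by subhomogeneity, while `1 - q` is lost in passing from `s n` to `e n`.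
  set A := max 1 (max (K / (r * (1 - q)) * (1 + 2 * T)) (F 1 * (1 + T))) with hA
  have hA1 : 1 ≤ A := le_max_left _ _
  have hA2 : K / (r * (1 - q)) * (1 + 2 * T) ≤ A := (le_max_left _ _).trans (le_max_right _ _)
  have hA3 : F 1 * (1 + T) ≤ A := (le_max_right _ _).trans (le_max_right _ _)
  refine ⟨A⁻¹ ^ r⁻¹ * (1 - q), by positivity, fun z₀ z hz hN t ht => ?_⟩
  set N := graphNormSq (systemOp j B Chat) z₀ with hNdef
  have hle : ∀ s, 0 ≤ s → ‖z s‖ ^ 2 / N ≤ 1 := by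
    intro s hs
    rw [div_le_one hN, hNdef, graphNormSq]
    have h1 := hz.norm_le hdiss hs
    have h2 : ‖z s‖ ^ 2 ≤ ‖(z₀ : EnergySpace V X U)‖ ^ 2 := by gcongr
    have h3 := sq_nonneg ‖systemOp j B Chat z₀‖
    linarith
  have hmono : ∀ s s', 0 ≤ s → s ≤ s' → ‖z s'‖ ^ 2 / N ≤ ‖z s‖ ^ 2 / N := by
    intro s s' hs hss
    have h1 := (hz.shift hs).norm_le hdiss (sub_nonneg.2 hss)
    rw [add_sub_cancel] at h1
    gcongr
  set e : ℕ → ℝ := fun n => ‖z (n * T)‖ ^ 2 / N with he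
  have he0 : ∀ n, 0 ≤ e n := fun n => by positivity
  have hnT : ∀ n : ℕ, 0 ≤ n * T := fun n => by positivity
  have hdec : ∀ n, e n * F (e n) ≤ K * ∑' k : ℕ, q ^ k * (e (n + k) - e (n + k + 1)) := by
    intro n
    -- Observability is available only for nonzero data; if `z (n T) = 0`, every later energy
    -- vanishes too.
    by_cases h0 : z (n * T) = 0
    · have h1 : ∀ k, e (n + k) = 0 := by
        intro k
        refine le_antisymm ?_ (he0 _)
        have := hmono (n * T) ((n + k : ℕ) * T) (hnT n) (by push_cast; nlinarith [hnT k])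
        simpa [h0, he] using this
      have h2 : e n = 0 := h1 0
      simp [h2, h1, add_assoc]
    · obtain ⟨hd, hgr⟩ := hz.exists_graphNormSq_le hdiss (hnT n)
      have h1 := observedBelow_le_tsum hj hjd hC hChat hCD hβ hM hTB hT (hz.shift (hnT n))
        (hobs N ⟨_, hd⟩ hN h0 hgr)
      have h2 : ∀ k : ℕ, q ^ k * ((‖z (n * T + k * T)‖ ^ 2 - ‖z (n * T + (k + 1) * T)‖ ^ 2) / 2)
          = N / 2 * (q ^ k * (e (n + k) - e (n + k + 1))) := by
        intro k
        simp only [he]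
        push_cast
        rw [← add_mul, ← add_mul, ← add_assoc]
        field_simp
      simp only [← hq, h2, tsum_mul_left] at h1
      have h3 : ‖z (n * T)‖ ^ 2 = N * e n := by
        simp only [he]
        field_simp
      have h4 : c * N * (e n * F (e n))
          ≤ c * N * (K * ∑' k : ℕ, q ^ k * (e (n + k) - e (n + k + 1))) := by
        calc _ = c * (‖z (n * T)‖ ^ 2 * F (‖z (n * T)‖ ^ 2 / N)) := by
              rw [h3, mul_div_cancel_left₀ _ hN.ne']
              ring
          _ ≤ _ := h1
          _ = _ := by
              rw [hKdef]
              field_simp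
      exact le_of_mul_le_mul_left h4 (by positivity)
  have hx0 : 0 ≤ ‖z t‖ ^ 2 / N := by positivity
  have hxρ : (1 - q) * (‖z t‖ ^ 2 / N) ∈ Icc (0 : ℝ) 1 :=
    ⟨by positivity, mul_le_one₀ (by linarith) hx0 (hle t ht)⟩
  have hmain : F ((1 - q) * (‖z t‖ ^ 2 / N)) ≤ A / (1 + t) := by
    rw [le_div_iff₀ (by positivity)]
    have hFρ := hF0 _ hxρ
    rcases lt_or_ge t T with htT | htT
    · refine le_trans ?_ hA3
      have h1 := hFm hxρ ⟨zero_le_one, le_rfl⟩ hxρ.2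
      have h2 := hF0 1 ⟨zero_le_one, le_rfl⟩
      gcongr
    · set n := ⌊t / T⌋₊ with hn
      have hn1 : n * T ≤ t := by
        rw [← le_div_iff₀ hT]
        exact Nat.floor_le (by positivity)
      have hn2 : t < (n + 1) * T := by
        rw [← div_lt_iff₀ hT]
        exact Nat.lt_floor_add_one _
      have hn3 : (1 : ℝ) ≤ n := by
        exact_mod_cast (Nat.one_le_floor_iff _).2 ((one_le_div hT).2 htT)
      have h1 := mul_le_of_average_decay hr hq0 hq1 hK
        (fun m n hmn => hmono _ _ (hnT m) (by gcongr)) he0 (fun n => hle _ (hnT n)) hF0 hFm hF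
        hdec n
      have h2 : F ((1 - q) * (‖z t‖ ^ 2 / N)) ≤ F ((1 - q) * e n) := by
        have h3 := mul_le_mul_of_nonneg_left (hmono _ _ (hnT n) hn1) hρ.le
        exact hFm hxρ ⟨mul_nonneg hρ.le (he0 n),
          mul_le_one₀ (by linarith) (he0 n) (hle _ (hnT n))⟩ h3
      -- From `t < (n + 1) T` and `n ≥ 1`, so that `n + 1 ≤ 2 n`.
      have h3 : 1 + t ≤ n * (1 + 2 * T) := by nlinarith
      calc F ((1 - q) * (‖z t‖ ^ 2 / N)) * (1 + t)
          ≤ F ((1 - q) * (‖z t‖ ^ 2 / N)) * (n * (1 + 2 * T)) := by gcongr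
        _ ≤ F ((1 - q) * e n) * (n * (1 + 2 * T)) := by gcongr
        _ = n * F ((1 - q) * e n) * (1 + 2 * T) := by ring
        _ ≤ K / (r * (1 - q)) * (1 + 2 * T) := by gcongr
        _ ≤ A := hA2
  have hA0 : 0 < A := by linarith
  rw [mul_assoc]
  refine (hF _ ⟨by positivity, Real.rpow_le_one (by positivity) (inv_le_one_of_one_le₀ hA1)
    (by positivity)⟩ _ hxρ).trans ?_
  rw [Real.rpow_inv_rpow (by positivity) hr.ne']
  calc A⁻¹ * F ((1 - q) * (‖z t‖ ^ 2 / N)) ≤ A⁻¹ * (A / (1 + t)) := by gcongr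
    _ = 1 / (1 + t) := by field_simp

/-- Monotonicity of `G(x) / x^p` is subhomogeneity of degree `p`. The endpoint 0, outside the
assumed interval, is covered by `G 0 = 0`. -/
theorem OrderIso.apply_toNNReal_mul_le {G : ℝ≥0 ≃o ℝ≥0} {p : ℝ} (hp : 0 < p)
    (hG : MonotoneOn (fun x : ℝ≥0 => (G x : ℝ) / (x : ℝ) ^ p) (Ioo 0 1)) {μ x : ℝ}
    (hμ : μ ∈ Icc (0 : ℝ) 1) (hx : x ∈ Ico (0 : ℝ) 1) :
    (G (μ * x).toNNReal : ℝ) ≤ μ ^ p * G x.toNNReal := by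
  have hG0 : G 0 = 0 := G.map_bot
  rcases hμ.1.eq_or_lt with h0 | h0
  · simp [← h0, Real.zero_rpow hp.ne', hG0]
  rcases hx.1.eq_or_lt with h1 | h1
  · simp [← h1, hG0]
  have hle : μ * x ≤ x := mul_le_of_le_one_left hx.1 hμ.2
  have hpos : 0 < μ * x := mul_pos h0 h1
  have h2 := hG (a := (μ * x).toNNReal) (b := x.toNNReal)
    ⟨Real.toNNReal_pos.2 hpos, Real.toNNReal_lt_one.2 (hle.trans_lt hx.2)⟩
    ⟨Real.toNNReal_pos.2 h1, Real.toNNReal_lt_one.2 hx.2⟩ (Real.toNNReal_le_toNNReal hle)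
  simp only [Real.coe_toNNReal _ hpos.le, Real.coe_toNNReal _ hx.1] at h2
  rw [Real.mul_rpow h0.le hx.1, div_le_div_iff₀ (by positivity) (by positivity)] at h2
  have h3 : 0 < x ^ p := by positivity
  refine le_of_mul_le_mul_right ?_ h3
  linarith

end EnergyDecay

/-! ### The two decay rates -/

theorem mainTheorem2
    {V X U W H₁ H₂ : Type*}
    [NormedAddCommGroup V] [InnerProductSpace ℂ V] [CompleteSpace V]
    [NormedAddCommGroup X] [InnerProductSpace ℂ X] [CompleteSpace X]
    [NormedAddCommGroup U] [InnerProductSpace ℂ U] [CompleteSpace U]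
    [NormedAddCommGroup W] [InnerProductSpace ℂ W] [CompleteSpace W]
    [NormedAddCommGroup H₁] [NormedSpace ℂ H₁] [CompleteSpace H₁]
    [NormedAddCommGroup H₂] [NormedSpace ℂ H₂] [CompleteSpace H₂]
    -- the embedding `V ⊂ X` and the coefficients of the system
    (j : V →L[ℂ] X) (hj : Function.Injective j) (hjd : DenseRange j)
    (B : U →L[ℂ] AntiDual V)
    (C : U →ₗ.[ℂ] U) (hC : IsSkewAdjointOp C)
    (D : W →L[ℂ] AntiDual C.graph)
    (Chat : U →ₗ.[ℂ] U) (hChat : IsMDissipative Chat) (hCD : IsSkewPlusDamping Chat C D)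
    -- `D(𝒜_d) ⊂ H₁ ⊂ ℋ ⊂ H₂`, equivalence of norms, and interpolation
    (ι₁ : H₁ →L[ℂ] EnergySpace V X U) (hι₁ : Function.Injective ι₁)
    (ι₂ : EnergySpace V X U →L[ℂ] H₂) (hι₂ : Function.Injective ι₂)
    (hdom : ((systemOp j B Chat).domain : Set (EnergySpace V X U)) ⊆ range ι₁)
    (hnorm : ∃ c K : ℝ, 0 < c ∧ ∀ (x : H₁) (hx : ι₁ x ∈ (systemOp j B Chat).domain),
      c * ‖x‖ ^ 2 ≤ graphNormSq (systemOp j B Chat) ⟨ι₁ x, hx⟩ ∧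
        graphNormSq (systemOp j B Chat) ⟨ι₁ x, hx⟩ ≤ K * ‖x‖ ^ 2)
    (θ : ℝ) (hθ0 : 0 < θ) (hθ1 : θ < 1) (hinterp : IsInterpolationSpace ι₁ ι₂ θ)
    -- transfer function estimate, or bounded damping
    (hH : TransferEstimate j B C D ∨ IsBoundedDamping C D)
    (T : ℝ) (hT : 0 < T) (c : ℝ) (hc : 0 < c) :
    -- `G` is a continuous increasing bijection of `[0, ∞)`
    (∀ G : ℝ≥0 ≃o ℝ≥0,
      MonotoneOn (fun x : ℝ≥0 => (G x : ℝ) / (x : ℝ) ^ (θ / (1 - θ))) (Ioo 0 1) →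
      (∀ z₀ : (systemOp j B Chat).domain, (z₀ : EnergySpace V X U) ≠ 0 →
        ObservedBelow j B C D T z₀
          (c * ‖(z₀ : EnergySpace V X U)‖ ^ 2 *
            G (‖ι₂ z₀‖₊ ^ 2 / ‖(z₀ : EnergySpace V X U)‖₊ ^ 2))) →
      ∃ K : ℝ, 0 < K ∧ ∀ (z₀ : (systemOp j B Chat).domain) (z : ℝ → EnergySpace V X U),
        IsClassicalSolution (systemOp j B Chat) z₀ z → ∀ t : ℝ≥0,
          1 / 2 * ‖z t‖ ^ 2 ≤
            K * (G.symm (1 / (1 + t)) : ℝ) ^ (θ / (1 - θ)) *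
              graphNormSq (systemOp j B Chat) z₀) ∧
    ((∀ z₀ : (systemOp j B Chat).domain, (z₀ : EnergySpace V X U) ≠ 0 →
        ObservedBelow j B C D T z₀ (c * ‖ι₂ z₀‖ ^ 2)) →
      ∃ K : ℝ, 0 < K ∧ ∀ (z₀ : (systemOp j B Chat).domain) (z : ℝ → EnergySpace V X U),
        IsClassicalSolution (systemOp j B Chat) z₀ z → ∀ t : ℝ≥0,
          1 / 2 * ‖z t‖ ^ 2 ≤
            K * (1 / (1 + (t : ℝ)) ^ (θ / (1 - θ))) * graphNormSq (systemOp j B Chat) z₀) := by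
  obtain ⟨β, M, hβ, hM, hTB⟩ : ∃ β M, 0 < β ∧ 0 ≤ M ∧ TransferBound j B C D β M :=
    hH.elim (fun h => h.transferBound hC) (fun h => h.transferBound hC)
  obtain ⟨κ, hκ, hκ1, hlow⟩ := hinterp.exists_lower_bound hι₂ hdom
    (by
      obtain ⟨c, K, hc, h⟩ := hnorm
      exact ⟨c, hc, fun x hx => (h x hx).1⟩) hθ0 hθ1
  set r := (1 - θ) / θ with hrdef
  have hr : 0 < r := div_pos (by linarith) hθ0
  have hp : θ / (1 - θ) = r⁻¹ := (inv_div _ _).symm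
  rw [hp]
  have hdiss := systemOp_dissipative (B := B) hj hjd hChat
  -- Common conclusion: a bound `Ξ t` on `κ (σ e)^r` is inverted to one on `e` with exponent `r⁻¹ =
  -- θ/(1-θ)`. A datum of zero graph norm is separated because `e` divides by that norm.
  have hfin : ∀ (Ξ : ℝ≥0 → ℝ) (F : ℝ → ℝ) (σ : ℝ), (∀ t, 0 ≤ Ξ t) → 0 < σ →
      (∀ (e : ℝ) (t : ℝ≥0), 0 ≤ e → F (σ * e) ≤ 1 / (1 + (t : ℝ)) →
        κ * (σ * e) ^ r ≤ Ξ t) →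
      (∀ (z₀ : (systemOp j B Chat).domain) (z : ℝ → EnergySpace V X U),
        IsClassicalSolution (systemOp j B Chat) z₀ z → 0 < graphNormSq (systemOp j B Chat) z₀ →
        ∀ t : ℝ, 0 ≤ t →
          F (σ * (‖z t‖ ^ 2 / graphNormSq (systemOp j B Chat) z₀)) ≤ 1 / (1 + t)) →
      ∃ K : ℝ, 0 < K ∧ ∀ (z₀ : (systemOp j B Chat).domain) (z : ℝ → EnergySpace V X U),
        IsClassicalSolution (systemOp j B Chat) z₀ z → ∀ t : ℝ≥0,
          1 / 2 * ‖z t‖ ^ 2 ≤ K * Ξ t ^ r⁻¹ * graphNormSq (systemOp j B Chat) z₀ := by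
    intro Ξ F σ hΞ hσ hF hdecay
    refine ⟨1 / 2 * (σ⁻¹ * κ⁻¹ ^ r⁻¹), by positivity, fun z₀ z hz t => ?_⟩
    have hN0 : 0 ≤ graphNormSq (systemOp j B Chat) z₀ := by
      rw [graphNormSq]
      positivity
    rcases hN0.eq_or_lt with hN | hN
    · have h1 : ‖(z₀ : EnergySpace V X U)‖ ^ 2 = 0 := by
        rw [graphNormSq] at hN
        linarith [sq_nonneg ‖(z₀ : EnergySpace V X U)‖, sq_nonneg ‖systemOp j B Chat z₀‖]
      have h2 := hz.norm_le hdiss t.2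
      rw [pow_eq_zero_iff two_ne_zero] at h1
      have h3 : ‖z t‖ = 0 := le_antisymm (h2.trans h1.le) (norm_nonneg _)
      rw [h3, ← hN]
      simp
    · have he : 0 ≤ ‖z t‖ ^ 2 / graphNormSq (systemOp j B Chat) z₀ := by positivity
      have h1 := le_of_mul_rpow_le hκ hσ he hr (hF _ t he (hdecay z₀ z hz hN t t.2))
      rw [div_le_iff₀ hN] at h1
      linarith
  constructor
  · intro G hG hobs
    have hscale : ∀ x ∈ Icc (0 : ℝ) 1, κ * x ^ r ∈ Ico (0 : ℝ) 1 := fun x hx =>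
      ⟨mul_nonneg hκ.le (Real.rpow_nonneg hx.1 _),
        (mul_le_of_le_one_right hκ.le (Real.rpow_le_one hx.1 hx.2 hr.le)).trans_lt hκ1⟩
    -- `G` is subhomogeneous of degree `1/r`, so composed with `κ x^r` it has degree 1: hence
    -- `one_pos` for the exponent.
    obtain ⟨σ, hσ, hdecay⟩ := exists_energy_decay (F := fun x => (G (κ * x ^ r).toNNReal : ℝ))
      hj hjd hC hChat hCD hβ hM hTB hT hc one_pos (fun x _ => NNReal.coe_nonneg _)
      (fun x hx y hy hxy => NNReal.coe_le_coe.2 (G.monotone (Real.toNNReal_le_toNNReal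
        (mul_le_mul_of_nonneg_left (Real.rpow_le_rpow hx.1 hxy hr.le) hκ.le))))
      (fun μ hμ x hx => by
        have h1 := OrderIso.apply_toNNReal_mul_le (inv_pos.2 hr) hG
          ⟨Real.rpow_nonneg hμ.1 r, Real.rpow_le_one hμ.1 hμ.2 hr.le⟩ (hscale x hx)
        rw [Real.rpow_rpow_inv hμ.1 hr.ne', mul_left_comm, ← Real.mul_rpow hμ.1 hx.1] at h1
        rwa [Real.rpow_one])
      (fun N z hN hz hzN z₁ y hz₁ hy => by
        refine le_trans ?_ (hobs z hz z₁ y hz₁ hy)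
        rw [mul_assoc]
        have hz0 : 0 < ‖(z : EnergySpace V X U)‖ := norm_pos_iff.2 hz
        gcongr
        rw [Real.toNNReal_le_iff_le_coe]
        push_cast
        rw [le_div_iff₀ (by positivity)]
        exact hlow z N hN hzN)
    refine hfin (fun t => (G.symm (1 / (1 + t)) : ℝ))
      (fun x => (G (κ * x ^ r).toNNReal : ℝ)) σ (fun t => NNReal.coe_nonneg _) hσ
      (fun e t he h => ?_) hdecay
    rw [← Real.toNNReal_le_iff_le_coe, OrderIso.le_symm_apply, ← NNReal.coe_le_coe]
    push_cast
    exact h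
  · intro hobs
    -- This is not the previous case with `G(x) = x`, whose monotonicity condition would require `θ
    -- ≤ 1/2`. Here `F` is homogeneous of degree `r`, which the decay lemma accepts for every `r >
    -- 0`.
    obtain ⟨σ, hσ, hdecay⟩ := exists_energy_decay (F := fun x => κ * x ^ r)
      hj hjd hC hChat hCD hβ hM hTB hT hc hr
      (fun x hx => mul_nonneg hκ.le (Real.rpow_nonneg hx.1 _))
      (fun x hx y hy hxy => mul_le_mul_of_nonneg_left (Real.rpow_le_rpow hx.1 hxy hr.le) hκ.le)
      (fun μ hμ x hx => by rw [Real.mul_rpow hμ.1 hx.1, mul_left_comm])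
      (fun N z hN hz hzN z₁ y hz₁ hy => by
        refine le_trans (mul_le_mul_of_nonneg_left ?_ hc.le) (hobs z hz z₁ y hz₁ hy)
        rw [mul_comm]
        exact hlow z N hN hzN)
    obtain ⟨K, hK, h⟩ := hfin (fun t => 1 / (1 + t)) (fun x => κ * x ^ r) σ (fun t => by positivity) hσ
      (fun e t he h => h) hdecay
    refine ⟨K, hK, fun z₀ z hz t => (h z₀ z hz t).trans_eq ?_⟩
    rw [Real.div_rpow zero_le_one (by positivity), Real.one_rpow]
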